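/- Let $k$ be a field and let $H$ be a Hopf algebra over $k$ whose antipode $S$ is bijective. All unadorned tensor products are over $k$. **Data.** Let $C$ be a (counital, coassociative) left $H$-module coalgebra, i.e. $(hc)_{(1)}\otimes (hc)_{(2)}=h_{(1)}c_{(1)}\otimes h_{(2)}c_{(2)}$ and $\varepsilon(hc)=\varepsilon(h)\varepsilon(c)$; let $A$ be a (unital, associative) left $H$-module algebra, i.e. $h(ab)=(h_{(1)}a)(h_{(2)}b)$ and $h1_A=\varepsilon(h)1_A$; and let $M$ be a left $H$-module that is also a left $H$-comodule $m\mapsto m_{(-1)}\otimes m_{(0)}$, with no compatibility assumed between the two structures. Let $\phi\colon C\otimes A\to A$ be an equivariant action of $C$ on $A$: $$\phi(c,ab)=\phi(c_{(1)},a)\,\phi(c_{(2)},b),\qquad \phi(c,1)=\varepsilon(c)1_A,\qquad h\,\phi(c,a)=\phi(hc,a).$$ **Cyclic objects.** Let $\Lambda$ be Connes' cyclic category. Cocyclic $k$-modules are covariant functors and cyclic $k$-modules are contravariant functors from $\Lambda$ to $k$-modules; ${\rm Ext}_\Lambda$ is taken in these abelian categories. Let $Cyc_\bullet(A)$ be the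 classical cyclic module of $A$ (with $A^{\otimes n+1}$ in degree $n$), let $k_\bullet$ be the classical cocyclic module of $k$ viewed as a coalgebra, and let $k_\bullet^\vee=Cyc_\bullet(k)$. For a cocyclic module $X_\bullet$ and a cyclic module $Y_\bullet$ let $diag{\rm Hom}_k(X_\bullet,Y_\bullet)$ be the cyclic module with ${\rm Hom}_k(X_n,Y_n)$ in degree $n$, on which each structure operator $\theta$ of $\Lambda$ acts by $f\mapsto \theta_Y\circ f\circ\theta_X$. Let $T_\bullet(C,M)$ be the para-cocyclic module with $T_n(C,M)=C^{\otimes n+1}\otimes M$ and $$\begin{aligned}\partial_0(c^0\otimes\cdots\otimes c^n\otimes m)&=c^0_{(1)}\otimes c^0_{(2)}\otimes c^1\otimes\cdots\otimes c^n\otimes m,\\ \sigma_0(c^0\otimes\cdots\otimes c^n\otimes m)&=\varepsilon(c^1)\,c^0\otimes c^2\otimes\cdots\otimes c^n\otimes m,\\ \tau_n(c^0\otimes\cdots\otimes c^n\otimes m)&=c^1\otimes\cdots\otimes c^n\otimes m_{(-1)}c^0\otimes m_{(0)},\end{aligned}$$ $\partial_j=\tau_{n+1}^{-j}\partial_0\tau_n^{j}$,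 $\sigma_j=\tau_{n-1}^{-j}\sigma_0\tau_n^{j}$; and let $T_\bullet(A,M)$ be the para-cyclic module with $T_n(A,M)=A^{\otimes n+1}\otimes M$ and $$\begin{aligned}\partial_0(a_0\otimes\cdots\otimes a_n\otimes m)&=a_0a_1\otimes a_2\otimes\cdots\otimes a_n\otimes m,\\ \sigma_0(a_0\otimes\cdots\otimes a_n\otimes m)&=a_0\otimes 1_A\otimes a_1\otimes\cdots\otimes a_n\otimes m,\\ \tau_n(a_0\otimes\cdots\otimes a_n\otimes m)&=S^{-1}(m_{(-1)})a_n\otimes a_0\otimes\cdots\otimes a_{n-1}\otimes m_{(0)},\end{aligned}$$ $\partial_j=\tau_{n-1}^{j}\partial_0\tau_n^{-j}$, $\sigma_j=\tau_{n+1}^{j}\sigma_0\tau_n^{-j}$. In both cases $H$ acts diagonally on each $T_n$; write $L_h$ for the action of $h$. Let $J_\bullet\subseteq T_\bullet$ be the smallest graded submodule that is a para-(co)cyclic submodule and an $H$-submodule in each degree and contains all elements $[L_h,\tau_n^i](\Psi)+(\tau_n^{n+1}-{\rm id})(\Phi)$ with $h\in H$, $i\in\mathbb Z$, $\Psi,\Phi\in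 T_n$. Put $Q_\bullet=T_\bullet/J_\bullet$ and let $C_\bullet(C,M)=k\otimes_H Q_\bullet(C,M)$ and $C_\bullet(A,M)=k\otimes_H Q_\bullet(A,M)$, which are a cocyclic and a cyclic $k$-module respectively. Define $$HC^n_{\rm Hopf}(C,M)={\rm Ext}^n_\Lambda(k_\bullet,C_\bullet(C,M)),\quad HC^n_{\rm Hopf}(A,M)={\rm Ext}^n_\Lambda(C_\bullet(A,M),k_\bullet^\vee),\quad HC^n(A)={\rm Ext}^n_\Lambda(Cyc_\bullet(A),k_\bullet^\vee).$$ **Theorem.** 1. There is a morphism of cyclic modules $\alpha_\bullet\colon Cyc_\bullet(A)\to diag{\rm Hom}_k(C_\bullet(C,M),C_\bullet(A,M))$ with $$\alpha_n(a_0\otimes\cdots\otimes a_n)\big([c^0\otimes\cdots\otimes c^n\otimes m]\big)=[\phi(c^0,a_0)\otimes\cdots\otimes\phi(c^n,a_n)\otimes m]$$ for all $n\ge 0$, $a_i\in A$, $c^i\in C$, $m\in M$, and an isomorphism of cyclic modules $e\colon diag{\rm Hom}_k(k_\bullet,C_\bullet(A,M))\cong C_\bullet(A,M)$, $g\mapsto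 g(1\otimes\cdots\otimes 1)$. (The functor $diag{\rm Hom}_k(\,\cdot\,,C_\bullet(A,M))$ is exact.) 2. For all $p,q\ge 0$ there is a $k$-linear pairing $$\smile\colon HC^p_{\rm Hopf}(C,M)\otimes HC^q_{\rm Hopf}(A,M)\to HC^{p+q}(A),$$ $$\xi\smile\nu={\rm Ext}^{p+q}_\Lambda(\alpha_\bullet,k_\bullet^\vee)\Big(diag{\rm Hom}_k(\xi,C_\bullet(A,M))\circ\nu\Big),$$ and it is the unique $k$-linear map with this property. Here $\xi$ is the class of any Yoneda $p$-extension, from $k_\bullet$ to $C_\bullet(C,M)$, i.e. of a splice of $p$ short exact sequences of cocyclic modules followed by a morphism into $C_\bullet(C,M)$ (just a morphism $k_\bullet\to C_\bullet(C,M)$ if $p=0$), $\nu$ is any element of $HC^q_{\rm Hopf}(A,M)$, $diag{\rm Hom}_k(\xi,C_\bullet(A,M))\in{\rm Ext}_\Lambda^p\big(diag{\rm Hom}_k(C_\bullet(C,M),C_\bullet(A,M)),\,diag{\rm Hom}_k(k_\bullet,C_\bullet(A,M))\big)$ is the Yoneda product, in reversed order, of the images of that morphism and of those short exact sequences under $diag{\rm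 Hom}_k(\,\cdot\,,C_\bullet(A,M))$, and $\circ$ is the Yoneda product (splicing) at $diag{\rm Hom}_k(k_\bullet,C_\bullet(A,M))\cong C_\bullet(A,M)$ via $e$, written so that ${\rm Ext}^p(X,Y)\otimes{\rm Ext}^q(Y,Z)\to{\rm Ext}^{p+q}(X,Z)$. -/

import Mathlib

open CategoryTheory TensorProduct

universe u v w

namespace HopfCyclic

noncomputable section

/-! ## Connes' cyclic category, by generators and relations -/

/-- The generators of the cyclic category: cofaces `δ i : [n] → [n+1]` for `0 ≤ i ≤ n + 1`,
codegeneracies `σ i : [n+1] → [n]` for `0 ≤ i ≤ n`, and the cyclic operators `τ : [n] → [n]`. -/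
inductive CycGen : ℕ → ℕ → Type
  | δ (n i : ℕ) (h : i ≤ n + 1) : CycGen n (n + 1)
  | σ (n i : ℕ) (h : i ≤ n) : CycGen (n + 1) n
  | τ (n : ℕ) : CycGen n n

/-- The quiver of generators of the cyclic category; its vertices are the natural numbers. -/
def CycQuiver : Type := ℕ

instance : Quiver CycQuiver where
  Hom a b := CycGen a b

namespace CycQuiver

/-- The vertex `[n]`, in the free category on the generators. -/
abbrev pt (n : ℕ) : Paths CycQuiver := (Paths.of CycQuiver).obj (n : CycQuiver)

/-- The generator `δ i`, in the free category. -/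
abbrev δ (n i : ℕ) (h : i ≤ n + 1) : pt n ⟶ pt (n + 1) :=
  (Paths.of CycQuiver).map (CycGen.δ n i h)

/-- The generator `σ i`, in the free category. -/
abbrev σ (n i : ℕ) (h : i ≤ n) : pt (n + 1) ⟶ pt n :=
  (Paths.of CycQuiver).map (CycGen.σ n i h)

/-- The generator `τ`, in the free category. -/
abbrev τ (n : ℕ) : pt n ⟶ pt n := (Paths.of CycQuiver).map (CycGen.τ n)

/-- The `j`-fold composite of an endomorphism. -/
def iter {D : Type u} [Category.{v} D] {X : D} (f : X ⟶ X) : ℕ → (X ⟶ X)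
  | 0 => 𝟙 X
  | j + 1 => iter f j ≫ f

/-- The relations of the cyclic category: the cosimplicial identities, the compatibility of the
cyclic operators with cofaces and codegeneracies, and `τ ^ (n + 1) = 1` on `[n]`. (`f ≫ g` is
"first `f`, then `g`".) -/
inductive Rel : HomRel (Paths CycQuiver)
  | δδ (n i j : ℕ) (h : i ≤ j) (hj : j ≤ n + 1) :
      Rel (δ n i (by omega) ≫ δ (n + 1) (j + 1) (by omega))
        (δ n j (by omega) ≫ δ (n + 1) i (by omega))
  | σσ (n i j : ℕ) (h : i ≤ j) (hj : j ≤ n) :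
      Rel (σ (n + 1) i (by omega) ≫ σ n j (by omega))
        (σ (n + 1) (j + 1) (by omega) ≫ σ n i (by omega))
  | δσ_le (n i j : ℕ) (h : i ≤ j) (hj : j ≤ n) :
      Rel (δ (n + 1) i (by omega) ≫ σ (n + 1) (j + 1) (by omega))
        (σ n j (by omega) ≫ δ n i (by omega))
  | δσ_self (n i : ℕ) (h : i ≤ n) :
      Rel (δ n i (by omega) ≫ σ n i (by omega)) (𝟙 _)
  | δσ_succ (n i : ℕ) (h : i ≤ n) :
      Rel (δ n (i + 1) (by omega) ≫ σ n i (by omega)) (𝟙 _)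
  | δσ_gt (n i j : ℕ) (h : j < i) (hi : i ≤ n + 1) :
      Rel (δ (n + 1) (i + 1) (by omega) ≫ σ (n + 1) j (by omega))
        (σ n j (by omega) ≫ δ n i (by omega))
  | δτ_succ (n i : ℕ) (h : i ≤ n) :
      Rel (δ n (i + 1) (by omega) ≫ τ (n + 1)) (τ n ≫ δ n i (by omega))
  | δτ_zero (n : ℕ) :
      Rel (δ n 0 (by omega) ≫ τ (n + 1)) (δ n (n + 1) (by omega))
  | στ_succ (n i : ℕ) (h : i + 1 ≤ n) :
      Rel (σ n (i + 1) (by omega) ≫ τ n) (τ (n + 1) ≫ σ n i (by omega))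
  | στ_zero (n : ℕ) :
      Rel (σ n 0 (by omega) ≫ τ n) (τ (n + 1) ≫ τ (n + 1) ≫ σ n n (by omega))
  | τ_pow (n : ℕ) : Rel (iter (τ n) (n + 1)) (𝟙 _)

end CycQuiver

/-- Connes' cyclic category `Λ`. -/
def CycCat : Type := CategoryTheory.Quotient CycQuiver.Rel

instance : SmallCategory CycCat := inferInstanceAs (Category (CategoryTheory.Quotient CycQuiver.Rel))

/-- The object `[n]` of `Λ`. -/
def CycCat.mk (n : ℕ) : CycCat := (CategoryTheory.Quotient.functor CycQuiver.Rel).obj (CycQuiver.pt n)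

/-- Cyclic `k`-modules: contravariant functors on `Λ`. -/
abbrev CyclicModule (k : Type u) [Field k] := CycCatᵒᵖ ⥤ ModuleCat.{u} k

/-- Cocyclic `k`-modules: covariant functors on `Λ`. -/
abbrev CocyclicModule (k : Type u) [Field k] := CycCat ⥤ ModuleCat.{u} k

/-- The value of a cyclic module at `[n]`. -/
abbrev CyclicModule.deg {k : Type u} [Field k] (Y : CyclicModule k) (n : ℕ) : ModuleCat.{u} k :=
  Y.obj (Opposite.op (CycCat.mk n))

/-- The value of a cocyclic module at `[n]`. -/
abbrev CocyclicModule.deg {k : Type u} [Field k] (X : CocyclicModule k) (n : ℕ) :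
    ModuleCat.{u} k :=
  X.obj (CycCat.mk n)

/-- The data that define a functor out of `Λ`: images of the generators, subject to the
relations. -/
structure CocyclicData (D : Type u) [Category.{v} D] where
  X : ℕ → D
  δ : ∀ n i : ℕ, i ≤ n + 1 → (X n ⟶ X (n + 1))
  σ : ∀ n i : ℕ, i ≤ n → (X (n + 1) ⟶ X n)
  τ : ∀ n : ℕ, X n ⟶ X n
  δδ : ∀ (n i j : ℕ) (_ : i ≤ j) (_ : j ≤ n + 1),
    δ n i (by omega) ≫ δ (n + 1) (j + 1) (by omega) = δ n j (by omega) ≫ δ (n + 1) i (by omega)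
  σσ : ∀ (n i j : ℕ) (_ : i ≤ j) (_ : j ≤ n),
    σ (n + 1) i (by omega) ≫ σ n j (by omega) = σ (n + 1) (j + 1) (by omega) ≫ σ n i (by omega)
  δσ_le : ∀ (n i j : ℕ) (_ : i ≤ j) (_ : j ≤ n),
    δ (n + 1) i (by omega) ≫ σ (n + 1) (j + 1) (by omega) = σ n j (by omega) ≫ δ n i (by omega)
  δσ_self : ∀ (n i : ℕ) (_ : i ≤ n), δ n i (by omega) ≫ σ n i (by omega) = 𝟙 _
  δσ_succ : ∀ (n i : ℕ) (_ : i ≤ n), δ n (i + 1) (by omega) ≫ σ n i (by omega) = 𝟙 _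
  δσ_gt : ∀ (n i j : ℕ) (_ : j < i) (_ : i ≤ n + 1),
    δ (n + 1) (i + 1) (by omega) ≫ σ (n + 1) j (by omega) = σ n j (by omega) ≫ δ n i (by omega)
  δτ_succ : ∀ (n i : ℕ) (_ : i ≤ n),
    δ n (i + 1) (by omega) ≫ τ (n + 1) = τ n ≫ δ n i (by omega)
  δτ_zero : ∀ n : ℕ, δ n 0 (by omega) ≫ τ (n + 1) = δ n (n + 1) (by omega)
  στ_succ : ∀ (n i : ℕ) (_ : i + 1 ≤ n),
    σ n (i + 1) (by omega) ≫ τ n = τ (n + 1) ≫ σ n i (by omega)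
  στ_zero : ∀ n : ℕ,
    σ n 0 (by omega) ≫ τ n = τ (n + 1) ≫ τ (n + 1) ≫ σ n n (by omega)
  τ_pow : ∀ n : ℕ, CycQuiver.iter (τ n) (n + 1) = 𝟙 _

namespace CocyclicData

variable {D : Type u} [Category.{v} D] (P : CocyclicData D)

/-- The action on generators. -/
def prefunctor : CycQuiver ⥤q D where
  obj n := P.X n
  map {_ _} g := match g with
    | CycGen.δ n i h => P.δ n i h
    | CycGen.σ n i h => P.σ n i h
    | CycGen.τ n => P.τ n

theorem lift_iter (n j : ℕ) :
    (Paths.lift P.prefunctor).map (CycQuiver.iter (CycQuiver.τ n) j) =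
      CycQuiver.iter (P.τ n) j := by
  induction j with
  | zero => exact (Paths.lift P.prefunctor).map_id _
  | succ j ih =>
    simp only [CycQuiver.iter, Functor.map_comp, ih]
    congr 1
    exact Paths.lift_toPath _ _

/-- The functor on `Λ` with prescribed values on the generators. -/
def functor : CycCat ⥤ D :=
  CategoryTheory.Quotient.lift CycQuiver.Rel (Paths.lift P.prefunctor) (by
    have hδ : ∀ n i h, (Paths.lift P.prefunctor).map (CycQuiver.δ n i h) = P.δ n i h :=
      fun n i h => Paths.lift_toPath _ _
    have hσ : ∀ n i h, (Paths.lift P.prefunctor).map (CycQuiver.σ n i h) = P.σ n i h :=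
      fun n i h => Paths.lift_toPath _ _
    have hτ : ∀ n, (Paths.lift P.prefunctor).map (CycQuiver.τ n) = P.τ n :=
      fun n => Paths.lift_toPath _ _
    intro x y f g r
    cases r
    case τ_pow n =>
      exact (P.lift_iter n (n + 1)).trans ((P.τ_pow n).trans
        ((Paths.lift P.prefunctor).map_id (CycQuiver.pt n)).symm)
    all_goals
      repeat rw [Functor.map_comp]
      simp only [hδ, hσ, hτ]
    · exact P.δδ _ _ _ ‹_› ‹_›
    · exact P.σσ _ _ _ ‹_› ‹_›
    · exact P.δσ_le _ _ _ ‹_› ‹_›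
    · exact P.δσ_self _ _ ‹_›
    · exact P.δσ_succ _ _ ‹_›
    · exact P.δσ_gt _ _ _ ‹_› ‹_›
    · exact P.δτ_succ _ _ ‹_›
    · exact P.δτ_zero _
    · exact P.στ_succ _ _ ‹_›
    · exact P.στ_zero _)

end CocyclicData

/-! ## Para-(co)cyclic modules and their quotients -/

/-- A para-cocyclic `k`-module: a cosimplicial `k`-module with invertible operators `t n` in each
degree, with all the relations of a cocyclic module except `t n ^ (n + 1) = 1`. -/
structure ParaCocyclic (k : Type u) [Field k] where
  X : ℕ → ModuleCat.{u} k
  d : ∀ n i : ℕ, i ≤ n + 1 → (X n →ₗ[k] X (n + 1))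
  s : ∀ n i : ℕ, i ≤ n → (X (n + 1) →ₗ[k] X n)
  t : ∀ n : ℕ, X n ≃ₗ[k] X n
  dd : ∀ (n i j : ℕ) (_ : i ≤ j) (_ : j ≤ n + 1) (x : X n),
    d (n + 1) (j + 1) (by omega) (d n i (by omega) x) =
      d (n + 1) i (by omega) (d n j (by omega) x)
  ss : ∀ (n i j : ℕ) (_ : i ≤ j) (_ : j ≤ n) (x : X (n + 1 + 1)),
    s n j (by omega) (s (n + 1) i (by omega) x) =
      s n i (by omega) (s (n + 1) (j + 1) (by omega) x)
  sd_le : ∀ (n i j : ℕ) (_ : i ≤ j) (_ : j ≤ n) (x : X (n + 1)),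
    s (n + 1) (j + 1) (by omega) (d (n + 1) i (by omega) x) =
      d n i (by omega) (s n j (by omega) x)
  sd_self : ∀ (n i : ℕ) (_ : i ≤ n) (x : X n), s n i (by omega) (d n i (by omega) x) = x
  sd_succ : ∀ (n i : ℕ) (_ : i ≤ n) (x : X n), s n i (by omega) (d n (i + 1) (by omega) x) = x
  sd_gt : ∀ (n i j : ℕ) (_ : j < i) (_ : i ≤ n + 1) (x : X (n + 1)),
    s (n + 1) j (by omega) (d (n + 1) (i + 1) (by omega) x) =
      d n i (by omega) (s n j (by omega) x)
  td_succ : ∀ (n i : ℕ) (_ : i ≤ n) (x : X n),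
    t (n + 1) (d n (i + 1) (by omega) x) = d n i (by omega) (t n x)
  td_zero : ∀ (n : ℕ) (x : X n), t (n + 1) (d n 0 (by omega) x) = d n (n + 1) (by omega) x
  ts_succ : ∀ (n i : ℕ) (_ : i + 1 ≤ n) (x : X (n + 1)),
    t n (s n (i + 1) (by omega) x) = s n i (by omega) (t (n + 1) x)
  ts_zero : ∀ (n : ℕ) (x : X (n + 1)),
    t n (s n 0 (by omega) x) = s n n (by omega) (t (n + 1) (t (n + 1) x))

/-- A para-cyclic `k`-module: a simplicial `k`-module with invertible operators `t n` in each
degree, with all the relations of a cyclic module except `t n ^ (n + 1) = 1`. -/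
structure ParaCyclic (k : Type u) [Field k] where
  X : ℕ → ModuleCat.{u} k
  d : ∀ n i : ℕ, i ≤ n + 1 → (X (n + 1) →ₗ[k] X n)
  s : ∀ n i : ℕ, i ≤ n → (X n →ₗ[k] X (n + 1))
  t : ∀ n : ℕ, X n ≃ₗ[k] X n
  dd : ∀ (n i j : ℕ) (_ : i ≤ j) (_ : j ≤ n + 1) (x : X (n + 1 + 1)),
    d n i (by omega) (d (n + 1) (j + 1) (by omega) x) =
      d n j (by omega) (d (n + 1) i (by omega) x)
  ss : ∀ (n i j : ℕ) (_ : i ≤ j) (_ : j ≤ n) (x : X n),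
    s (n + 1) i (by omega) (s n j (by omega) x) =
      s (n + 1) (j + 1) (by omega) (s n i (by omega) x)
  ds_le : ∀ (n i j : ℕ) (_ : i ≤ j) (_ : j ≤ n) (x : X (n + 1)),
    d (n + 1) i (by omega) (s (n + 1) (j + 1) (by omega) x) =
      s n j (by omega) (d n i (by omega) x)
  ds_self : ∀ (n i : ℕ) (_ : i ≤ n) (x : X n), d n i (by omega) (s n i (by omega) x) = x
  ds_succ : ∀ (n i : ℕ) (_ : i ≤ n) (x : X n), d n (i + 1) (by omega) (s n i (by omega) x) = x
  ds_gt : ∀ (n i j : ℕ) (_ : j < i) (_ : i ≤ n + 1) (x : X (n + 1)),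
    d (n + 1) (i + 1) (by omega) (s (n + 1) j (by omega) x) =
      s n j (by omega) (d n i (by omega) x)
  dt_succ : ∀ (n i : ℕ) (_ : i ≤ n) (x : X (n + 1)),
    d n (i + 1) (by omega) (t (n + 1) x) = t n (d n i (by omega) x)
  dt_zero : ∀ (n : ℕ) (x : X (n + 1)), d n 0 (by omega) (t (n + 1) x) = d n (n + 1) (by omega) x
  st_succ : ∀ (n i : ℕ) (_ : i + 1 ≤ n) (x : X n),
    s n (i + 1) (by omega) (t n x) = t (n + 1) (s n i (by omega) x)
  st_zero : ∀ (n : ℕ) (x : X n),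
    s n 0 (by omega) (t n x) = t (n + 1) (t (n + 1) (s n n (by omega) x))

/-- The iterates of the underlying categorical endomorphism are the powers. -/
theorem iter_ofHom {k : Type u} [Field k] {X : ModuleCat.{u} k} (f : X ≃ₗ[k] X) (j : ℕ) :
    CycQuiver.iter (ModuleCat.ofHom f.toLinearMap : X ⟶ X) j =
      ModuleCat.ofHom (f ^ j).toLinearMap := by
  induction j with
  | zero => rfl
  | succ j ih => rw [CycQuiver.iter, ih, pow_succ', ← ModuleCat.ofHom_comp]; rfl

/-- The same in the opposite category. -/
theorem iter_op_ofHom {k : Type u} [Field k] {X : ModuleCat.{u} k} (f : X ≃ₗ[k] X) (j : ℕ) :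
    CycQuiver.iter (ModuleCat.ofHom f.toLinearMap : X ⟶ X).op j =
      (ModuleCat.ofHom (f ^ j).toLinearMap).op := by
  induction j with
  | zero => rfl
  | succ j ih =>
    rw [CycQuiver.iter, ih, pow_succ, ← op_comp, ← ModuleCat.ofHom_comp]; rfl

namespace ParaCocyclic

variable {k : Type u} [Field k] (P : ParaCocyclic k)

/-- The cocyclic module (a functor on `Λ`) given by a para-cocyclic module that satisfies
`t n ^ (n + 1) = 1`. -/
def toCocyclic (h : ∀ n x, (P.t n ^ (n + 1)) x = x) : CocyclicModule k :=
  CocyclicData.functor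
    { X := P.X
      δ := fun n i hi => ModuleCat.ofHom (P.d n i hi)
      σ := fun n i hi => ModuleCat.ofHom (P.s n i hi)
      τ := fun n => ModuleCat.ofHom (P.t n).toLinearMap
      δδ := fun n i j h₁ h₂ => by ext x; exact P.dd n i j h₁ h₂ x
      σσ := fun n i j h₁ h₂ => by ext x; exact P.ss n i j h₁ h₂ x
      δσ_le := fun n i j h₁ h₂ => by ext x; exact P.sd_le n i j h₁ h₂ x
      δσ_self := fun n i h₁ => by ext x; exact P.sd_self n i h₁ x
      δσ_succ := fun n i h₁ => by ext x; exact P.sd_succ n i h₁ x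
      δσ_gt := fun n i j h₁ h₂ => by ext x; exact P.sd_gt n i j h₁ h₂ x
      δτ_succ := fun n i h₁ => by ext x; exact P.td_succ n i h₁ x
      δτ_zero := fun n => by ext x; exact P.td_zero n x
      στ_succ := fun n i h₁ => by ext x; exact P.ts_succ n i h₁ x
      στ_zero := fun n => by ext x; exact P.ts_zero n x
      τ_pow := fun n => by rw [iter_ofHom]; ext x; exact h n x }

/-- A graded submodule that is a para-cocyclic submodule. -/
structure IsSub (N : ∀ n, Submodule k (P.X n)) : Prop where
  d : ∀ n i hi, ∀ x ∈ N n, P.d n i hi x ∈ N (n + 1)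
  s : ∀ n i hi, ∀ x ∈ N (n + 1), P.s n i hi x ∈ N n
  t : ∀ n, ∀ x ∈ N n, P.t n x ∈ N n
  t_symm : ∀ n, ∀ x ∈ N n, (P.t n).symm x ∈ N n

/-- The quotient of a para-cocyclic module by a para-cocyclic submodule. -/
def quot (N : ∀ n, Submodule k (P.X n)) (hN : P.IsSub N) : ParaCocyclic k where
  X n := ModuleCat.of k (P.X n ⧸ N n)
  d n i hi := (N n).mapQ (N (n + 1)) (P.d n i hi) (hN.d n i hi)
  s n i hi := (N (n + 1)).mapQ (N n) (P.s n i hi) (hN.s n i hi)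
  t n := Submodule.Quotient.equiv (N n) (N n) (P.t n) (le_antisymm
    (by rintro _ ⟨x, hx, rfl⟩; exact hN.t n x hx)
    (fun x hx => ⟨(P.t n).symm x, hN.t_symm n x hx, (P.t n).apply_symm_apply x⟩))
  dd n i j h₁ h₂ x := by
    obtain ⟨x, rfl⟩ := Submodule.Quotient.mk_surjective _ x
    exact congrArg (Submodule.Quotient.mk) (P.dd n i j h₁ h₂ x)
  ss n i j h₁ h₂ x := by
    obtain ⟨x, rfl⟩ := Submodule.Quotient.mk_surjective _ x
    exact congrArg (Submodule.Quotient.mk) (P.ss n i j h₁ h₂ x)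
  sd_le n i j h₁ h₂ x := by
    obtain ⟨x, rfl⟩ := Submodule.Quotient.mk_surjective _ x
    exact congrArg (Submodule.Quotient.mk) (P.sd_le n i j h₁ h₂ x)
  sd_self n i h₁ x := by
    obtain ⟨x, rfl⟩ := Submodule.Quotient.mk_surjective _ x
    exact congrArg (Submodule.Quotient.mk) (P.sd_self n i h₁ x)
  sd_succ n i h₁ x := by
    obtain ⟨x, rfl⟩ := Submodule.Quotient.mk_surjective _ x
    exact congrArg (Submodule.Quotient.mk) (P.sd_succ n i h₁ x)
  sd_gt n i j h₁ h₂ x := by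
    obtain ⟨x, rfl⟩ := Submodule.Quotient.mk_surjective _ x
    exact congrArg (Submodule.Quotient.mk) (P.sd_gt n i j h₁ h₂ x)
  td_succ n i h₁ x := by
    obtain ⟨x, rfl⟩ := Submodule.Quotient.mk_surjective _ x
    exact congrArg (Submodule.Quotient.mk) (P.td_succ n i h₁ x)
  td_zero n x := by
    obtain ⟨x, rfl⟩ := Submodule.Quotient.mk_surjective _ x
    exact congrArg (Submodule.Quotient.mk) (P.td_zero n x)
  ts_succ n i h₁ x := by
    obtain ⟨x, rfl⟩ := Submodule.Quotient.mk_surjective _ x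
    exact congrArg (Submodule.Quotient.mk) (P.ts_succ n i h₁ x)
  ts_zero n x := by
    obtain ⟨x, rfl⟩ := Submodule.Quotient.mk_surjective _ x
    exact congrArg (Submodule.Quotient.mk) (P.ts_zero n x)

/-- The projection onto the quotient. -/
def quotMk (N : ∀ n, Submodule k (P.X n)) (hN : P.IsSub N) (n : ℕ) :
    P.X n →ₗ[k] (P.quot N hN).X n :=
  (N n).mkQ

theorem quotMk_surjective (N : ∀ n, Submodule k (P.X n)) (hN : P.IsSub N) (n : ℕ) :
    Function.Surjective (P.quotMk N hN n) :=
  Submodule.mkQ_surjective (N n)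

theorem quot_t_pow (N : ∀ n, Submodule k (P.X n)) (hN : P.IsSub N) (n j : ℕ) (x : P.X n) :
    ((P.quot N hN).t n ^ j) (P.quotMk N hN n x) = P.quotMk N hN n ((P.t n ^ j) x) := by
  induction j with
  | zero => rfl
  | succ j ih =>
    rw [pow_succ', pow_succ']
    exact congrArg ((P.quot N hN).t n) ih

end ParaCocyclic

namespace ParaCyclic

variable {k : Type u} [Field k] (P : ParaCyclic k)

/-- The cyclic module (a contravariant functor on `Λ`) given by a para-cyclic module that
satisfies `t n ^ (n + 1) = 1`. -/
def toCyclic (h : ∀ n x, (P.t n ^ (n + 1)) x = x) : CyclicModule k :=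
  (CocyclicData.functor (D := (ModuleCat.{u} k)ᵒᵖ)
    { X := fun n => Opposite.op (P.X n)
      δ := fun n i hi => (ModuleCat.ofHom (P.d n i hi)).op
      σ := fun n i hi => (ModuleCat.ofHom (P.s n i hi)).op
      τ := fun n => (ModuleCat.ofHom (P.t n).toLinearMap).op
      δδ := fun n i j h₁ h₂ => Quiver.Hom.unop_inj (by ext x; exact P.dd n i j h₁ h₂ x)
      σσ := fun n i j h₁ h₂ => Quiver.Hom.unop_inj (by ext x; exact P.ss n i j h₁ h₂ x)
      δσ_le := fun n i j h₁ h₂ => Quiver.Hom.unop_inj (by ext x; exact P.ds_le n i j h₁ h₂ x)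
      δσ_self := fun n i h₁ => Quiver.Hom.unop_inj (by ext x; exact P.ds_self n i h₁ x)
      δσ_succ := fun n i h₁ => Quiver.Hom.unop_inj (by ext x; exact P.ds_succ n i h₁ x)
      δσ_gt := fun n i j h₁ h₂ => Quiver.Hom.unop_inj (by ext x; exact P.ds_gt n i j h₁ h₂ x)
      δτ_succ := fun n i h₁ => Quiver.Hom.unop_inj (by ext x; exact P.dt_succ n i h₁ x)
      δτ_zero := fun n => Quiver.Hom.unop_inj (by ext x; exact P.dt_zero n x)
      στ_succ := fun n i h₁ => Quiver.Hom.unop_inj (by ext x; exact P.st_succ n i h₁ x)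
      στ_zero := fun n => Quiver.Hom.unop_inj (by ext x; exact P.st_zero n x)
      τ_pow := fun n => by
        rw [iter_op_ofHom]
        exact Quiver.Hom.unop_inj (by ext x; exact h n x) }).leftOp

/-- A graded submodule that is a para-cyclic submodule. -/
structure IsSub (N : ∀ n, Submodule k (P.X n)) : Prop where
  d : ∀ n i hi, ∀ x ∈ N (n + 1), P.d n i hi x ∈ N n
  s : ∀ n i hi, ∀ x ∈ N n, P.s n i hi x ∈ N (n + 1)
  t : ∀ n, ∀ x ∈ N n, P.t n x ∈ N n
  t_symm : ∀ n, ∀ x ∈ N n, (P.t n).symm x ∈ N n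

/-- The quotient of a para-cyclic module by a para-cyclic submodule. -/
def quot (N : ∀ n, Submodule k (P.X n)) (hN : P.IsSub N) : ParaCyclic k where
  X n := ModuleCat.of k (P.X n ⧸ N n)
  d n i hi := (N (n + 1)).mapQ (N n) (P.d n i hi) (hN.d n i hi)
  s n i hi := (N n).mapQ (N (n + 1)) (P.s n i hi) (hN.s n i hi)
  t n := Submodule.Quotient.equiv (N n) (N n) (P.t n) (le_antisymm
    (by rintro _ ⟨x, hx, rfl⟩; exact hN.t n x hx)
    (fun x hx => ⟨(P.t n).symm x, hN.t_symm n x hx, (P.t n).apply_symm_apply x⟩))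
  dd n i j h₁ h₂ x := by
    obtain ⟨x, rfl⟩ := Submodule.Quotient.mk_surjective _ x
    exact congrArg (Submodule.Quotient.mk) (P.dd n i j h₁ h₂ x)
  ss n i j h₁ h₂ x := by
    obtain ⟨x, rfl⟩ := Submodule.Quotient.mk_surjective _ x
    exact congrArg (Submodule.Quotient.mk) (P.ss n i j h₁ h₂ x)
  ds_le n i j h₁ h₂ x := by
    obtain ⟨x, rfl⟩ := Submodule.Quotient.mk_surjective _ x
    exact congrArg (Submodule.Quotient.mk) (P.ds_le n i j h₁ h₂ x)
  ds_self n i h₁ x := by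
    obtain ⟨x, rfl⟩ := Submodule.Quotient.mk_surjective _ x
    exact congrArg (Submodule.Quotient.mk) (P.ds_self n i h₁ x)
  ds_succ n i h₁ x := by
    obtain ⟨x, rfl⟩ := Submodule.Quotient.mk_surjective _ x
    exact congrArg (Submodule.Quotient.mk) (P.ds_succ n i h₁ x)
  ds_gt n i j h₁ h₂ x := by
    obtain ⟨x, rfl⟩ := Submodule.Quotient.mk_surjective _ x
    exact congrArg (Submodule.Quotient.mk) (P.ds_gt n i j h₁ h₂ x)
  dt_succ n i h₁ x := by
    obtain ⟨x, rfl⟩ := Submodule.Quotient.mk_surjective _ x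
    exact congrArg (Submodule.Quotient.mk) (P.dt_succ n i h₁ x)
  dt_zero n x := by
    obtain ⟨x, rfl⟩ := Submodule.Quotient.mk_surjective _ x
    exact congrArg (Submodule.Quotient.mk) (P.dt_zero n x)
  st_succ n i h₁ x := by
    obtain ⟨x, rfl⟩ := Submodule.Quotient.mk_surjective _ x
    exact congrArg (Submodule.Quotient.mk) (P.st_succ n i h₁ x)
  st_zero n x := by
    obtain ⟨x, rfl⟩ := Submodule.Quotient.mk_surjective _ x
    exact congrArg (Submodule.Quotient.mk) (P.st_zero n x)

/-- The projection onto the quotient. -/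
def quotMk (N : ∀ n, Submodule k (P.X n)) (hN : P.IsSub N) (n : ℕ) :
    P.X n →ₗ[k] (P.quot N hN).X n :=
  (N n).mkQ

theorem quotMk_surjective (N : ∀ n, Submodule k (P.X n)) (hN : P.IsSub N) (n : ℕ) :
    Function.Surjective (P.quotMk N hN n) :=
  Submodule.mkQ_surjective (N n)

theorem quot_t_pow (N : ∀ n, Submodule k (P.X n)) (hN : P.IsSub N) (n j : ℕ) (x : P.X n) :
    ((P.quot N hN).t n ^ j) (P.quotMk N hN n x) = P.quotMk N hN n ((P.t n ^ j) x) := by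
  induction j with
  | zero => rfl
  | succ j ih =>
    rw [pow_succ', pow_succ']
    exact congrArg ((P.quot N hN).t n) ih

end ParaCyclic

/-- A para-cocyclic module with operators `L n h`, `h ∈ H`, in each degree, that commute with the
cofaces `d n i` for `i ≤ n` and with the codegeneracies (but not with `t n` or the last coface). -/
structure HParaCocyclic (k : Type u) [Field k] (H : Type w) extends ParaCocyclic k where
  L : ∀ n : ℕ, H → (X n →ₗ[k] X n)
  L_d : ∀ (n i : ℕ) (_ : i ≤ n) (h : H) (x : X n),
    L (n + 1) h (d n i (by omega) x) = d n i (by omega) (L n h x)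
  L_s : ∀ (n i : ℕ) (hi : i ≤ n) (h : H) (x : X (n + 1)),
    L n h (s n i hi x) = s n i hi (L (n + 1) h x)

namespace HParaCocyclic

variable {k : Type u} [Field k] {H : Type w} (P : HParaCocyclic k H)

/-- The graded submodules that are para-cocyclic `k`-submodules and graded `H`-submodules, and
contain all elements `[L_h, t ^ i] Ψ + (t ^ (n + 1) - 1) Φ`, where `i` is any integer. -/
structure Admissible (N : ∀ n, Submodule k (P.X n)) : Prop extends P.IsSub N where
  L : ∀ n h, ∀ x ∈ N n, P.L n h x ∈ N n
  gen : ∀ (n : ℕ) (h : H) (i : ℤ) (Ψ Φ : P.X n),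
    (P.L n h ((P.t n ^ i) Ψ) - (P.t n ^ i) (P.L n h Ψ)) + ((P.t n ^ (n + 1)) Φ - Φ) ∈ N n

/-- The smallest admissible graded submodule `J`. -/
def J (n : ℕ) : Submodule k (P.X n) :=
  (sInf {N : ∀ n, Submodule k (P.X n) | P.Admissible N}) n

theorem mem_J {n : ℕ} {x : P.X n} : x ∈ P.J n ↔ ∀ N, P.Admissible N → x ∈ N n := by
  simp [J, sInf_apply, Submodule.mem_iInf]

theorem J_admissible : P.Admissible P.J where
  d n i hi x hx := P.mem_J.2 fun N hN => hN.d n i hi x (P.mem_J.1 hx N hN)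
  s n i hi x hx := P.mem_J.2 fun N hN => hN.s n i hi x (P.mem_J.1 hx N hN)
  t n x hx := P.mem_J.2 fun N hN => hN.t n x (P.mem_J.1 hx N hN)
  t_symm n x hx := P.mem_J.2 fun N hN => hN.t_symm n x (P.mem_J.1 hx N hN)
  L n h x hx := P.mem_J.2 fun N hN => hN.L n h x (P.mem_J.1 hx N hN)
  gen n h i Ψ Φ := P.mem_J.2 fun _ hN => hN.gen n h i Ψ Φ

/-- The quotient `Q = T / J`. -/
def Q : ParaCocyclic k := P.quot P.J P.J_admissible.toIsSub

/-- The projection `T → Q`. -/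
def toQ (n : ℕ) : P.X n →ₗ[k] P.Q.X n := P.quotMk P.J P.J_admissible.toIsSub n

theorem toQ_surjective (n : ℕ) : Function.Surjective (P.toQ n) :=
  P.quotMk_surjective P.J P.J_admissible.toIsSub n

theorem toQ_eq {n : ℕ} {x y : P.X n} (h : x - y ∈ P.J n) : P.toQ n x = P.toQ n y :=
  (Submodule.Quotient.eq (P.J n)).2 h

/-- The action of `h ∈ H` on `Q`. -/
def LQ (n : ℕ) (h : H) : P.Q.X n →ₗ[k] P.Q.X n :=
  (P.J n).mapQ (P.J n) (P.L n h) (P.J_admissible.L n h)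

theorem Q_t_pow [Nonempty H] (n : ℕ) (x : P.Q.X n) : (P.Q.t n ^ (n + 1)) x = x := by
  obtain ⟨x, rfl⟩ := P.toQ_surjective n x
  refine (P.quot_t_pow P.J P.J_admissible.toIsSub n (n + 1) x).trans (P.toQ_eq ?_)
  obtain ⟨h⟩ := ‹Nonempty H›
  simpa using P.J_admissible.gen n h 0 0 x

/-- The submodule of `Q` spanned by the elements `h x - ε(h) x`. -/
def augSub (ε : H → k) (n : ℕ) : Submodule k (P.Q.X n) :=
  Submodule.span k {y | ∃ (h : H) (x : P.Q.X n), y = P.LQ n h x - ε h • x}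

theorem LQ_t (n : ℕ) (h : H) (x : P.Q.X n) : P.LQ n h (P.Q.t n x) = P.Q.t n (P.LQ n h x) := by
  obtain ⟨x, rfl⟩ := P.toQ_surjective n x
  refine P.toQ_eq (x := P.L n h (P.t n x)) (y := P.t n (P.L n h x)) ?_
  have := P.J_admissible.gen n h 1 x 0
  simpa using this

theorem LQ_d (n i : ℕ) (hi : i ≤ n + 1) (h : H) (x : P.Q.X n) :
    P.LQ (n + 1) h (P.Q.d n i hi x) = P.Q.d n i hi (P.LQ n h x) := by
  have key : ∀ (i : ℕ) (hi : i ≤ n) (x : P.Q.X n),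
      P.LQ (n + 1) h (P.Q.d n i (by omega) x) = P.Q.d n i (by omega) (P.LQ n h x) := by
    intro i hi x
    obtain ⟨x, rfl⟩ := P.toQ_surjective n x
    exact congrArg (P.toQ (n + 1)) (P.L_d n i hi h x)
  rcases Nat.lt_or_ge n i with hlt | hle
  · obtain rfl : i = n + 1 := by omega
    rw [← P.Q.td_zero, ← P.Q.td_zero, LQ_t, key 0 (by omega)]
  · exact key i hle x

theorem LQ_s (n i : ℕ) (hi : i ≤ n) (h : H) (x : P.Q.X (n + 1)) :
    P.LQ n h (P.Q.s n i hi x) = P.Q.s n i hi (P.LQ (n + 1) h x) := by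
  obtain ⟨x, rfl⟩ := P.toQ_surjective (n + 1) x
  exact congrArg (P.toQ n) (P.L_s n i hi h x)

theorem augSub_map (ε : H → k) {m n : ℕ} (f : P.Q.X m →ₗ[k] P.Q.X n)
    (hf : ∀ h x, P.LQ n h (f x) = f (P.LQ m h x)) :
    ∀ x ∈ P.augSub ε m, f x ∈ P.augSub ε n := by
  intro x hx
  refine (Submodule.span_le (p := (P.augSub ε n).comap f)).2 ?_ hx
  rintro _ ⟨h, y, rfl⟩
  refine Submodule.subset_span ⟨h, f y, ?_⟩
  rw [map_sub, map_smul, hf]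

theorem augSub_isSub (ε : H → k) : P.Q.IsSub (P.augSub ε) where
  d n i hi := P.augSub_map ε _ fun h x => P.LQ_d n i hi h x
  s n i hi := P.augSub_map ε _ fun h x => P.LQ_s n i hi h x
  t n := P.augSub_map ε (P.Q.t n).toLinearMap fun h x => P.LQ_t n h x
  t_symm n := P.augSub_map ε (P.Q.t n).symm.toLinearMap fun h x => by
    apply (P.Q.t n).injective
    simp only [LinearEquiv.coe_coe]
    rw [← LQ_t, LinearEquiv.apply_symm_apply, LinearEquiv.apply_symm_apply]

/-- The coinvariants `k ⊗_H Q = Q / span (h x - ε(h) x)`. -/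
def coinv (ε : H → k) : ParaCocyclic k := P.Q.quot (P.augSub ε) (P.augSub_isSub ε)

theorem coinv_t_pow [Nonempty H] (ε : H → k) (n : ℕ) (x : (P.coinv ε).X n) :
    ((P.coinv ε).t n ^ (n + 1)) x = x := by
  obtain ⟨x, rfl⟩ := P.Q.quotMk_surjective (P.augSub ε) (P.augSub_isSub ε) n x
  refine (P.Q.quot_t_pow (P.augSub ε) (P.augSub_isSub ε) n (n + 1) x).trans ?_
  rw [P.Q_t_pow]

/-- The cocyclic module `k ⊗_H Q`. -/
def hopf [Nonempty H] (ε : H → k) : CocyclicModule k := (P.coinv ε).toCocyclic (P.coinv_t_pow ε)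

/-- The projection from `T` to `k ⊗_H Q`. -/
def toHopf [Nonempty H] (ε : H → k) (n : ℕ) : P.X n →ₗ[k] (P.hopf ε).deg n :=
  P.Q.quotMk (P.augSub ε) (P.augSub_isSub ε) n ∘ₗ P.toQ n

end HParaCocyclic

/-- A para-cyclic module with operators `L n h`, `h ∈ H`, in each degree, that commute with the
faces `d n i` for `i ≤ n` and with the degeneracies (but not with `t n` or the last face). -/
structure HParaCyclic (k : Type u) [Field k] (H : Type w) extends ParaCyclic k where
  L : ∀ n : ℕ, H → (X n →ₗ[k] X n)
  L_d : ∀ (n i : ℕ) (_ : i ≤ n) (h : H) (x : X (n + 1)),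
    L n h (d n i (by omega) x) = d n i (by omega) (L (n + 1) h x)
  L_s : ∀ (n i : ℕ) (hi : i ≤ n) (h : H) (x : X n),
    L (n + 1) h (s n i hi x) = s n i hi (L n h x)

namespace HParaCyclic

variable {k : Type u} [Field k] {H : Type w} (P : HParaCyclic k H)

/-- The graded submodules that are para-cyclic `k`-submodules and graded `H`-submodules, and
contain all elements `[L_h, t ^ i] Ψ + (t ^ (n + 1) - 1) Φ`, where `i` is any integer. -/
structure Admissible (N : ∀ n, Submodule k (P.X n)) : Prop extends P.IsSub N where
  L : ∀ n h, ∀ x ∈ N n, P.L n h x ∈ N n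
  gen : ∀ (n : ℕ) (h : H) (i : ℤ) (Ψ Φ : P.X n),
    (P.L n h ((P.t n ^ i) Ψ) - (P.t n ^ i) (P.L n h Ψ)) + ((P.t n ^ (n + 1)) Φ - Φ) ∈ N n

/-- The smallest admissible graded submodule `J`. -/
def J (n : ℕ) : Submodule k (P.X n) :=
  (sInf {N : ∀ n, Submodule k (P.X n) | P.Admissible N}) n

theorem mem_J {n : ℕ} {x : P.X n} : x ∈ P.J n ↔ ∀ N, P.Admissible N → x ∈ N n := by
  simp [J, sInf_apply, Submodule.mem_iInf]

theorem J_admissible : P.Admissible P.J where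
  d n i hi x hx := P.mem_J.2 fun N hN => hN.d n i hi x (P.mem_J.1 hx N hN)
  s n i hi x hx := P.mem_J.2 fun N hN => hN.s n i hi x (P.mem_J.1 hx N hN)
  t n x hx := P.mem_J.2 fun N hN => hN.t n x (P.mem_J.1 hx N hN)
  t_symm n x hx := P.mem_J.2 fun N hN => hN.t_symm n x (P.mem_J.1 hx N hN)
  L n h x hx := P.mem_J.2 fun N hN => hN.L n h x (P.mem_J.1 hx N hN)
  gen n h i Ψ Φ := P.mem_J.2 fun _ hN => hN.gen n h i Ψ Φ

/-- The quotient `Q = T / J`. -/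
def Q : ParaCyclic k := P.quot P.J P.J_admissible.toIsSub

/-- The projection `T → Q`. -/
def toQ (n : ℕ) : P.X n →ₗ[k] P.Q.X n := P.quotMk P.J P.J_admissible.toIsSub n

theorem toQ_surjective (n : ℕ) : Function.Surjective (P.toQ n) :=
  P.quotMk_surjective P.J P.J_admissible.toIsSub n

theorem toQ_eq {n : ℕ} {x y : P.X n} (h : x - y ∈ P.J n) : P.toQ n x = P.toQ n y :=
  (Submodule.Quotient.eq (P.J n)).2 h

/-- The action of `h ∈ H` on `Q`. -/
def LQ (n : ℕ) (h : H) : P.Q.X n →ₗ[k] P.Q.X n :=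
  (P.J n).mapQ (P.J n) (P.L n h) (P.J_admissible.L n h)

theorem Q_t_pow [Nonempty H] (n : ℕ) (x : P.Q.X n) : (P.Q.t n ^ (n + 1)) x = x := by
  obtain ⟨x, rfl⟩ := P.toQ_surjective n x
  refine (P.quot_t_pow P.J P.J_admissible.toIsSub n (n + 1) x).trans (P.toQ_eq ?_)
  obtain ⟨h⟩ := ‹Nonempty H›
  simpa using P.J_admissible.gen n h 0 0 x

/-- The submodule of `Q` spanned by the elements `h x - ε(h) x`. -/
def augSub (ε : H → k) (n : ℕ) : Submodule k (P.Q.X n) :=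
  Submodule.span k {y | ∃ (h : H) (x : P.Q.X n), y = P.LQ n h x - ε h • x}

theorem LQ_t (n : ℕ) (h : H) (x : P.Q.X n) : P.LQ n h (P.Q.t n x) = P.Q.t n (P.LQ n h x) := by
  obtain ⟨x, rfl⟩ := P.toQ_surjective n x
  refine P.toQ_eq (x := P.L n h (P.t n x)) (y := P.t n (P.L n h x)) ?_
  have := P.J_admissible.gen n h 1 x 0
  simpa using this

theorem LQ_d (n i : ℕ) (hi : i ≤ n + 1) (h : H) (x : P.Q.X (n + 1)) :
    P.LQ n h (P.Q.d n i hi x) = P.Q.d n i hi (P.LQ (n + 1) h x) := by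
  have key : ∀ (i : ℕ) (hi : i ≤ n) (x : P.Q.X (n + 1)),
      P.LQ n h (P.Q.d n i (by omega) x) = P.Q.d n i (by omega) (P.LQ (n + 1) h x) := by
    intro i hi x
    obtain ⟨x, rfl⟩ := P.toQ_surjective (n + 1) x
    exact congrArg (P.toQ n) (P.L_d n i hi h x)
  rcases Nat.lt_or_ge n i with hlt | hle
  · obtain rfl : i = n + 1 := by omega
    rw [← P.Q.dt_zero, ← P.Q.dt_zero, key 0 (by omega), LQ_t]
  · exact key i hle x

theorem LQ_s (n i : ℕ) (hi : i ≤ n) (h : H) (x : P.Q.X n) :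
    P.LQ (n + 1) h (P.Q.s n i hi x) = P.Q.s n i hi (P.LQ n h x) := by
  obtain ⟨x, rfl⟩ := P.toQ_surjective n x
  exact congrArg (P.toQ (n + 1)) (P.L_s n i hi h x)

theorem augSub_map (ε : H → k) {m n : ℕ} (f : P.Q.X m →ₗ[k] P.Q.X n)
    (hf : ∀ h x, P.LQ n h (f x) = f (P.LQ m h x)) :
    ∀ x ∈ P.augSub ε m, f x ∈ P.augSub ε n := by
  intro x hx
  refine (Submodule.span_le (p := (P.augSub ε n).comap f)).2 ?_ hx
  rintro _ ⟨h, y, rfl⟩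
  refine Submodule.subset_span ⟨h, f y, ?_⟩
  rw [map_sub, map_smul, hf]

theorem augSub_isSub (ε : H → k) : P.Q.IsSub (P.augSub ε) where
  d n i hi := P.augSub_map ε _ fun h x => P.LQ_d n i hi h x
  s n i hi := P.augSub_map ε _ fun h x => P.LQ_s n i hi h x
  t n := P.augSub_map ε (P.Q.t n).toLinearMap fun h x => P.LQ_t n h x
  t_symm n := P.augSub_map ε (P.Q.t n).symm.toLinearMap fun h x => by
    apply (P.Q.t n).injective
    simp only [LinearEquiv.coe_coe]
    rw [← LQ_t, LinearEquiv.apply_symm_apply, LinearEquiv.apply_symm_apply]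

/-- The coinvariants `k ⊗_H Q = Q / span (h x - ε(h) x)`. -/
def coinv (ε : H → k) : ParaCyclic k := P.Q.quot (P.augSub ε) (P.augSub_isSub ε)

theorem coinv_t_pow [Nonempty H] (ε : H → k) (n : ℕ) (x : (P.coinv ε).X n) :
    ((P.coinv ε).t n ^ (n + 1)) x = x := by
  obtain ⟨x, rfl⟩ := P.Q.quotMk_surjective (P.augSub ε) (P.augSub_isSub ε) n x
  refine (P.Q.quot_t_pow (P.augSub ε) (P.augSub_isSub ε) n (n + 1) x).trans ?_
  rw [P.Q_t_pow]

/-- The cyclic module `k ⊗_H Q`. -/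
def hopf [Nonempty H] (ε : H → k) : CyclicModule k := (P.coinv ε).toCyclic (P.coinv_t_pow ε)

/-- The projection from `T` to `k ⊗_H Q`. -/
def toHopf [Nonempty H] (ε : H → k) (n : ℕ) : P.X n →ₗ[k] (P.hopf ε).deg n :=
  P.Q.quotMk (P.augSub ε) (P.augSub_isSub ε) n ∘ₗ P.toQ n

end HParaCyclic

/-! ## Iterated tensor products and the operations on single slots -/

section Tensor

variable (k : Type u) [Field k]

/-- `V ⊗ (V ⊗ ⋯ (V ⊗ M))` with `n` factors `V`, i.e. `V^{⊗ n} ⊗ M`. -/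
def tpow (V M : Type u) [AddCommGroup V] [Module k V] [AddCommGroup M] [Module k M] :
    ℕ → ModuleCat.{u} k
  | 0 => ModuleCat.of k M
  | n + 1 => ModuleCat.of k (V ⊗[k] tpow V M n)

variable {V M : Type u} [AddCommGroup V] [Module k V] [AddCommGroup M] [Module k M]

/-- The pure tensor `v 0 ⊗ v 1 ⊗ ⋯ ⊗ v (n - 1) ⊗ m`. -/
def tens : ∀ n : ℕ, (ℕ → V) → M → tpow k V M n
  | 0, _, m => m
  | n + 1, v, m => (v 0 ⊗ₜ[k] tens n (fun i => v (i + 1)) m : V ⊗[k] tpow k V M n)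

variable (V) in
/-- Swap the first two slots, then apply `f` behind the first slot. -/
def step {X Z : Type u} [AddCommGroup X] [Module k X] [AddCommGroup Z] [Module k Z]
    (f : V ⊗[k] X →ₗ[k] Z) : V ⊗[k] (V ⊗[k] X) →ₗ[k] V ⊗[k] Z :=
  LinearMap.lTensor V f ∘ₗ (TensorProduct.leftComm k V V X).toLinearMap

/-- Move the first slot to the end: `v 0 ⊗ ⋯ ⊗ v n ⊗ m ↦ v 1 ⊗ ⋯ ⊗ v n ⊗ w (v 0 ⊗ m)`. -/
def push (w : V ⊗[k] M ≃ₗ[k] V ⊗[k] M) : ∀ n : ℕ, tpow k V M (n + 1) ≃ₗ[k] tpow k V M (n + 1)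
  | 0 => w
  | n + 1 => (TensorProduct.leftComm k V V (tpow k V M n)).trans (LinearEquiv.lTensor V (push w n))

variable {X Y Z W : Type u} [AddCommGroup X] [Module k X] [AddCommGroup Y] [Module k Y]
  [AddCommGroup Z] [Module k Z] [AddCommGroup W] [Module k W]

theorem lT_square {f : X →ₗ[k] Y} {g : Y →ₗ[k] Z} {f' : X →ₗ[k] W} {g' : W →ₗ[k] Z}
    (h : g ∘ₗ f = g' ∘ₗ f') :
    LinearMap.lTensor V g ∘ₗ LinearMap.lTensor V f =
      LinearMap.lTensor V g' ∘ₗ LinearMap.lTensor V f' := by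
  rw [← LinearMap.lTensor_comp, h, LinearMap.lTensor_comp]

theorem lT_id {f : X →ₗ[k] Y} {g : Y →ₗ[k] X} (h : g ∘ₗ f = LinearMap.id) :
    LinearMap.lTensor V g ∘ₗ LinearMap.lTensor V f = LinearMap.id := by
  rw [← LinearMap.lTensor_comp, h, LinearMap.lTensor_id]

theorem step_square {a : X →ₗ[k] Y} {g : V ⊗[k] Y →ₗ[k] W} {f : V ⊗[k] X →ₗ[k] Z}
    {b : Z →ₗ[k] W} (h : g ∘ₗ LinearMap.lTensor V a = b ∘ₗ f) :
    step k V g ∘ₗ LinearMap.lTensor V (LinearMap.lTensor V a) =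
      LinearMap.lTensor V b ∘ₗ step k V f := by
  ext c d x
  have := LinearMap.congr_fun h (c ⊗ₜ x)
  simp at this
  simp [step, this]

theorem lT_step {g : Z →ₗ[k] W} {f : V ⊗[k] X →ₗ[k] Z} {h : V ⊗[k] X →ₗ[k] W}
    (e : g ∘ₗ f = h) :
    LinearMap.lTensor V g ∘ₗ step k V f = step k V h := by
  subst e
  ext; simp [step]

theorem step_step (f : V ⊗[k] X →ₗ[k] V ⊗[k] X) :
    step k V (step k V f) ∘ₗ step k V (step k V f) =
      LinearMap.lTensor V (step k V f ∘ₗ step k V f) ∘ₗ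
        (TensorProduct.leftComm k V V (V ⊗[k] X)).toLinearMap ∘ₗ
          LinearMap.lTensor V (TensorProduct.leftComm k V V X).toLinearMap := by
  have key : ∀ (a x : V) (z : V ⊗[k] X), step k V (step k V f) (a ⊗ₜ (x ⊗ₜ z)) =
      x ⊗ₜ step k V f (a ⊗ₜ z) := by
    intro a x z; simp [step]
  have key2 : ∀ (a x : V) (z : X), step k V f (a ⊗ₜ (x ⊗ₜ z)) =
      x ⊗ₜ f (a ⊗ₜ z) := by
    intro a x z; simp [step]
  ext a b x y
  simp [key, key2]

/-! ### Coalgebra slots -/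

section Coalg

variable (C : Type u) [AddCommGroup C] [Module k C] [Coalgebra k C]

/-- Comultiplication on the first slot. -/
def cF (X : Type u) [AddCommGroup X] [Module k X] : C ⊗[k] X →ₗ[k] C ⊗[k] (C ⊗[k] X) :=
  (TensorProduct.assoc k C C X).toLinearMap ∘ₗ
    (Coalgebra.comul (R := k) (A := C)).rTensor X

/-- Counit on the first slot. -/
def eF (X : Type u) [AddCommGroup X] [Module k X] : C ⊗[k] X →ₗ[k] X :=
  (TensorProduct.lid k X).toLinearMap ∘ₗ (Coalgebra.counit (R := k) (A := C)).rTensor X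

theorem eF_tmul (c : C) (x : X) : eF k C X (c ⊗ₜ x) = Coalgebra.counit (R := k) c • x := by
  simp [eF]

theorem cF_nat (f : X →ₗ[k] Y) :
    cF k C Y ∘ₗ LinearMap.lTensor C f =
      LinearMap.lTensor C (LinearMap.lTensor C f) ∘ₗ cF k C X := by
  ext c x
  simp only [cF, AlgebraTensorModule.curry_apply, LinearMap.restrictScalars_self, curry_apply,
    LinearMap.coe_comp, LinearEquiv.coe_coe, Function.comp_apply, LinearMap.lTensor_tmul,
    LinearMap.rTensor_tmul]
  induction Coalgebra.comul (R := k) c with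
  | zero => simp
  | add a b ha hb => simp [TensorProduct.add_tmul, ha, hb]
  | tmul a b => simp

theorem eF_nat (f : X →ₗ[k] Y) : eF k C Y ∘ₗ LinearMap.lTensor C f = f ∘ₗ eF k C X := by
  ext c x; simp [eF]

theorem cF_cF : LinearMap.lTensor C (cF k C X) ∘ₗ cF k C X = cF k C (C ⊗[k] X) ∘ₗ cF k C X := by
  ext c x
  have h1 : ∀ z : C ⊗[k] C, LinearMap.lTensor C (cF k C X) (TensorProduct.assoc k C C X (z ⊗ₜ x))
      = (LinearMap.lTensor C (TensorProduct.assoc k C C X).toLinearMap)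
        (TensorProduct.assoc k C (C ⊗[k] C) X (LinearMap.lTensor C Coalgebra.comul z ⊗ₜ x)) := by
    intro z
    induction z with
    | zero => simp
    | add a b ha hb => simp [TensorProduct.add_tmul, ha, hb]
    | tmul a b => simp [cF]
  have h2 : ∀ z : C ⊗[k] C, cF k C (C ⊗[k] X) (TensorProduct.assoc k C C X (z ⊗ₜ x))
      = (LinearMap.lTensor C (TensorProduct.assoc k C C X).toLinearMap)
        (TensorProduct.assoc k C (C ⊗[k] C) X
          (TensorProduct.assoc k C C C (LinearMap.rTensor C Coalgebra.comul z) ⊗ₜ x)) := by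
    intro z
    induction z with
    | zero => simp
    | add a b ha hb => simp [TensorProduct.add_tmul, ha, hb]
    | tmul a b =>
      simp only [cF, TensorProduct.assoc_tmul, LinearMap.coe_comp, LinearEquiv.coe_coe,
        Function.comp_apply, LinearMap.rTensor_tmul]
      induction Coalgebra.comul (R := k) a with
      | zero => simp
      | add a b ha hb => simp [TensorProduct.add_tmul, ha, hb]
      | tmul a b => simp
  have h3 := Coalgebra.coassoc_apply (R := k) c
  change LinearMap.lTensor C (cF k C X) (TensorProduct.assoc k C C X (Coalgebra.comul c ⊗ₜ x)) =
    cF k C (C ⊗[k] X) (TensorProduct.assoc k C C X (Coalgebra.comul c ⊗ₜ x))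
  rw [h1, h2, h3]

theorem eF_cF : eF k C (C ⊗[k] X) ∘ₗ cF k C X = LinearMap.id := by
  ext c x
  have h1 : ∀ z : C ⊗[k] C, eF k C (C ⊗[k] X) (TensorProduct.assoc k C C X (z ⊗ₜ x)) =
      (TensorProduct.lid k C (LinearMap.rTensor C Coalgebra.counit z)) ⊗ₜ x := by
    intro z
    induction z with
    | zero => simp
    | add a b ha hb => simp [TensorProduct.add_tmul, ha, hb]
    | tmul a b => simp [eF, TensorProduct.smul_tmul']
  refine (h1 _).trans ?_
  simp

theorem lT_eF_cF : LinearMap.lTensor C (eF k C X) ∘ₗ cF k C X = LinearMap.id := by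
  ext c x
  have h1 : ∀ z : C ⊗[k] C, LinearMap.lTensor C (eF k C X) (TensorProduct.assoc k C C X (z ⊗ₜ x))
      = (TensorProduct.rid k C (LinearMap.lTensor C Coalgebra.counit z)) ⊗ₜ x := by
    intro z
    induction z with
    | zero => simp
    | add a b ha hb => simp [TensorProduct.add_tmul, ha, hb]
    | tmul a b => simp [eF, TensorProduct.smul_tmul']
  refine (h1 _).trans ?_
  simp

theorem step_cF (f : C ⊗[k] X →ₗ[k] C ⊗[k] X) :
    step k C (step k C f) ∘ₗ LinearMap.lTensor C (cF k C X) =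
      cF k C (C ⊗[k] X) ∘ₗ step k C f := by
  ext c d x
  have h1 : ∀ z : C ⊗[k] C, step k C (step k C f) (c ⊗ₜ TensorProduct.assoc k C C X (z ⊗ₜ x)) =
      TensorProduct.assoc k C C (C ⊗[k] X) (z ⊗ₜ f (c ⊗ₜ x)) := by
    intro z
    induction z with
    | zero => simp
    | add a b ha hb => simp [TensorProduct.add_tmul, TensorProduct.tmul_add, ha, hb]
    | tmul a b => simp [step]
  refine (h1 _).trans ?_
  simp [step, cF]

theorem step_eF (f : C ⊗[k] X →ₗ[k] C ⊗[k] X) :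
    f ∘ₗ LinearMap.lTensor C (eF k C X) = eF k C (C ⊗[k] X) ∘ₗ step k C f := by
  ext c d x; simp [step, eF]

theorem step_eF_self : step k C (eF k C X) = eF k C (C ⊗[k] X) := by
  ext c d x; simp [step, eF, TensorProduct.tmul_smul]

theorem step_step_cF (f : C ⊗[k] X →ₗ[k] C ⊗[k] X) :
    step k C (step k C f ∘ₗ step k C f ∘ₗ cF k C X) =
      step k C (step k C f) ∘ₗ step k C (step k C f) ∘ₗ cF k C (C ⊗[k] X) := by
  rw [← LinearMap.comp_assoc, ← LinearMap.comp_assoc, step_step]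
  ext c d x
  have h1 : ∀ z : C ⊗[k] C, (TensorProduct.leftComm k C C (C ⊗[k] X))
      (LinearMap.lTensor C (TensorProduct.leftComm k C C X).toLinearMap
        (TensorProduct.assoc k C C (C ⊗[k] X) (z ⊗ₜ (d ⊗ₜ x)))) =
      d ⊗ₜ TensorProduct.assoc k C C X (z ⊗ₜ x) := by
    intro z
    induction z with
    | zero => simp
    | add a b ha hb => simp [TensorProduct.add_tmul, TensorProduct.tmul_add, ha, hb]
    | tmul a b => simp
  have h2 := h1 (Coalgebra.comul c)
  simp only [step, cF] at h2 ⊢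
  simp [h2]

variable (M)

/-- Comultiplication on slot `i`, for `i ≤ n` (the other values are not used). -/
def coD : ∀ n _ : ℕ, tpow k C M (n + 1) →ₗ[k] tpow k C M (n + 2)
  | n, 0 => cF k C (tpow k C M n)
  | 0, _ + 1 => 0
  | n + 1, i + 1 => LinearMap.lTensor C (coD n i)

/-- Counit on slot `i`, for `i ≤ n` (the other values are not used). -/
def coE : ∀ n _ : ℕ, tpow k C M (n + 1) →ₗ[k] tpow k C M n
  | n, 0 => eF k C (tpow k C M n)
  | 0, _ + 1 => 0
  | n + 1, i + 1 => LinearMap.lTensor C (coE n i)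

theorem coD_zero (n : ℕ) : coD k M C n 0 = cF k C (tpow k C M n) := by
  cases n <;> rfl

theorem coE_zero (n : ℕ) : coE k M C n 0 = eF k C (tpow k C M n) := by
  cases n <;> rfl

theorem coD_coD (n i j : ℕ) (h : i ≤ j) (hj : j ≤ n) :
    coD k M C (n + 1) (j + 1) ∘ₗ coD k M C n i = coD k M C (n + 1) i ∘ₗ coD k M C n j := by
  induction n generalizing i j with
  | zero =>
    obtain rfl : j = 0 := by omega
    obtain rfl : i = 0 := by omega
    exact cF_cF k C
  | succ n ih =>
    match i, j with
    | 0, 0 => exact cF_cF k C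
    | 0, j + 1 => exact (cF_nat k C (coD k M C n j)).symm
    | i + 1, j + 1 => exact lT_square k (ih i j (by omega) (by omega))

theorem coE_coE (n i j : ℕ) (h : i ≤ j) (hj : j ≤ n) :
    coE k M C n i ∘ₗ coE k M C (n + 1) (j + 1) = coE k M C n j ∘ₗ coE k M C (n + 1) i := by
  induction n generalizing i j with
  | zero =>
    obtain rfl : j = 0 := by omega
    obtain rfl : i = 0 := by omega
    exact eF_nat k C _
  | succ n ih =>
    match i, j with
    | 0, j => exact eF_nat k C (coE k M C (n + 1) j)
    | i + 1, j + 1 => exact lT_square k (ih i j (by omega) (by omega))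

theorem coE_coD_self (n i : ℕ) (h : i ≤ n) :
    coE k M C (n + 1) i ∘ₗ coD k M C n i = LinearMap.id := by
  induction n generalizing i with
  | zero =>
    obtain rfl : i = 0 := by omega
    exact eF_cF k C
  | succ n ih =>
    match i with
    | 0 => exact eF_cF k C
    | i + 1 => exact lT_id k (ih i (by omega))

theorem coE_coD_succ (n i : ℕ) (h : i ≤ n) :
    coE k M C (n + 1) (i + 1) ∘ₗ coD k M C n i = LinearMap.id := by
  induction n generalizing i with
  | zero =>
    obtain rfl : i = 0 := by omega
    exact lT_eF_cF k C
  | succ n ih =>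
    match i with
    | 0 => exact lT_eF_cF k C
    | i + 1 => exact lT_id k (ih i (by omega))

theorem coE_coD_le (n i j : ℕ) (h : i ≤ j) (hj : j ≤ n) :
    coE k M C (n + 2) (j + 2) ∘ₗ coD k M C (n + 1) i =
      coD k M C n i ∘ₗ coE k M C (n + 1) (j + 1) := by
  induction n generalizing i j with
  | zero =>
    obtain rfl : i = 0 := by omega
    exact (cF_nat k C (coE k M C 0 j)).symm
  | succ n ih =>
    match i, j with
    | 0, j => exact (cF_nat k C (coE k M C (n + 1) j)).symm
    | i + 1, j + 1 => exact lT_square k (ih i j (by omega) (by omega))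

theorem coE_coD_gt (n i j : ℕ) (h : j ≤ i) (hi : i ≤ n) :
    coE k M C (n + 2) j ∘ₗ coD k M C (n + 1) (i + 1) =
      coD k M C n i ∘ₗ coE k M C (n + 1) j := by
  induction n generalizing i j with
  | zero =>
    obtain rfl : j = 0 := by omega
    exact eF_nat k C (coD k M C 0 i)
  | succ n ih =>
    match i, j with
    | i, 0 => exact eF_nat k C (coD k M C (n + 1) i)
    | i + 1, j + 1 => exact lT_square k (ih i j (by omega) (by omega))

/-- A linear automorphism of `C ⊗ M` compatible with the comultiplication and counit of `C`. -/
structure CoTwist where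
  w : C ⊗[k] M ≃ₗ[k] C ⊗[k] M
  comul : cF k C M ∘ₗ w.toLinearMap =
    step k C w.toLinearMap ∘ₗ step k C w.toLinearMap ∘ₗ cF k C M
  counit : eF k C M ∘ₗ w.toLinearMap = eF k C M

variable {M C}
variable (T : CoTwist k M C)

theorem push_coD (n i : ℕ) (hi : i ≤ n) :
    (push k T.w (n + 2)).toLinearMap ∘ₗ coD k M C (n + 1) (i + 1) =
      coD k M C (n + 1) i ∘ₗ (push k T.w (n + 1)).toLinearMap := by
  induction n generalizing i with
  | zero =>
    obtain rfl : i = 0 := by omega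
    exact step_cF k C _
  | succ n ih =>
    match i with
    | 0 => exact step_cF k C _
    | i + 1 => exact step_square k (ih i (by omega))

theorem push_coE (n i : ℕ) (hi : i ≤ n) :
    (push k T.w n).toLinearMap ∘ₗ coE k M C (n + 1) (i + 1) =
      coE k M C (n + 1) i ∘ₗ (push k T.w (n + 1)).toLinearMap := by
  induction n generalizing i with
  | zero =>
    obtain rfl : i = 0 := by omega
    exact step_eF k C _
  | succ n ih =>
    match i with
    | 0 => exact step_eF k C _
    | i + 1 => exact step_square k (ih i (by omega))

theorem coE_push (n : ℕ) :
    coE k M C n n ∘ₗ (push k T.w n).toLinearMap = coE k M C n 0 := by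
  induction n with
  | zero => exact T.counit
  | succ n ih =>
    have h1 := lT_step (V := C) k (ih.trans (coE_zero k M C n))
    have h2 := step_eF_self k C (X := tpow k C M n)
    exact h1.trans h2

theorem coD_push (n : ℕ) :
    coD k M C n n ∘ₗ (push k T.w n).toLinearMap =
      (push k T.w (n + 1)).toLinearMap ∘ₗ (push k T.w (n + 1)).toLinearMap ∘ₗ coD k M C n 0 := by
  induction n with
  | zero => exact T.comul
  | succ n ih =>
    rw [coD_zero] at ih
    have h1 := lT_step (V := C) k ih
    have h2 := step_step_cF k C (X := tpow k C M n) (push k T.w n).toLinearMap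
    exact h1.trans h2

/-- The faces with the last one `t ∘ d 0`. -/
def coFace (n i : ℕ) : tpow k C M (n + 1) →ₗ[k] tpow k C M (n + 2) :=
  if i ≤ n then coD k M C n i else (push k T.w (n + 1)).toLinearMap ∘ₗ coD k M C n 0

theorem coFace_le {n i : ℕ} (h : i ≤ n) : coFace k T n i = coD k M C n i := if_pos h

theorem coFace_last (n : ℕ) :
    coFace k T n (n + 1) = (push k T.w (n + 1)).toLinearMap ∘ₗ coD k M C n 0 :=
  if_neg (by omega)

/-- The para-cocyclic module `C^{⊗ n + 1} ⊗ M` of a coalgebra `C` and a twist `w`: the coface `i`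
comultiplies slot `i` for `i ≤ n`, the codegeneracy `i` applies the counit to slot `i + 1`,
and `t (c 0 ⊗ ⋯ ⊗ c n ⊗ m) = c 1 ⊗ ⋯ ⊗ c n ⊗ w (c 0 ⊗ m)`. The last coface is `t ∘ d 0`. By the
relations, `d i = t ^ (-i) ∘ d 0 ∘ t ^ i` and `s i = t ^ (-i) ∘ s 0 ∘ t ^ i`. -/
def coPara : ParaCocyclic k where
  X n := tpow k C M (n + 1)
  d n i _ := coFace k T n i
  s n i _ := coE k M C (n + 1) (i + 1)
  t n := push k T.w n
  dd n i j h hj x := by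
    have A := fun i j h hj => LinearMap.congr_fun (coD_coD k M C n i j h hj)
    have B := fun i hi => LinearMap.congr_fun (push_coD k T n i hi)
    have E := LinearMap.congr_fun (coD_push k T (n + 1))
    simp only [LinearMap.comp_apply, LinearEquiv.coe_coe] at A B E
    rcases Nat.lt_or_ge n j with hlt | hle
    · obtain rfl : j = n + 1 := by omega
      rcases Nat.lt_or_ge n i with hlt' | hle'
      · obtain rfl : i = n + 1 := by omega
        rw [coFace_last, coFace_last, coFace_le k T (le_refl (n + 1))]
        simp only [LinearMap.comp_apply, LinearEquiv.coe_coe]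
        rw [E, ← B 0 (by omega), A 0 0 (by omega) (by omega)]
      · rw [coFace_last, coFace_last, coFace_le k T hle', coFace_le k T (show i ≤ n + 1 by omega)]
        simp only [LinearMap.comp_apply, LinearEquiv.coe_coe]
        rw [← B i hle', A 0 i (by omega) hle']
    · rw [coFace_le k T hle, coFace_le k T (show i ≤ n by omega),
        coFace_le k T (show i ≤ n + 1 by omega), coFace_le k T (show j + 1 ≤ n + 1 by omega)]
      exact A i j h hle x
  ss n i j h hj x :=
    LinearMap.congr_fun (coE_coE k M C (n + 1) (i + 1) (j + 1) (by omega) (by omega)).symm x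
  sd_le n i j h hj x := by
    rw [coFace_le k T (show i ≤ n by omega), coFace_le k T (show i ≤ n + 1 by omega)]
    exact LinearMap.congr_fun (coE_coD_le k M C n i j h hj) x
  sd_self n i h x := by
    rw [coFace_le k T h]
    exact LinearMap.congr_fun (coE_coD_succ k M C n i h) x
  sd_succ n i h x := by
    rcases Nat.lt_or_ge i n with hlt | hle
    · rw [coFace_le k T (show i + 1 ≤ n by omega)]
      exact LinearMap.congr_fun (coE_coD_self k M C n (i + 1) hlt) x
    · obtain rfl : i = n := by omega
      rw [coFace_last]
      exact (LinearMap.congr_fun (coE_push k T (i + 1)) _).trans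
        (LinearMap.congr_fun (coE_coD_self k M C i 0 (by omega)) x)
  sd_gt n i j h hi x := by
    rcases Nat.lt_or_ge n i with hlt | hle
    · obtain rfl : i = n + 1 := by omega
      rw [coFace_last, coFace_last]
      have B := LinearMap.congr_fun (push_coE k T (n + 1) j (by omega))
      have E := LinearMap.congr_fun (coE_coD_le k M C n 0 j (by omega) (by omega))
      have F := LinearMap.congr_fun (push_coE k T (n + 1) (j + 1) (by omega))
      simp only [LinearMap.comp_apply, LinearEquiv.coe_coe] at B E F ⊢
      rw [← F, E]
    · rw [coFace_le k T hle, coFace_le k T (show i + 1 ≤ n + 1 by omega)]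
      exact LinearMap.congr_fun (coE_coD_gt k M C n i (j + 1) h hle) x
  td_succ n i h x := by
    rcases Nat.lt_or_ge i n with hlt | hle
    · obtain ⟨n, rfl⟩ : ∃ m, n = m + 1 := ⟨n - 1, by omega⟩
      rw [coFace_le k T h, coFace_le k T (show i + 1 ≤ n + 1 by omega)]
      exact LinearMap.congr_fun (push_coD k T n i (by omega)) x
    · obtain rfl : i = n := by omega
      rw [coFace_last, coFace_le k T le_rfl]
      exact (LinearMap.congr_fun (coD_push k T i) x).symm
  td_zero n x := by
    rw [coFace_last, coFace_le k T (Nat.zero_le n)]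
    rfl
  ts_succ n i h x := LinearMap.congr_fun (push_coE k T n (i + 1) h) x
  ts_zero n x :=
    (LinearMap.congr_fun (push_coE k T n 0 (by omega)) x).trans
      (LinearMap.congr_fun (coE_push k T (n + 1)) _).symm

end Coalg

/-! ### Algebra slots -/

section Alg

variable (A : Type u) [Ring A] [Algebra k A]

/-- Multiplication of the first two slots. -/
def mF (X : Type u) [AddCommGroup X] [Module k X] : A ⊗[k] (A ⊗[k] X) →ₗ[k] A ⊗[k] X :=
  (LinearMap.mul' k A).rTensor X ∘ₗ (TensorProduct.assoc k A A X).symm.toLinearMap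

/-- Insertion of the unit as a new first slot. -/
def uF (X : Type u) [AddCommGroup X] [Module k X] : X →ₗ[k] A ⊗[k] X :=
  TensorProduct.mk k A X 1

theorem mF_tmul (a b : A) (x : X) : mF k A X (a ⊗ₜ (b ⊗ₜ x)) = (a * b) ⊗ₜ x := by
  simp [mF]

theorem mF_nat (f : X →ₗ[k] Y) :
    mF k A Y ∘ₗ LinearMap.lTensor A (LinearMap.lTensor A f) =
      LinearMap.lTensor A f ∘ₗ mF k A X := by
  ext a b x; simp [mF]

theorem uF_nat (f : X →ₗ[k] Y) : LinearMap.lTensor A f ∘ₗ uF k A X = uF k A Y ∘ₗ f := by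
  ext x; simp [uF]

theorem mF_mF : mF k A X ∘ₗ LinearMap.lTensor A (mF k A X) = mF k A X ∘ₗ mF k A (A ⊗[k] X) := by
  ext a b c x; simp [mF, mul_assoc]

theorem mF_uF : mF k A X ∘ₗ uF k A (A ⊗[k] X) = LinearMap.id := by
  ext a x; simp [mF, uF]

theorem mF_lT_uF : mF k A X ∘ₗ LinearMap.lTensor A (uF k A X) = LinearMap.id := by
  ext a x; simp [mF, uF]

theorem step_mF (f : A ⊗[k] X →ₗ[k] A ⊗[k] X) :
    step k A f ∘ₗ LinearMap.lTensor A (mF k A X) =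
      mF k A (A ⊗[k] X) ∘ₗ step k A (step k A f) := by
  ext c a b x
  have h1 : ∀ z : A ⊗[k] X, mF k A (A ⊗[k] X) (a ⊗ₜ (b ⊗ₜ z)) = (a * b) ⊗ₜ z := by
    intro z; simp [mF]
  simp only [step] at h1 ⊢
  simp [h1, mF_tmul]

theorem step_uF (f : A ⊗[k] X →ₗ[k] A ⊗[k] X) :
    step k A f ∘ₗ LinearMap.lTensor A (uF k A X) = uF k A (A ⊗[k] X) ∘ₗ f := by
  ext a x; simp [step, uF]

theorem step_uF_self (f : A ⊗[k] X →ₗ[k] A ⊗[k] X) :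
    step k A f ∘ₗ uF k A (A ⊗[k] X) = LinearMap.lTensor A (f ∘ₗ uF k A X) := by
  ext a x; simp [step, uF]

theorem step_step_mF {f : A ⊗[k] X →ₗ[k] A ⊗[k] X} {D : A ⊗[k] (A ⊗[k] X) →ₗ[k] A ⊗[k] X}
    (h : D ∘ₗ step k A f ∘ₗ step k A f = f ∘ₗ mF k A X) :
    LinearMap.lTensor A D ∘ₗ step k A (step k A f) ∘ₗ step k A (step k A f) =
      step k A f ∘ₗ mF k A (A ⊗[k] X) := by
  rw [step_step, ← LinearMap.comp_assoc, ← LinearMap.lTensor_comp, h]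
  ext a b d x
  simp [step, mF]

variable (M)

/-- Multiplication of the slots `i` and `i + 1`, for `i ≤ n` (the other values are not used). -/
def alD : ∀ n _ : ℕ, tpow k A M (n + 2) →ₗ[k] tpow k A M (n + 1)
  | n, 0 => mF k A (tpow k A M n)
  | 0, _ + 1 => 0
  | n + 1, i + 1 => LinearMap.lTensor A (alD n i)

/-- Insertion of the unit before slot `i`, for `i ≤ n` (the other values are not used). -/
def alU : ∀ n _ : ℕ, tpow k A M n →ₗ[k] tpow k A M (n + 1)
  | n, 0 => uF k A (tpow k A M n)
  | 0, _ + 1 => 0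
  | n + 1, i + 1 => LinearMap.lTensor A (alU n i)

theorem alD_zero (n : ℕ) : alD k M A n 0 = mF k A (tpow k A M n) := by
  cases n <;> rfl

theorem alU_zero (n : ℕ) : alU k M A n 0 = uF k A (tpow k A M n) := by
  cases n <;> rfl

theorem alD_alD (n i j : ℕ) (h : i ≤ j) (hj : j ≤ n) :
    alD k M A n i ∘ₗ alD k M A (n + 1) (j + 1) = alD k M A n j ∘ₗ alD k M A (n + 1) i := by
  induction n generalizing i j with
  | zero =>
    obtain rfl : j = 0 := by omega
    obtain rfl : i = 0 := by omega
    exact mF_mF k A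
  | succ n ih =>
    match i, j with
    | 0, 0 => exact mF_mF k A
    | 0, j + 1 => exact mF_nat k A (alD k M A n j)
    | i + 1, j + 1 => exact lT_square k (ih i j (by omega) (by omega))

theorem alU_alU (n i j : ℕ) (h : i ≤ j) (hj : j ≤ n) :
    alU k M A (n + 1) (j + 1) ∘ₗ alU k M A n i = alU k M A (n + 1) i ∘ₗ alU k M A n j := by
  induction n generalizing i j with
  | zero =>
    obtain rfl : j = 0 := by omega
    obtain rfl : i = 0 := by omega
    exact uF_nat k A _
  | succ n ih =>
    match i, j with
    | 0, j => exact uF_nat k A (alU k M A (n + 1) j)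
    | i + 1, j + 1 => exact lT_square k (ih i j (by omega) (by omega))

theorem alD_alU_self (n i : ℕ) (h : i ≤ n) :
    alD k M A n i ∘ₗ alU k M A (n + 1) i = LinearMap.id := by
  induction n generalizing i with
  | zero =>
    obtain rfl : i = 0 := by omega
    exact mF_uF k A
  | succ n ih =>
    match i with
    | 0 => exact mF_uF k A
    | i + 1 => exact lT_id k (ih i (by omega))

theorem alD_alU_succ (n i : ℕ) (h : i ≤ n) :
    alD k M A n i ∘ₗ alU k M A (n + 1) (i + 1) = LinearMap.id := by
  induction n generalizing i with
  | zero =>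
    obtain rfl : i = 0 := by omega
    exact mF_lT_uF k A
  | succ n ih =>
    match i with
    | 0 => exact mF_lT_uF k A
    | i + 1 => exact lT_id k (ih i (by omega))

theorem alD_alU_le (n i j : ℕ) (h : i ≤ j) (hj : j ≤ n) :
    alD k M A (n + 1) i ∘ₗ alU k M A (n + 2) (j + 2) =
      alU k M A (n + 1) (j + 1) ∘ₗ alD k M A n i := by
  induction n generalizing i j with
  | zero =>
    obtain rfl : i = 0 := by omega
    exact mF_nat k A (alU k M A 0 j)
  | succ n ih =>
    match i, j with
    | 0, j => exact mF_nat k A (alU k M A (n + 1) j)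
    | i + 1, j + 1 => exact lT_square k (ih i j (by omega) (by omega))

theorem alD_alU_gt (n i j : ℕ) (h : j ≤ i) (hi : i ≤ n) :
    alD k M A (n + 1) (i + 1) ∘ₗ alU k M A (n + 2) j =
      alU k M A (n + 1) j ∘ₗ alD k M A n i := by
  induction n generalizing i j with
  | zero =>
    obtain rfl : j = 0 := by omega
    exact uF_nat k A (alD k M A 0 i)
  | succ n ih =>
    match i, j with
    | i, 0 => exact uF_nat k A (alD k M A (n + 1) i)
    | i + 1, j + 1 => exact lT_square k (ih i j (by omega) (by omega))

/-- A linear automorphism of `A ⊗ M` compatible with the multiplication and unit of `A`. -/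
structure AlTwist where
  w : A ⊗[k] M ≃ₗ[k] A ⊗[k] M
  mul : mF k A M ∘ₗ step k A w.toLinearMap ∘ₗ step k A w.toLinearMap =
    w.toLinearMap ∘ₗ mF k A M
  one : w.toLinearMap ∘ₗ uF k A M = uF k A M

variable {M A}
variable (T : AlTwist k M A)

theorem push_alD (n i : ℕ) (hi : i ≤ n) :
    (push k T.w (n + 1)).toLinearMap ∘ₗ alD k M A (n + 1) (i + 1) =
      alD k M A (n + 1) i ∘ₗ (push k T.w (n + 2)).toLinearMap := by
  induction n generalizing i with
  | zero =>
    obtain rfl : i = 0 := by omega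
    exact step_mF k A _
  | succ n ih =>
    match i with
    | 0 => exact step_mF k A _
    | i + 1 => exact step_square k (ih i (by omega))

theorem push_alU (n i : ℕ) (hi : i ≤ n) :
    (push k T.w (n + 1)).toLinearMap ∘ₗ alU k M A (n + 1) (i + 1) =
      alU k M A (n + 1) i ∘ₗ (push k T.w n).toLinearMap := by
  induction n generalizing i with
  | zero =>
    obtain rfl : i = 0 := by omega
    exact step_uF k A _
  | succ n ih =>
    match i with
    | 0 => exact step_uF k A _
    | i + 1 => exact step_square k (ih i (by omega))

theorem push_alU_zero (n : ℕ) :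
    (push k T.w n).toLinearMap ∘ₗ alU k M A n 0 = alU k M A n n := by
  induction n with
  | zero => exact T.one
  | succ n ih =>
    rw [alU_zero] at ih
    have h1 := step_uF_self k A (X := tpow k A M n) (push k T.w n).toLinearMap
    exact h1.trans (congrArg (LinearMap.lTensor A) ih)

theorem alD_push (n : ℕ) :
    alD k M A n n ∘ₗ (push k T.w (n + 1)).toLinearMap ∘ₗ (push k T.w (n + 1)).toLinearMap =
      (push k T.w n).toLinearMap ∘ₗ alD k M A n 0 := by
  induction n with
  | zero => exact T.mul
  | succ n ih =>
    rw [alD_zero] at ih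
    have h1 := step_step_mF k A (X := tpow k A M n) (f := (push k T.w n).toLinearMap) ih
    exact h1

/-- The faces, with the last one `d 0 ∘ t`. -/
def alFace (n i : ℕ) : tpow k A M (n + 2) →ₗ[k] tpow k A M (n + 1) :=
  if i ≤ n then alD k M A n i else alD k M A n 0 ∘ₗ (push k T.w (n + 1)).symm.toLinearMap

theorem alFace_le {n i : ℕ} (h : i ≤ n) : alFace k T n i = alD k M A n i := if_pos h

theorem alFace_last (n : ℕ) :
    alFace k T n (n + 1) = alD k M A n 0 ∘ₗ (push k T.w (n + 1)).symm.toLinearMap :=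
  if_neg (by omega)

/-- The para-cyclic module `A^{⊗ n + 1} ⊗ M` of an algebra `A` and a twist `w`: the face `i`
multiplies the slots `i` and `i + 1` for `i ≤ n`, the degeneracy `i` inserts `1` after slot `i`, and
`t` is the inverse of `a 0 ⊗ ⋯ ⊗ a n ⊗ m ↦ a 1 ⊗ ⋯ ⊗ a n ⊗ w (a 0 ⊗ m)`, so that it sends
`a 0 ⊗ ⋯ ⊗ a (n - 1) ⊗ w (a n ⊗ m)` to `a n ⊗ a 0 ⊗ ⋯ ⊗ a (n - 1) ⊗ m`. The last face is
`d 0 ∘ t`. By the relations, `d i = t ^ i ∘ d 0 ∘ t ^ (-i)` and `s i = t ^ i ∘ s 0 ∘ t ^ (-i)`. -/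
def alPara : ParaCyclic k where
  X n := tpow k A M (n + 1)
  d n i _ := alFace k T n i
  s n i _ := alU k M A (n + 1) (i + 1)
  t n := (push k T.w n).symm
  dd n i j h hj x := by
    have D := fun i j h hj => LinearMap.congr_fun (alD_alD k M A n i j h hj)
    have B := fun i hi => LinearMap.congr_fun (push_alD k T n i hi)
    have E := LinearMap.congr_fun (alD_push k T (n + 1))
    simp only [LinearMap.comp_apply, LinearEquiv.coe_coe] at D B E
    rcases Nat.lt_or_ge n j with hlt | hle
    · obtain rfl : j = n + 1 := by omega
      obtain ⟨x, rfl⟩ := (push k T.w (n + 2)).surjective x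
      rcases Nat.lt_or_ge n i with hlt' | hle'
      · obtain rfl : i = n + 1 := by omega
        obtain ⟨x, rfl⟩ := (push k T.w (n + 2)).surjective x
        rw [alFace_last, alFace_last, alFace_le k T (le_refl (n + 1))]
        simp only [LinearMap.comp_apply, LinearEquiv.coe_coe, LinearEquiv.symm_apply_apply]
        rw [E, ← B 0 (by omega), LinearEquiv.symm_apply_apply, LinearEquiv.symm_apply_apply,
          D 0 0 (by omega) (by omega)]
      · rw [alFace_last, alFace_last, alFace_le k T hle', alFace_le k T (show i ≤ n + 1 by omega)]
        simp only [LinearMap.comp_apply, LinearEquiv.coe_coe, LinearEquiv.symm_apply_apply]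
        rw [← B i hle', LinearEquiv.symm_apply_apply, D 0 i (by omega) hle']
    · rw [alFace_le k T hle, alFace_le k T (show i ≤ n by omega),
        alFace_le k T (show i ≤ n + 1 by omega), alFace_le k T (show j + 1 ≤ n + 1 by omega)]
      exact D i j h hle x
  ss n i j h hj x :=
    LinearMap.congr_fun (alU_alU k M A (n + 1) (i + 1) (j + 1) (by omega) (by omega)).symm x
  ds_le n i j h hj x := by
    rw [alFace_le k T (show i ≤ n by omega), alFace_le k T (show i ≤ n + 1 by omega)]
    exact LinearMap.congr_fun (alD_alU_le k M A n i j h hj) x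
  ds_self n i h x := by
    rw [alFace_le k T h]
    exact LinearMap.congr_fun (alD_alU_succ k M A n i h) x
  ds_succ n i h x := by
    rcases Nat.lt_or_ge i n with hlt | hle
    · rw [alFace_le k T (show i + 1 ≤ n by omega)]
      exact LinearMap.congr_fun (alD_alU_self k M A n (i + 1) hlt) x
    · obtain rfl : i = n := by omega
      have E := LinearMap.congr_fun (push_alU_zero k T (i + 1)) x
      have F := LinearMap.congr_fun (alD_alU_self k M A i 0 (by omega)) x
      simp only [LinearMap.comp_apply, LinearEquiv.coe_coe] at E F
      rw [alFace_last, ← E]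
      simp only [LinearMap.comp_apply, LinearEquiv.coe_coe, LinearEquiv.symm_apply_apply]
      exact F
  ds_gt n i j h hi x := by
    rcases Nat.lt_or_ge n i with hlt | hle
    · obtain rfl : i = n + 1 := by omega
      rw [alFace_last, alFace_last]
      have B := LinearMap.congr_fun (push_alU k T (n + 1) (j + 1) (by omega))
      have E := LinearMap.congr_fun (alD_alU_le k M A n 0 j (by omega) (by omega))
      obtain ⟨x, rfl⟩ := (push k T.w (n + 1)).surjective x
      simp only [LinearMap.comp_apply, LinearEquiv.coe_coe, LinearEquiv.symm_apply_apply]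
        at B E ⊢
      rw [← B, LinearEquiv.symm_apply_apply, E]
    · rw [alFace_le k T hle, alFace_le k T (show i + 1 ≤ n + 1 by omega)]
      exact LinearMap.congr_fun (alD_alU_gt k M A n i (j + 1) h hle) x
  dt_succ n i h x := by
    obtain ⟨x, rfl⟩ := (push k T.w (n + 1)).surjective x
    rw [LinearEquiv.symm_apply_apply]
    apply (push k T.w n).injective
    rw [LinearEquiv.apply_symm_apply]
    rcases Nat.lt_or_ge i n with hlt | hle
    · obtain ⟨n, rfl⟩ : ∃ m, n = m + 1 := ⟨n - 1, by omega⟩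
      rw [alFace_le k T h, alFace_le k T (show i + 1 ≤ n + 1 by omega)]
      exact LinearMap.congr_fun (push_alD k T n i (by omega)) x
    · obtain rfl : i = n := by omega
      obtain ⟨x, rfl⟩ := (push k T.w (i + 1)).surjective x
      rw [alFace_last, alFace_le k T le_rfl]
      simp only [LinearMap.comp_apply, LinearEquiv.coe_coe, LinearEquiv.symm_apply_apply]
      exact (LinearMap.congr_fun (alD_push k T i) x).symm
  dt_zero n x := by
    rw [alFace_last, alFace_le k T (Nat.zero_le n)]
    rfl
  st_succ n i h x := by
    obtain ⟨x, rfl⟩ := (push k T.w n).surjective x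
    apply (push k T.w (n + 1)).injective
    rw [LinearEquiv.apply_symm_apply, LinearEquiv.symm_apply_apply]
    exact LinearMap.congr_fun (push_alU k T n (i + 1) h) x
  st_zero n x := by
    obtain ⟨x, rfl⟩ := (push k T.w n).surjective x
    apply (push k T.w (n + 1)).injective
    apply (push k T.w (n + 1)).injective
    rw [LinearEquiv.apply_symm_apply, LinearEquiv.symm_apply_apply, LinearEquiv.apply_symm_apply]
    have B := LinearMap.congr_fun (push_alU k T n 0 (by omega)) x
    have E := LinearMap.congr_fun (push_alU_zero k T (n + 1)) (push k T.w n x)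
    simp only [LinearMap.comp_apply, LinearEquiv.coe_coe] at B E
    exact (congrArg _ B).trans E

end Alg

end Tensor

/-! ## Hopf-module algebras, coalgebras, comodules, and the cover complexes -/

section Hopf

variable (k : Type u) [Field k] (H : Type w) [Ring H]

/-- The action of a `k`-algebra `H` on a left `H`-module, as a bilinear map. -/
def act [Algebra k H] (X : Type u) [AddCommGroup X] [Module k X] [Module H X]
    [IsScalarTower k H X] : H →ₗ[k] X →ₗ[k] X :=
  (Algebra.lsmul k k X).toLinearMap

@[simp]
theorem act_apply [Algebra k H] (X : Type u) [AddCommGroup X] [Module k X] [Module H X]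
    [IsScalarTower k H X] (h : H) (x : X) : act k H X h x = h • x := rfl

/-- A left `H`-comodule, with coaction `m ↦ m₍₋₁₎ ⊗ m₍₀₎`. -/
class LeftComodule [Algebra k H] [Coalgebra k H] (M : Type u) [AddCommGroup M] [Module k M] where
  coact : M →ₗ[k] H ⊗[k] M
  coassoc : (TensorProduct.assoc k H H M).toLinearMap ∘ₗ
    (Coalgebra.comul (R := k) (A := H)).rTensor M ∘ₗ coact = coact.lTensor H ∘ₗ coact
  counit : (TensorProduct.lid k M).toLinearMap ∘ₗ
    (Coalgebra.counit (R := k) (A := H)).rTensor M ∘ₗ coact = LinearMap.id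

/-- `C` is a left `H`-module coalgebra:
`(h c)₍₁₎ ⊗ (h c)₍₂₎ = h₍₁₎ c₍₁₎ ⊗ h₍₂₎ c₍₂₎` and `ε (h c) = ε h ε c`. -/
class ModuleCoalgebra [Bialgebra k H] (C : Type u) [AddCommGroup C] [Module k C] [Coalgebra k C]
    [Module H C] [IsScalarTower k H C] : Prop where
  comul_smul : ∀ (h : H) (c : C), Coalgebra.comul (R := k) (h • c) =
    TensorProduct.map₂ (act k H C) (act k H C) (Coalgebra.comul h) (Coalgebra.comul c)
  counit_smul : ∀ (h : H) (c : C), Coalgebra.counit (R := k) (h • c) =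
    Coalgebra.counit (R := k) h * Coalgebra.counit (R := k) c

/-- `A` is a left `H`-module algebra: `h (a b) = (h₍₁₎ a) (h₍₂₎ b)` and `h 1 = ε h 1`. -/
class ModuleAlgebra [Bialgebra k H] (A : Type u) [Ring A] [Algebra k A]
    [Module H A] [IsScalarTower k H A] : Prop where
  smul_mul : ∀ (h : H) (a b : A), h • (a * b) = LinearMap.mul' k A
    (TensorProduct.map₂ (act k H A) (act k H A) (Coalgebra.comul (R := k) h) (a ⊗ₜ b))
  smul_one : ∀ h : H, h • (1 : A) = Coalgebra.counit (R := k) h • (1 : A)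

/-- An equivariant action of an `H`-module coalgebra `C` on an `H`-module algebra `A`:
`φ (c, a b) = φ (c₍₁₎, a) φ (c₍₂₎, b)`, `φ (c, 1) = ε c 1` and `h φ (c, a) = φ (h c, a)`. -/
structure IsEquivariantAction [Bialgebra k H] {C A : Type u} [AddCommGroup C] [Module k C]
    [Coalgebra k C] [Module H C] [Ring A] [Algebra k A] [Module H A]
    (φ : C →ₗ[k] A →ₗ[k] A) : Prop where
  map_mul : ∀ (c : C) (a b : A), φ c (a * b) = LinearMap.mul' k A
    (TensorProduct.map₂ φ φ (Coalgebra.comul (R := k) c) (a ⊗ₜ b))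
  map_one : ∀ c : C, φ c 1 = Coalgebra.counit (R := k) c • (1 : A)
  smul_map : ∀ (h : H) (c : C) (a : A), h • φ c a = φ (h • c) a

variable {H} [HopfAlgebra k H]

/-- The diagonal action `h (x ⊗ y) = h₍₁₎ x ⊗ h₍₂₎ y`. -/
def diagAct {X Y : Type u} [AddCommGroup X] [Module k X] [AddCommGroup Y] [Module k Y]
    (ρ : H →ₗ[k] X →ₗ[k] X) (ρ' : H →ₗ[k] Y →ₗ[k] Y) : H →ₗ[k] X ⊗[k] Y →ₗ[k] X ⊗[k] Y :=
  TensorProduct.map₂ ρ ρ' ∘ₗ Coalgebra.comul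

/-- The diagonal action on `V^{⊗ n} ⊗ M`. -/
def tpowAct {V M : Type u} [AddCommGroup V] [Module k V] [AddCommGroup M] [Module k M]
    (ρ : H →ₗ[k] V →ₗ[k] V) (ρ' : H →ₗ[k] M →ₗ[k] M) :
    ∀ n : ℕ, H →ₗ[k] tpow k V M n →ₗ[k] tpow k V M n
  | 0 => ρ'
  | n + 1 => diagAct k ρ (tpowAct ρ ρ' n)

theorem diagAct_lTensor {V X Y : Type u} [AddCommGroup V] [Module k V] [AddCommGroup X] [Module k X]
    [AddCommGroup Y] [Module k Y] (ρ : H →ₗ[k] V →ₗ[k] V) {ρX : H →ₗ[k] X →ₗ[k] X}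
    {ρY : H →ₗ[k] Y →ₗ[k] Y} {f : X →ₗ[k] Y} (hf : ∀ h x, ρY h (f x) = f (ρX h x)) (h : H)
    (z : V ⊗[k] X) :
    diagAct k ρ ρY h (LinearMap.lTensor V f z) = LinearMap.lTensor V f (diagAct k ρ ρX h z) := by
  simp only [diagAct, LinearMap.comp_apply]
  induction (Coalgebra.comul (R := k) h) with
  | zero => simp
  | add a b ha hb => simp [ha, hb]
  | tmul a b =>
    induction z with
    | zero => simp
    | add x y hx hy => simp only [map_add, hx, hy]
    | tmul v x => simp [hf]

section CoalgebraCase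

variable {C M : Type u} [AddCommGroup C] [Module k C] [Coalgebra k C] [Module H C]
  [IsScalarTower k H C] [ModuleCoalgebra k H C] [AddCommGroup M] [Module k M]
  {X : Type u} [AddCommGroup X] [Module k X]

theorem diagAct_cF (ρ : H →ₗ[k] X →ₗ[k] X) (h : H) (z : C ⊗[k] X) :
    diagAct k (act k H C) (diagAct k (act k H C) ρ) h (cF k C X z) =
      cF k C X (diagAct k (act k H C) ρ h z) := by
  induction z with
  | zero => simp
  | add x y hx hy => simp only [map_add, hx, hy]
  | tmul c x =>
    -- both sides are the image of `h₍₁₎ ⊗ h₍₂₎ ⊗ h₍₃₎`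
    have h1 : ∀ (u : C ⊗[k] C) (y : H ⊗[k] H),
        TensorProduct.map₂ (act k H C) (diagAct k (act k H C) ρ) y
          (TensorProduct.assoc k C C X (u ⊗ₜ x)) =
        TensorProduct.assoc k C C X (TensorProduct.map₂
          (TensorProduct.map₂ (act k H C) (act k H C)) ρ
          ((TensorProduct.assoc k H H H).symm (LinearMap.lTensor H Coalgebra.comul y))
          (u ⊗ₜ x)) := by
      intro u y
      induction y with
      | zero => simp
      | add a b ha hb => simp [ha, hb]
      | tmul a b =>
        simp only [LinearMap.lTensor_tmul, diagAct]
        induction u with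
        | zero => simp
        | add p q hp hq => simp only [TensorProduct.add_tmul, map_add, hp, hq]
        | tmul c d =>
          simp only [TensorProduct.assoc_tmul, TensorProduct.map₂_apply_tmul,
            LinearMap.comp_apply]
          induction (Coalgebra.comul (R := k) b) with
          | zero => simp
          | add p q hp hq =>
            simp only [TensorProduct.tmul_add, map_add, TensorProduct.map_add_right,
              LinearMap.add_apply, hp, hq]
          | tmul p q => simp
    have h2 : ∀ y : H ⊗[k] H, cF k C X (TensorProduct.map₂ (act k H C) ρ y (c ⊗ₜ x)) =
        TensorProduct.assoc k C C X (TensorProduct.map₂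
          (TensorProduct.map₂ (act k H C) (act k H C)) ρ
          (LinearMap.rTensor H Coalgebra.comul y) (Coalgebra.comul c ⊗ₜ x)) := by
      intro y
      induction y with
      | zero => simp
      | add a b ha hb => simp [ha, hb]
      | tmul a b =>
        have := ModuleCoalgebra.comul_smul (k := k) a c
        simp [cF, ← this]
    have h3 := h1 (Coalgebra.comul c) (Coalgebra.comul h)
    rw [← Coalgebra.coassoc_apply, LinearEquiv.symm_apply_apply] at h3
    refine Eq.trans ?_ (h3.trans (h2 (Coalgebra.comul h)).symm)
    simp [diagAct, cF]

theorem diagAct_eF (ρ : H →ₗ[k] X →ₗ[k] X) (h : H) (z : C ⊗[k] X) :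
    ρ h (eF k C X z) = eF k C X (diagAct k (act k H C) ρ h z) := by
  induction z with
  | zero => simp
  | add x y hx hy => simp only [map_add, hx, hy]
  | tmul c x =>
    have h1 : ∀ y : H ⊗[k] H, eF k C X (TensorProduct.map₂ (act k H C) ρ y (c ⊗ₜ x)) =
        Coalgebra.counit (R := k) c •
          ρ (TensorProduct.lid k H (LinearMap.rTensor H Coalgebra.counit y)) x := by
      intro y
      induction y with
      | zero => simp
      | add a b ha hb => simp [ha, hb]
      | tmul a b =>
        have := ModuleCoalgebra.counit_smul (k := k) a c
        simp only [TensorProduct.map₂_apply_tmul, TensorProduct.map_tmul, act_apply, eF_tmul, this,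
          LinearMap.rTensor_tmul, TensorProduct.lid_tmul, map_smul, LinearMap.smul_apply]
        rw [mul_comm, mul_smul]
    refine Eq.trans ?_ (h1 (Coalgebra.comul h)).symm
    simp [eF]

theorem tpowAct_coD (ρ : H →ₗ[k] M →ₗ[k] M) (n i : ℕ) (hi : i ≤ n) (h : H)
    (x : tpow k C M (n + 1)) :
    tpowAct k (act k H C) ρ (n + 2) h (coD k M C n i x) =
      coD k M C n i (tpowAct k (act k H C) ρ (n + 1) h x) := by
  induction n generalizing i h with
  | zero =>
    obtain rfl : i = 0 := by omega
    exact diagAct_cF k _ h x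
  | succ n ih =>
    match i with
    | 0 => exact diagAct_cF k _ h x
    | i + 1 => exact diagAct_lTensor k _ (fun h x => ih i (by omega) h x) h x

theorem tpowAct_coE (ρ : H →ₗ[k] M →ₗ[k] M) (n i : ℕ) (hi : i ≤ n) (h : H)
    (x : tpow k C M (n + 1)) :
    tpowAct k (act k H C) ρ n h (coE k M C n i x) =
      coE k M C n i (tpowAct k (act k H C) ρ (n + 1) h x) := by
  induction n generalizing i h with
  | zero =>
    obtain rfl : i = 0 := by omega
    exact diagAct_eF k _ h x
  | succ n ih =>
    match i with
    | 0 => exact diagAct_eF k _ h x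
    | i + 1 => exact diagAct_lTensor k _ (fun h x => ih i (by omega) h x) h x

end CoalgebraCase

section AlgebraCase

variable {A M : Type u} [Ring A] [Algebra k A] [Module H A]
  [IsScalarTower k H A] [ModuleAlgebra k H A] [AddCommGroup M] [Module k M]
  {X : Type u} [AddCommGroup X] [Module k X]

theorem diagAct_mF (ρ : H →ₗ[k] X →ₗ[k] X) (h : H) (z : A ⊗[k] (A ⊗[k] X)) :
    diagAct k (act k H A) ρ h (mF k A X z) =
      mF k A X (diagAct k (act k H A) (diagAct k (act k H A) ρ) h z) := by
  have main : ∀ (a b : A) (x : X), diagAct k (act k H A) ρ h (mF k A X (a ⊗ₜ (b ⊗ₜ x))) =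
      mF k A X (diagAct k (act k H A) (diagAct k (act k H A) ρ) h (a ⊗ₜ (b ⊗ₜ x))) := by
    intro a b x
    have h1 : ∀ y : H ⊗[k] H, mF k A X
        (TensorProduct.map₂ (act k H A) (diagAct k (act k H A) ρ) y (a ⊗ₜ (b ⊗ₜ x))) =
        LinearMap.rTensor X (LinearMap.mul' k A) (TensorProduct.map₂
          (TensorProduct.map₂ (act k H A) (act k H A)) ρ
          ((TensorProduct.assoc k H H H).symm (LinearMap.lTensor H Coalgebra.comul y))
          ((a ⊗ₜ b) ⊗ₜ x)) := by
      intro y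
      induction y with
      | zero => simp
      | add a b ha hb => simp [ha, hb]
      | tmul p q =>
        simp only [LinearMap.lTensor_tmul, diagAct, TensorProduct.map₂_apply_tmul,
          LinearMap.comp_apply]
        induction (Coalgebra.comul (R := k) q) with
        | zero => simp
        | add p q hp hq =>
          simp only [TensorProduct.tmul_add, map_add, TensorProduct.map_add_right,
            LinearMap.add_apply, hp, hq]
        | tmul p q => simp [mF]
    have h2 : ∀ y : H ⊗[k] H, TensorProduct.map₂ (act k H A) ρ y ((a * b) ⊗ₜ x) =
        LinearMap.rTensor X (LinearMap.mul' k A) (TensorProduct.map₂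
          (TensorProduct.map₂ (act k H A) (act k H A)) ρ
          (LinearMap.rTensor H Coalgebra.comul y) ((a ⊗ₜ b) ⊗ₜ x)) := by
      intro y
      induction y with
      | zero => simp
      | add a b ha hb => simp [ha, hb]
      | tmul p q =>
        have := ModuleAlgebra.smul_mul (k := k) p a b
        simp [← this]
    have h3 := h1 (Coalgebra.comul h)
    rw [← Coalgebra.coassoc_apply, LinearEquiv.symm_apply_apply] at h3
    rw [mF_tmul]
    exact (h2 (Coalgebra.comul h)).trans h3.symm
  induction z with
  | zero => simp
  | add x y hx hy => simp only [map_add, hx, hy]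
  | tmul a z =>
    induction z with
    | zero => simp
    | add x y hx hy => simp only [TensorProduct.tmul_add, map_add, hx, hy]
    | tmul b x => exact main a b x

theorem diagAct_uF (ρ : H →ₗ[k] X →ₗ[k] X) (h : H) (x : X) :
    diagAct k (act k H A) ρ h (uF k A X x) = uF k A X (ρ h x) := by
  have h1 : ∀ y : H ⊗[k] H, TensorProduct.map₂ (act k H A) ρ y ((1 : A) ⊗ₜ x) =
      (1 : A) ⊗ₜ ρ (TensorProduct.lid k H (LinearMap.rTensor H Coalgebra.counit y)) x := by
    intro y
    induction y with
    | zero => simp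
    | add a b ha hb => simp [ha, hb, TensorProduct.tmul_add]
    | tmul a b =>
      have := ModuleAlgebra.smul_one (k := k) (A := A) a
      simp [this, TensorProduct.smul_tmul]
  refine (h1 (Coalgebra.comul h)).trans ?_
  simp [uF]

theorem tpowAct_alD (ρ : H →ₗ[k] M →ₗ[k] M) (n i : ℕ) (hi : i ≤ n) (h : H)
    (x : tpow k A M (n + 2)) :
    tpowAct k (act k H A) ρ (n + 1) h (alD k M A n i x) =
      alD k M A n i (tpowAct k (act k H A) ρ (n + 2) h x) := by
  induction n generalizing i h with
  | zero =>
    obtain rfl : i = 0 := by omega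
    exact diagAct_mF k _ h x
  | succ n ih =>
    match i with
    | 0 => exact diagAct_mF k _ h x
    | i + 1 => exact diagAct_lTensor k _ (fun h x => ih i (by omega) h x) h x

theorem tpowAct_alU (ρ : H →ₗ[k] M →ₗ[k] M) (n i : ℕ) (hi : i ≤ n) (h : H)
    (x : tpow k A M n) :
    tpowAct k (act k H A) ρ (n + 1) h (alU k M A n i x) =
      alU k M A n i (tpowAct k (act k H A) ρ n h x) := by
  induction n generalizing i h with
  | zero =>
    obtain rfl : i = 0 := by omega
    exact diagAct_uF k _ h x
  | succ n ih =>
    match i with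
    | 0 => exact diagAct_uF k _ h x
    | i + 1 => exact diagAct_lTensor k _ (fun h x => ih i (by omega) h x) h x

end AlgebraCase

section Twist

variable {V M : Type u} [AddCommGroup V] [Module k V] [Module H V] [IsScalarTower k H V]
  [AddCommGroup M] [Module k M] [LeftComodule k H M]

/-- `h ⊗ m ↦ f (h) v ⊗ m`. -/
def slotAct (f : H →ₗ[k] H) (v : V) : H ⊗[k] M →ₗ[k] V ⊗[k] M :=
  LinearMap.rTensor M ((act k H V).flip v ∘ₗ f)

variable (V M) in
/-- `v ⊗ m ↦ f (m₍₋₁₎) v ⊗ m₍₀₎`. -/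
def wMap (f : H →ₗ[k] H) : V ⊗[k] M →ₗ[k] V ⊗[k] M :=
  LinearMap.rTensor M (TensorProduct.lift (act k H V ∘ₗ f)) ∘ₗ
    (TensorProduct.assoc k H V M).symm.toLinearMap ∘ₗ
      (TensorProduct.leftComm k V H M).toLinearMap ∘ₗ
        LinearMap.lTensor V (LeftComodule.coact : M →ₗ[k] H ⊗[k] M)

theorem wMap_tmul (f : H →ₗ[k] H) (v : V) (m : M) :
    wMap k V M f (v ⊗ₜ m) = slotAct k f v (LeftComodule.coact m : H ⊗[k] M) := by
  simp only [wMap, slotAct, LinearMap.comp_apply, LinearMap.lTensor_tmul]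
  induction (LeftComodule.coact m : H ⊗[k] M) with
  | zero => simp
  | add a b ha hb => simp only [TensorProduct.tmul_add, map_add, ha, hb]
  | tmul a b => simp

/-- `g (h₍₂₎) f (h₍₁₎)`. -/
def twistConv (g f : H →ₗ[k] H) : H →ₗ[k] H :=
  TensorProduct.lift ((LinearMap.mul k H ∘ₗ g).flip ∘ₗ f) ∘ₗ Coalgebra.comul

theorem wMap_wMap {g f : H →ₗ[k] H}
    (hc : twistConv k g f = Algebra.linearMap k H ∘ₗ Coalgebra.counit) (z : V ⊗[k] M) :
    wMap k V M g (wMap k V M f z) = z := by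
  induction z with
  | zero => simp
  | add a b ha hb => simp only [map_add, ha, hb]
  | tmul v m =>
    rw [wMap_tmul]
    have h2 : ∀ y : H ⊗[k] M, wMap k V M g (slotAct k f v y) =
        LinearMap.rTensor M ((act k H V).flip v ∘ₗ
          TensorProduct.lift ((LinearMap.mul k H ∘ₗ g).flip ∘ₗ f))
          ((TensorProduct.assoc k H H M).symm (LinearMap.lTensor H LeftComodule.coact y)) := by
      intro y
      induction y with
      | zero => simp
      | add a b ha hb => simp only [map_add, ha, hb]
      | tmul a m =>
        simp only [slotAct, LinearMap.rTensor_tmul, wMap_tmul, LinearMap.lTensor_tmul]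
        induction (LeftComodule.coact m : H ⊗[k] M) with
        | zero => simp
        | add a b ha hb => simp only [TensorProduct.tmul_add, map_add, ha, hb]
        | tmul b m => simp [mul_smul]
    rw [h2]
    have h3 := LinearMap.congr_fun (LeftComodule.coassoc (k := k) (H := H) (M := M)) m
    simp only [LinearMap.comp_apply, LinearEquiv.coe_coe] at h3
    rw [← h3, LinearEquiv.symm_apply_apply, ← LinearMap.rTensor_comp_apply,
      LinearMap.comp_assoc]
    have h4 := hc
    rw [twistConv] at h4
    rw [h4]
    have h5 : ∀ y : H ⊗[k] M, LinearMap.rTensor M ((act k H V).flip v ∘ₗ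
        Algebra.linearMap k H ∘ₗ Coalgebra.counit) y =
        v ⊗ₜ TensorProduct.lid k M (LinearMap.rTensor M Coalgebra.counit y) := by
      intro y
      induction y with
      | zero => simp
      | add a b ha hb => simp only [TensorProduct.tmul_add, map_add, ha, hb]
      | tmul a m => simp [TensorProduct.smul_tmul]
    rw [h5]
    have h6 := LinearMap.congr_fun (LeftComodule.counit (k := k) (H := H) (M := M)) m
    simp only [LinearMap.comp_apply, LinearEquiv.coe_coe, LinearMap.id_apply] at h6
    rw [h6]

/-- The inverse of the antipode. -/
def antipodeInv (hS : Function.Bijective (HopfAlgebra.antipode k : H →ₗ[k] H)) : H →ₗ[k] H :=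
  (LinearEquiv.ofBijective (HopfAlgebra.antipode k : H →ₗ[k] H) hS).symm.toLinearMap

theorem antipode_antipodeInv (hS : Function.Bijective (HopfAlgebra.antipode k : H →ₗ[k] H))
    (h : H) : HopfAlgebra.antipode k (antipodeInv k hS h) = h :=
  (LinearEquiv.ofBijective (HopfAlgebra.antipode k : H →ₗ[k] H) hS).apply_symm_apply h

theorem antipode_counit (h : H) :
    HopfAlgebra.antipode k ((Algebra.linearMap k H ∘ₗ Coalgebra.counit) h) =
      (Algebra.linearMap k H ∘ₗ Coalgebra.counit) h := by
  simp [Algebra.algebraMap_eq_smul_one]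

theorem twistConv_antipodeInv_id
    (hS : Function.Bijective (HopfAlgebra.antipode k : H →ₗ[k] H)) :
    twistConv k (antipodeInv k hS) LinearMap.id = Algebra.linearMap k H ∘ₗ Coalgebra.counit := by
  ext h
  apply hS.injective
  have h1 : ∀ y : H ⊗[k] H, HopfAlgebra.antipode k (TensorProduct.lift
      ((LinearMap.mul k H ∘ₗ antipodeInv k hS).flip ∘ₗ LinearMap.id) y) =
      LinearMap.mul' k H (LinearMap.rTensor H (HopfAlgebra.antipode k) y) := by
    intro y
    induction y with
    | zero => simp
    | add a b ha hb => simp only [map_add, ha, hb]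
    | tmul a b => simp [HopfAlgebra.antipode_mul_antidistrib, antipode_antipodeInv]
  rw [antipode_counit, twistConv, LinearMap.comp_apply, h1]
  exact LinearMap.congr_fun HopfAlgebra.mul_antipode_rTensor_comul h

theorem twistConv_id_antipodeInv
    (hS : Function.Bijective (HopfAlgebra.antipode k : H →ₗ[k] H)) :
    twistConv k LinearMap.id (antipodeInv k hS) = Algebra.linearMap k H ∘ₗ Coalgebra.counit := by
  ext h
  apply hS.injective
  have h1 : ∀ y : H ⊗[k] H, HopfAlgebra.antipode k (TensorProduct.lift
      ((LinearMap.mul k H ∘ₗ LinearMap.id).flip ∘ₗ antipodeInv k hS) y) =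
      LinearMap.mul' k H (LinearMap.lTensor H (HopfAlgebra.antipode k) y) := by
    intro y
    induction y with
    | zero => simp
    | add a b ha hb => simp only [map_add, ha, hb]
    | tmul a b => simp [HopfAlgebra.antipode_mul_antidistrib, antipode_antipodeInv]
  rw [antipode_counit, twistConv, LinearMap.comp_apply, h1]
  exact LinearMap.congr_fun HopfAlgebra.mul_antipode_lTensor_comul h

variable (V M) in
/-- The automorphism `v ⊗ m ↦ m₍₋₁₎ v ⊗ m₍₀₎` of `V ⊗ M`; its inverse is
`v ⊗ m ↦ S⁻¹ (m₍₋₁₎) v ⊗ m₍₀₎`. -/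
def hopfTwist (hS : Function.Bijective (HopfAlgebra.antipode k : H →ₗ[k] H)) :
    V ⊗[k] M ≃ₗ[k] V ⊗[k] M :=
  { wMap k V M (LinearMap.id : H →ₗ[k] H) with
    invFun := wMap k V M (antipodeInv k hS)
    left_inv := fun z => wMap_wMap k (twistConv_antipodeInv_id k hS) z
    right_inv := fun z => wMap_wMap k (twistConv_id_antipodeInv k hS) z }

theorem step_step_wMap (u : V ⊗[k] V) (m : M) :
    step k V (wMap k V M (LinearMap.id : H →ₗ[k] H))
      (step k V (wMap k V M (LinearMap.id : H →ₗ[k] H))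
        (TensorProduct.assoc k V V M (u ⊗ₜ m))) =
    TensorProduct.assoc k V V M (LinearMap.rTensor M
      ((TensorProduct.map₂ (act k H V) (act k H V)).flip u ∘ₗ Coalgebra.comul)
        (LeftComodule.coact m : H ⊗[k] M)) := by
  rw [LinearMap.rTensor_comp_apply]
  have h3 := LinearMap.congr_fun (LeftComodule.coassoc (k := k) (H := H) (M := M)) m
  simp only [LinearMap.comp_apply, LinearEquiv.coe_coe] at h3
  rw [(LinearEquiv.eq_symm_apply _).2 h3]
  induction u with
  | zero => simp
  | add a b ha hb =>
    simp only [TensorProduct.add_tmul, map_add, ha, hb, LinearMap.rTensor_add, LinearMap.add_apply]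
  | tmul a b =>
    have h1 : step k V (wMap k V M (LinearMap.id : H →ₗ[k] H))
        (TensorProduct.assoc k V V M ((a ⊗ₜ b) ⊗ₜ m)) =
        b ⊗ₜ slotAct k LinearMap.id a (LeftComodule.coact m : H ⊗[k] M) := by
      simp [step, wMap_tmul]
    rw [h1]
    induction (LeftComodule.coact m : H ⊗[k] M) with
    | zero => simp
    | add p q hp hq => simp only [TensorProduct.tmul_add, map_add, hp, hq]
    | tmul p m =>
      have h4 : step k V (wMap k V M (LinearMap.id : H →ₗ[k] H))
          (b ⊗ₜ slotAct k LinearMap.id a (p ⊗ₜ[k] m)) =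
          (p • a) ⊗ₜ slotAct k LinearMap.id b (LeftComodule.coact m : H ⊗[k] M) := by
        simp [step, slotAct, wMap_tmul]
      rw [h4]
      simp only [LinearMap.lTensor_tmul]
      induction (LeftComodule.coact m : H ⊗[k] M) with
      | zero => simp
      | add p q hp hq => simp only [TensorProduct.tmul_add, map_add, hp, hq]
      | tmul q m => simp [slotAct]

end Twist

variable (hS : Function.Bijective (HopfAlgebra.antipode k : H →ₗ[k] H))

section Cover

variable (C A M : Type u) [AddCommGroup C] [Module k C] [Coalgebra k C] [Module H C]
  [IsScalarTower k H C] [ModuleCoalgebra k H C]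
  [Ring A] [Algebra k A] [Module H A] [IsScalarTower k H A] [ModuleAlgebra k H A]
  [AddCommGroup M] [Module k M] [Module H M] [IsScalarTower k H M] [LeftComodule k H M]

/-- The twist `c ⊗ m ↦ m₍₋₁₎ c ⊗ m₍₀₎`. -/
def hopfCoTwist : CoTwist k M C where
  w := hopfTwist k C M hS
  comul := by
    ext c m
    have h1 := step_step_wMap k (H := H) (Coalgebra.comul (R := k) c) m
    refine Eq.trans ?_ h1.symm
    change cF k C M (wMap k C M (LinearMap.id : H →ₗ[k] H) (c ⊗ₜ m)) = _
    rw [wMap_tmul]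
    induction (LeftComodule.coact m : H ⊗[k] M) with
    | zero => simp
    | add p q hp hq => simp only [map_add, hp, hq]
    | tmul p m =>
      have := ModuleCoalgebra.comul_smul (k := k) p c
      simp [slotAct, cF] at this ⊢
      rw [this]
  counit := by
    ext c m
    change eF k C M (wMap k C M (LinearMap.id : H →ₗ[k] H) (c ⊗ₜ m)) = eF k C M (c ⊗ₜ m)
    rw [wMap_tmul]
    have h1 : ∀ y : H ⊗[k] M, eF k C M (slotAct k LinearMap.id c y) =
        Coalgebra.counit (R := k) c •
          TensorProduct.lid k M (LinearMap.rTensor M Coalgebra.counit y) := by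
      intro y
      induction y with
      | zero => simp
      | add p q hp hq => simp only [map_add, hp, hq, smul_add]
      | tmul p m =>
        have := ModuleCoalgebra.counit_smul (k := k) p c
        simp [slotAct, eF, this, mul_smul]
        exact smul_comm _ _ _
    have h6 := LinearMap.congr_fun (LeftComodule.counit (k := k) (H := H) (M := M)) m
    simp only [LinearMap.comp_apply, LinearEquiv.coe_coe, LinearMap.id_apply] at h6
    rw [h1, h6, eF_tmul]

/-- The twist `a ⊗ m ↦ m₍₋₁₎ a ⊗ m₍₀₎`. -/
def hopfAlTwist : AlTwist k M A where
  w := hopfTwist k A M hS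
  mul := by
    ext a b m
    have h1 := step_step_wMap k (H := H) (a ⊗ₜ[k] b) m
    rw [TensorProduct.assoc_tmul] at h1
    refine (congrArg (mF k A M) h1).trans ?_
    change _ = wMap k A M (LinearMap.id : H →ₗ[k] H) (mF k A M (a ⊗ₜ (b ⊗ₜ m)))
    rw [mF_tmul, wMap_tmul]
    induction (LeftComodule.coact m : H ⊗[k] M) with
    | zero => simp
    | add p q hp hq => simp only [map_add, hp, hq]
    | tmul p m =>
      have := ModuleAlgebra.smul_mul (k := k) p a b
      simp [slotAct, mF] at this ⊢
      rw [this]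
  one := by
    ext m
    change wMap k A M (LinearMap.id : H →ₗ[k] H) ((1 : A) ⊗ₜ m) = (1 : A) ⊗ₜ m
    rw [wMap_tmul]
    have h1 : ∀ y : H ⊗[k] M, slotAct k LinearMap.id (1 : A) y =
        (1 : A) ⊗ₜ TensorProduct.lid k M (LinearMap.rTensor M Coalgebra.counit y) := by
      intro y
      induction y with
      | zero => simp
      | add p q hp hq => simp only [map_add, hp, hq, TensorProduct.tmul_add]
      | tmul p m =>
        have := ModuleAlgebra.smul_one (k := k) (A := A) p
        simp [slotAct, this, TensorProduct.smul_tmul]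
    have h6 := LinearMap.congr_fun (LeftComodule.counit (k := k) (H := H) (M := M)) m
    simp only [LinearMap.comp_apply, LinearEquiv.coe_coe, LinearMap.id_apply] at h6
    rw [h1, h6]

/-- The cover complex `T_n (C, M) = C^{⊗ n + 1} ⊗ M`, with
`t (c 0 ⊗ ⋯ ⊗ c n ⊗ m) = c 1 ⊗ ⋯ ⊗ c n ⊗ m₍₋₁₎ c 0 ⊗ m₍₀₎` and the diagonal action of `H`. -/
def coverC : HParaCocyclic k H where
  toParaCocyclic := coPara k (hopfCoTwist k hS C M)
  L n h := tpowAct k (act k H C) (act k H M) (n + 1) h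
  L_d n i hi h x := by
    change tpowAct k (act k H C) (act k H M) (n + 2) h (coFace k _ n i x) =
      coFace k _ n i (tpowAct k (act k H C) (act k H M) (n + 1) h x)
    rw [coFace_le k _ hi]
    exact tpowAct_coD k _ n i hi h x
  L_s n i hi h x := tpowAct_coE k _ (n + 1) (i + 1) (by omega) h x

/-- The cover complex `T_n (A, M) = A^{⊗ n + 1} ⊗ M`, with
`t (a 0 ⊗ ⋯ ⊗ a n ⊗ m) = S⁻¹ (m₍₋₁₎) a n ⊗ a 0 ⊗ ⋯ ⊗ a (n - 1) ⊗ m₍₀₎` and the diagonal action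
of `H`. -/
def coverA : HParaCyclic k H where
  toParaCyclic := alPara k (hopfAlTwist k hS A M)
  L n h := tpowAct k (act k H A) (act k H M) (n + 1) h
  L_d n i hi h x := by
    change tpowAct k (act k H A) (act k H M) (n + 1) h (alFace k _ n i x) =
      alFace k _ n i (tpowAct k (act k H A) (act k H M) (n + 2) h x)
    rw [alFace_le k _ hi]
    exact tpowAct_alD k _ n i hi h x
  L_s n i hi h x := tpowAct_alU k _ (n + 1) (i + 1) (by omega) h x

/-- The Hopf-cocyclic module `C_• (C, M) = k ⊗_H (T_• (C, M) / J_• (C, M))`. -/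
def hopfC : CocyclicModule k := (coverC k hS C M).hopf (Coalgebra.counit (R := k) (A := H))

/-- The Hopf-cyclic module `C_• (A, M) = k ⊗_H (T_• (A, M) / J_• (A, M))`. -/
def hopfA : CyclicModule k := (coverA k hS A M).hopf (Coalgebra.counit (R := k) (A := H))

/-- The class of `c 0 ⊗ ⋯ ⊗ c n ⊗ m` in `C_n (C, M)`. -/
def hopfC.cls (n : ℕ) (c : ℕ → C) (m : M) : (hopfC k hS C M).deg n :=
  (coverC k hS C M).toHopf (Coalgebra.counit (R := k) (A := H)) n (tens k (n + 1) c m)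

/-- The class of `a 0 ⊗ ⋯ ⊗ a n ⊗ m` in `C_n (A, M)`. -/
def hopfA.cls (n : ℕ) (a : ℕ → A) (m : M) : (hopfA k hS A M).deg n :=
  (coverA k hS A M).toHopf (Coalgebra.counit (R := k) (A := H)) n (tens k (n + 1) a m)

end Cover

end Hopf

/-! ## The cyclic module of an algebra and the cocyclic module of a coalgebra -/

section Cyc

variable (k : Type u) [Field k] {V M : Type u} [AddCommGroup V] [Module k V]
  [AddCommGroup M] [Module k M]

theorem tens_congr {n : ℕ} {v v' : ℕ → V} (m : M) (h : ∀ i < n, v i = v' i) :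
    tens k n v m = tens k n v' m := by
  induction n generalizing v v' with
  | zero => rfl
  | succ n ih =>
    have h1 := ih (v := fun i => v (i + 1)) (v' := fun i => v' (i + 1))
      (fun i hi => h (i + 1) (by omega))
    change v 0 ⊗ₜ[k] tens k n (fun i => v (i + 1)) m = v' 0 ⊗ₜ[k] tens k n (fun i => v' (i + 1)) m
    rw [h1, h 0 (by omega)]

theorem tens_span (n : ℕ) (x : tpow k V M n) :
    x ∈ Submodule.span k (Set.range fun p : (ℕ → V) × M => tens k n p.1 p.2) := by
  induction n with
  | zero => exact Submodule.subset_span ⟨(fun _ => 0, x), rfl⟩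
  | succ n ih =>
    have key : ∀ z : V ⊗[k] tpow k V M n, (show tpow k V M (n + 1) from z) ∈
        Submodule.span k (Set.range fun p : (ℕ → V) × M => tens k (n + 1) p.1 p.2) := by
      intro z
      induction z with
      | zero => exact Submodule.zero_mem _
      | add a b ha hb => exact Submodule.add_mem _ ha hb
      | tmul v y =>
        refine (Submodule.span_le (p := (Submodule.span k (Set.range
          fun p : (ℕ → V) × M => tens k (n + 1) p.1 p.2)).comap
          (show tpow k V M n →ₗ[k] tpow k V M (n + 1) from
            TensorProduct.mk k V (tpow k V M n) v))).2 ?_ (ih y)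
        rintro _ ⟨⟨c, m⟩, rfl⟩
        exact Submodule.subset_span ⟨(fun i => if i = 0 then v else c (i - 1), m), by
          simp [tens]; rfl⟩
    exact key x

theorem push_refl_tens (n : ℕ) (v : ℕ → V) (m : M) :
    push k (LinearEquiv.refl k (V ⊗[k] M)) n (tens k (n + 1) v m) =
      tens k (n + 1) (fun i => if i = n then v 0 else v (i + 1)) m := by
  induction n generalizing v with
  | zero => rfl
  | succ n ih =>
    have h1 := ih (fun i => if i = 0 then v 0 else v (i + 1))
    refine (congrArg (fun z => (v 1 ⊗ₜ[k] z : V ⊗[k] tpow k V M (n + 1))) h1).trans ?_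
    change v 1 ⊗ₜ[k] _ = v 1 ⊗ₜ[k] _
    congr 2
    funext i
    simp

theorem push_refl_pow_tens (n j : ℕ) (v : ℕ → V) (m : M) :
    (push k (LinearEquiv.refl k (V ⊗[k] M)) n ^ j) (tens k (n + 1) v m) =
      tens k (n + 1) (fun i => v ((i + j) % (n + 1))) m := by
  induction j with
  | zero => exact tens_congr k m fun i hi => by rw [add_zero, Nat.mod_eq_of_lt hi]
  | succ j ih =>
    rw [pow_succ', LinearEquiv.mul_apply, ih, push_refl_tens]
    refine tens_congr k m fun i hi => ?_
    by_cases h : i = n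
    · subst h
      rw [if_pos rfl, zero_add, show i + (j + 1) = j + (i + 1) by omega, Nat.add_mod_right]
    · rw [if_neg h, show i + (j + 1) = i + 1 + j by omega]

theorem push_refl_pow (n : ℕ) (x : tpow k V M (n + 1)) :
    (push k (LinearEquiv.refl k (V ⊗[k] M)) n ^ (n + 1)) x = x := by
  refine Submodule.span_induction (p := fun x _ =>
    (push k (LinearEquiv.refl k (V ⊗[k] M)) n ^ (n + 1)) x = x) ?_ ?_ ?_ ?_ (tens_span k (n + 1) x)
  · rintro _ ⟨⟨v, m⟩, rfl⟩
    refine (push_refl_pow_tens k n (n + 1) v m).trans (tens_congr k m fun i hi => ?_)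
    rw [Nat.add_mod_right, Nat.mod_eq_of_lt hi]
  · exact map_zero _
  · intro x y _ _ hx hy
    rw [map_add, hx, hy]
  · intro a x _ hx
    rw [map_smul, hx]

/-- The trivial twist of a coalgebra. -/
def coTwistRefl (C : Type u) [AddCommGroup C] [Module k C] [Coalgebra k C] : CoTwist k k C where
  w := LinearEquiv.refl k _
  comul := by
    have : ∀ z : C ⊗[k] (C ⊗[k] k), step k C (LinearMap.id : C ⊗[k] k →ₗ[k] C ⊗[k] k)
        (step k C (LinearMap.id : C ⊗[k] k →ₗ[k] C ⊗[k] k) z) = z := by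
      intro z; simp only [step, LinearMap.lTensor_id, LinearMap.id_comp]
      exact (TensorProduct.leftComm k C C k).symm_apply_apply z
    ext z
    exact (this _).symm
  counit := rfl

/-- The trivial twist of an algebra. -/
def alTwistRefl (A : Type u) [Ring A] [Algebra k A] : AlTwist k k A where
  w := LinearEquiv.refl k _
  mul := by
    have : ∀ z : A ⊗[k] (A ⊗[k] k), step k A (LinearMap.id : A ⊗[k] k →ₗ[k] A ⊗[k] k)
        (step k A (LinearMap.id : A ⊗[k] k →ₗ[k] A ⊗[k] k) z) = z := by
      intro z; simp only [step, LinearMap.lTensor_id, LinearMap.id_comp]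
      exact (TensorProduct.leftComm k A A k).symm_apply_apply z
    exact LinearMap.ext fun z => congrArg (mF k A k) (this z)
  one := rfl

/-- The classical cocyclic module of a coalgebra, `C^{⊗ n + 1}` in degree `n`, with
`t (c 0 ⊗ ⋯ ⊗ c n) = c 1 ⊗ ⋯ ⊗ c n ⊗ c 0`. (The last tensor factor `k` is the empty product.) -/
def cocycCoalg (C : Type u) [AddCommGroup C] [Module k C] [Coalgebra k C] : CocyclicModule k :=
  (coPara k (coTwistRefl k C)).toCocyclic fun n x => push_refl_pow k n x

/-- The classical cyclic module of an algebra, `A^{⊗ n + 1}` in degree `n`, with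
`t (a 0 ⊗ ⋯ ⊗ a n) = a n ⊗ a 0 ⊗ ⋯ ⊗ a (n - 1)`. (The last tensor factor `k` is the empty
product.) -/
def cycAlg (A : Type u) [Ring A] [Algebra k A] : CyclicModule k :=
  (alPara k (alTwistRefl k A)).toCyclic fun n x => by
    change ((push k (LinearEquiv.refl k (A ⊗[k] k)) n).symm ^ (n + 1)) x = x
    have h1 : (push k (LinearEquiv.refl k (A ⊗[k] k)) n) ^ (n + 1) = 1 :=
      LinearEquiv.ext fun x => push_refl_pow k n x
    have h2 : (push k (LinearEquiv.refl k (A ⊗[k] k)) n)⁻¹ ^ (n + 1) = 1 := by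
      rw [inv_pow, h1, inv_one]
    exact LinearEquiv.congr_fun h2 x

/-- The tensor `c 0 ⊗ ⋯ ⊗ c n`. -/
def cocycCoalg.cls {C : Type u} [AddCommGroup C] [Module k C] [Coalgebra k C] (n : ℕ) (c : ℕ → C) :
    (cocycCoalg k C).deg n :=
  tens k (n + 1) c (1 : k)

/-- The tensor `a 0 ⊗ ⋯ ⊗ a n`. -/
def cycAlg.cls {A : Type u} [Ring A] [Algebra k A] (n : ℕ) (a : ℕ → A) :
    (cycAlg k A).deg n :=
  tens k (n + 1) a (1 : k)

/-- The cocyclic module `k_•` of the ground field, viewed as a coalgebra. -/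
abbrev kCocyc : CocyclicModule k := cocycCoalg k k

/-- The cyclic module `k_•^∨` of the ground field, viewed as an algebra. -/
abbrev kCyc : CyclicModule k := cycAlg k k

end Cyc

/-! ## The cyclic module `diagHom (X, Y)` -/

section DiagHom

variable {k : Type u} [Field k]

/-- For a cocyclic module `X` and a cyclic module `Y`, the cyclic module `diagHom (X, Y)` with
`Hom_k (X_n, Y_n)` in degree `n`; a morphism `f` of `Λ` acts by `g ↦ Y (f) ∘ g ∘ X (f)`. -/
def diagHom (X : CocyclicModule k) (Y : CyclicModule k) : CyclicModule k where
  obj n := ModuleCat.of k (X.obj n.unop →ₗ[k] Y.obj n)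
  map f := ModuleCat.ofHom
    { toFun := fun g => (Y.map f).hom ∘ₗ g ∘ₗ (X.map f.unop).hom
      map_add' := fun g g' => by ext x; simp
      map_smul' := fun r g => by ext x; simp }
  map_id n := by ext g x; simp
  map_comp f f' := by ext g x; simp

/-- The elements of `diagHom (X, Y)` of degree `n` are the linear maps `X_n → Y_n`. -/
def diagHom.eval {X : CocyclicModule k} {Y : CyclicModule k} {n : ℕ} (g : (diagHom X Y).deg n) :
    X.deg n →ₗ[k] Y.deg n := g

/-- The contravariant functor `diagHom (-, Y)`. -/
def diagHomFunctor (Y : CyclicModule k) : (CocyclicModule k)ᵒᵖ ⥤ CyclicModule k where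
  obj X := diagHom X.unop Y
  map {X X'} a :=
    { app := fun n => ModuleCat.ofHom
        { toFun := fun g => (show X.unop.obj n.unop →ₗ[k] Y.obj n from g) ∘ₗ (a.unop.app n.unop).hom
          map_add' := fun g g' => rfl
          map_smul' := fun r g => rfl }
      naturality := fun n n' f => by
        ext g
        apply LinearMap.ext
        intro x
        have h := ConcreteCategory.congr_hom (a.unop.naturality f.unop) x
        have h' := congrArg (fun z => (Y.map f).hom
          ((show X.unop.obj n.unop →ₗ[k] Y.obj n from g) z)) h
        exact h'.symm }
  map_id X := by ext n g; rfl
  map_comp a b := by ext n g; rfl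

instance (Y : CyclicModule k) : (diagHomFunctor Y).Additive where
  map_add {X X' a b} := by
    ext n g
    apply LinearMap.ext
    intro x
    exact map_add (show X.unop.obj n.unop →ₗ[k] Y.obj n from g) _ _

end DiagHom

section Exact

variable {k : Type u} [Field k]

theorem shortExact_of_forall {J : Type} [SmallCategory J] {T : ShortComplex (J ⥤ ModuleCat.{u} k)}
    (h : ∀ j, (T.map ((evaluation J (ModuleCat.{u} k)).obj j)).ShortExact) : T.ShortExact where
  exact := by
    rw [ShortComplex.exact_iff_isZero_homology]
    refine Functor.isZero _ fun j => ?_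
    exact (((ShortComplex.exact_iff_isZero_homology _).1 (h j).exact)).of_iso
      (T.mapHomologyIso ((evaluation J (ModuleCat.{u} k)).obj j)).symm
  mono_f :=
    have : ∀ j, Mono (T.f.app j) := fun j => (h j).mono_f
    NatTrans.mono_of_mono_app T.f
  epi_g :=
    have : ∀ j, Epi (T.g.app j) := fun j => (h j).epi_g
    NatTrans.epi_of_epi_app T.g

/-- Since `k` is a field, `diagHom (-, Y)` is exact. -/
theorem diagHomFunctor_shortExact (Y : CyclicModule k) (S : ShortComplex (CocyclicModule k))
    (hS : S.ShortExact) : (S.op.map (diagHomFunctor Y)).ShortExact := by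
  refine shortExact_of_forall fun j => ?_
  have hE := hS.map_of_exact ((evaluation CycCat (ModuleCat.{u} k)).obj j.unop)
  have hi := hE.moduleCat_injective_f
  have hs := hE.moduleCat_surjective_g
  have hx := (ShortComplex.moduleCat_exact_iff _).1 hE.exact
  obtain ⟨r, hr⟩ := LinearMap.exists_leftInverse_of_injective
    (S.f.app j.unop).hom (LinearMap.ker_eq_bot.2 hi)
  obtain ⟨s, hs'⟩ := LinearMap.exists_rightInverse_of_surjective
    (S.g.app j.unop).hom (LinearMap.range_eq_top.2 hs)
  exact
    { exact := by
        rw [ShortComplex.moduleCat_exact_iff]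
        intro g hg
        change S.X₂.obj j.unop →ₗ[k] Y.obj j at g
        replace hg : g ∘ₗ (S.f.app j.unop).hom = 0 := hg
        refine ⟨(g ∘ₗ s : S.X₃.obj j.unop →ₗ[k] Y.obj j), ?_⟩
        change g ∘ₗ s ∘ₗ (S.g.app j.unop).hom = g
        refine LinearMap.ext fun x => ?_
        obtain ⟨y, hy⟩ := hx (s ((S.g.app j.unop).hom x) - x) (by
          have := LinearMap.congr_fun hs' ((S.g.app j.unop).hom x)
          change (S.g.app j.unop).hom (_ - x) = 0
          rw [map_sub, sub_eq_zero]
          exact this)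
        have h0 := LinearMap.congr_fun hg y
        have h1 : g (s ((S.g.app j.unop).hom x) - x) = 0 := by rw [← hy]; exact h0
        rw [map_sub, sub_eq_zero] at h1
        exact h1
      mono_f := by
        rw [ModuleCat.mono_iff_injective]
        intro g g' h
        change S.X₃.obj j.unop →ₗ[k] Y.obj j at g g'
        replace h : g ∘ₗ (S.g.app j.unop).hom = g' ∘ₗ (S.g.app j.unop).hom := h
        refine LinearMap.ext fun x => ?_
        obtain ⟨y, rfl⟩ := hs x
        exact LinearMap.congr_fun h y
      epi_g := by
        rw [ModuleCat.epi_iff_surjective]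
        intro g
        change S.X₁.obj j.unop →ₗ[k] Y.obj j at g
        refine ⟨(g ∘ₗ r : S.X₂.obj j.unop →ₗ[k] Y.obj j), ?_⟩
        change g ∘ₗ r ∘ₗ (S.f.app j.unop).hom = g
        rw [hr, LinearMap.comp_id] }

instance cyclicModule_isGrothendieckAbelian (J : Type) [SmallCategory J] :
    IsGrothendieckAbelian.{u} (Jᵒᵖ ⥤ ModuleCat.{u} k) where
  locallySmall := inferInstance
  hasFilteredColimitsOfSize := ⟨fun _ => inferInstance⟩
  ab5OfSize := ⟨fun _ => inferInstance⟩
  hasSeparator := inferInstance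

instance cocyclicModule_isGrothendieckAbelian (J : Type) [SmallCategory J] :
    IsGrothendieckAbelian.{u} (J ⥤ ModuleCat.{u} k) :=
  IsGrothendieckAbelian.of_equivalence
    ((opOpEquivalence J).congrLeft : ((Jᵒᵖ)ᵒᵖ ⥤ ModuleCat.{u} k) ≌ (J ⥤ ModuleCat.{u} k))

end Exact

/-! ## Yoneda extensions and the cyclic cohomology groups -/

section Yoneda

/-- Exact sequences `0 → Y → E n → ⋯ → E 1 → X → 0` that represent the elements of
`Ext^n (X, Y)`, cut into short exact sequences, together with a morphism along which the sequence is
pushed out at the end (an isomorphism for a sequence that ends in `Y` itself). The sequences of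
length `0` are the morphisms `X ⟶ Y`; a sequence of length `n + 1` is
`S : 0 → S.X₁ → S.X₂ → S.X₃ → 0`, with `S.X₃ = X`, spliced at `S.X₁` with a sequence of length `n`
from `S.X₁` to `Y`. -/
inductive YonedaSeq {D : Type v} [Category.{w} D] [Preadditive D] : D → D → ℕ → Type (max v w)
  | hom {X Y : D} (f : X ⟶ Y) : YonedaSeq X Y 0
  | splice (S : ShortComplex D) (hS : S.ShortExact) {Y : D} {n : ℕ} (ξ : YonedaSeq S.X₁ Y n) :
      YonedaSeq S.X₃ Y (n + 1)

namespace YonedaSeq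

open CategoryTheory.Abelian

variable {D : Type v} [Category.{w} D] [Abelian D] [HasExt.{u} D]

/-- The class of a sequence in `Ext^n (X, Y)`: the Yoneda product of the classes of its short exact
sequences. -/
def ext {X Y : D} {n : ℕ} : YonedaSeq X Y n → Ext.{u} X Y n
  | hom f => Ext.mk₀ f
  | splice _ hS ξ => hS.extClass.comp ξ.ext (Nat.add_comm 1 _)

variable {D' : Type v} [Category.{w} D'] [Abelian D'] [HasExt.{u} D'] (F : Dᵒᵖ ⥤ D') [F.Additive]

/-- For a contravariant exact functor `F`, the class in `Ext^n (F Y, F X)` of the image under `F` of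
a sequence from `X` to `Y`: the Yoneda product, in the reversed order, of the classes of the images
of its short exact sequences. -/
def extMap (hF : ∀ S : ShortComplex D, S.ShortExact → (S.op.map F).ShortExact) {X Y : D} {n : ℕ} :
    YonedaSeq X Y n → Ext.{u} (F.obj (Opposite.op Y)) (F.obj (Opposite.op X)) n
  | hom f => Ext.mk₀ (F.map f.op)
  | splice S hS ξ => (ξ.extMap hF).comp (hF S hS).extClass rfl

end YonedaSeq

end Yoneda

section Cohomology

open CategoryTheory.Abelian

/-- `HC^n (A) = Ext_Λ^n (Cyc_• (A), k_•^∨)`, the cyclic cohomology of an algebra. -/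
abbrev HC (k : Type u) [Field k] (A : Type u) [Ring A] [Algebra k A] (n : ℕ) : Type u :=
  Ext.{u} (cycAlg k A) (kCyc k) n

variable (k : Type u) [Field k] {H : Type w} [Ring H] [HopfAlgebra k H]
  (hS : Function.Bijective (HopfAlgebra.antipode k : H →ₗ[k] H))
  (C A M : Type u) [AddCommGroup C] [Module k C] [Coalgebra k C] [Module H C]
  [IsScalarTower k H C] [ModuleCoalgebra k H C]
  [Ring A] [Algebra k A] [Module H A] [IsScalarTower k H A] [ModuleAlgebra k H A]
  [AddCommGroup M] [Module k M] [Module H M] [IsScalarTower k H M] [LeftComodule k H M]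

/-- `HC_Hopf^n (C, M) = Ext_Λ^n (k_•, C_• (C, M))`. -/
abbrev HCHopfC (n : ℕ) : Type u := Ext.{u} (kCocyc k) (hopfC k hS C M) n

/-- `HC_Hopf^n (A, M) = Ext_Λ^n (C_• (A, M), k_•^∨)`. -/
abbrev HCHopfA (n : ℕ) : Type u := Ext.{u} (hopfA k hS A M) (kCyc k) n

end Cohomology

end

end HopfCyclic

open HopfCyclic

namespace HopfCyclic

/-! ## The extension class of the image of a Yoneda sequence under a contravariant exact functor -/

section YonedaExt

open CategoryTheory.Abelian Limits

universe v₁ w₁ t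

variable {D : Type v₁} [Category.{w₁} D] [Abelian D] [HasExt.{u} D]

/-! Two independent facts carry the theorem: the pairing of tensors `⟨x, y⟩`, with `x = a₀ ⊗ ⋯ ⊗ aₙ`
and `y = c⁰ ⊗ ⋯ ⊗ cⁿ ⊗ m`, descends to the Hopf-cyclic quotients, and a contravariant exact functor
acts linearly on Ext groups.

For the first, the axioms of an equivariant action say precisely that the pairing is dinatural for
the cover complexes: `⟨d x, y⟩ = d ⟨x, d y⟩` for faces, degeneracies and cyclic operators alike, and
that it is `H`-linear in `y`. The difficulty is to show that it maps `J(C, M)` into `J(A, M)`. The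
submodule `{y | ⟨x, y⟩ ∈ J(A, M) for all x}` cannot simply be tested for admissibility, since
dinaturality only gives `d ⟨x, d y⟩ ∈ J` and not `⟨x, d y⟩ ∈ J`. Instead `J_le_commSub` shows that
`J(C, M)` is contained in the span of the commutators `[L_h, t ^ i] Ψ` and of the elements `(t ^ (n
+ 1) - 1) Φ`. That span is already stable under all operators, because powers of `t` can be carried
past `d 0` and `s 0`, leaving maps that commute with `H`. On these spanning elements the claim is a
computation (`coverPair_mem_J`): a power of `t` on the `C` side becomes the inverse power on the
value, at the price of a rotation of the `A` variable, on which `H` does not act in the pairing.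

For the second, the image of a Yoneda sequence under an exact contravariant `F` must be shown to
depend only on its class in Ext, and linearly so. Linear maps `Ext^n (X, Y) → Ext^n (F Y, F X)` are
built by dimension shifting in `Y`, along embeddings into injectives (`exists_succ`). They are then
shown to turn splicing with any short exact sequence at `X` into the reversed splicing of its image
(`extTransformation_extClass_comp`), so they agree with `YonedaSeq.extMap`. The pairing is a
composite of these maps with Yoneda products, hence bilinear. It is unique because every Ext class
is the class of a Yoneda sequence (`ext_surjective`).

The isomorphism `e` is evaluation at `1 ⊗ ⋯ ⊗ 1`, which spans `k^{⊗ n + 1}` and is fixed by every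
morphism of `Λ`. -/

theorem exists_pullback_shortExact {S : ShortComplex D} (hS : S.ShortExact) {X : D}
    (f : X ⟶ S.X₃) : ∃ (P : D) (i : S.X₁ ⟶ P) (p : P ⟶ X) (hip : i ≫ p = 0)
      (hP : (ShortComplex.mk i p hip).ShortExact),
      hP.extClass = (Ext.mk₀ f).comp hS.extClass (zero_add 1) := by
  have := hS.mono_f
  have := hS.epi_g
  -- The extension is `S` pulled back along `f`. Its left map is a monomorphism because followed by
  -- the first projection it gives `S.f`; its right map is an epimorphism as a pullback of `S.g`.
  let i : S.X₁ ⟶ pullback S.g f := pullback.lift S.f 0 (by simp)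
  have hi : i ≫ pullback.fst S.g f = S.f := pullback.lift_fst _ _ _
  have hip : i ≫ pullback.snd S.g f = 0 := pullback.lift_snd _ _ _
  have : Mono i := by
    have : Mono (i ≫ pullback.fst S.g f) := by rw [hi]; infer_instance
    exact mono_of_mono i (pullback.fst S.g f)
  have hP : (ShortComplex.mk i (pullback.snd S.g f) hip).ShortExact :=
    { exact := by
        -- A map into the pullback with zero second component has a first component killed by `S.g`,
        -- so it factors through `S.f`.
        refine ShortComplex.exact_of_f_is_kernel _ (KernelFork.IsLimit.ofι' _ _ fun {A} k hk => ?_)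
        have hk' : (k ≫ pullback.fst S.g f) ≫ S.g = 0 := by
          rw [Category.assoc, pullback.condition, reassoc_of% hk, zero_comp]
        refine ⟨hS.exact.lift _ hk', ?_⟩
        refine pullback.hom_ext ?_ ?_
        · rw [Category.assoc]
          exact (congrArg (hS.exact.lift _ hk' ≫ ·) hi).trans (hS.exact.lift_f _ hk')
        · rw [Category.assoc]
          exact (congrArg (hS.exact.lift _ hk' ≫ ·) hip).trans (by rw [comp_zero]; exact hk.symm) }
  refine ⟨_, i, _, hip, hP, ?_⟩
  -- The first projection, with the identity on the left and `f` on the right, is a morphism of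
  -- short exact sequences, and naturality of the extension class along it is the claim.
  have h := ShortComplex.ShortExact.extClass_naturality hP hS
    { τ₁ := 𝟙 _, τ₂ := pullback.fst S.g f, τ₃ := f
      comm₁₂ := by rw [Category.id_comp]; exact hi.symm
      comm₂₃ := pullback.condition }
  exact (Ext.comp_mk₀_id _).symm.trans h

/-- Sequences grow at the end `X` by definition, while dimension shifting adds a short exact
sequence at the end `Y`. The recursion runs through the splices down to the terminal morphism `g`,
where `S` is pulled back along `g ≫ f`. -/
theorem YonedaSeq.exists_ext_eq_comp_extClass {X Y : D} {n : ℕ} (ξ : YonedaSeq X Y n)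
    {S : ShortComplex D} (hS : S.ShortExact) (f : Y ⟶ S.X₃) :
    ∃ ζ : YonedaSeq X S.X₁ (n + 1),
      ζ.ext = ξ.ext.comp ((Ext.mk₀ f).comp hS.extClass (zero_add 1)) rfl := by
  induction ξ with
  | hom g =>
    obtain ⟨P, i, p, hip, hP, h⟩ := exists_pullback_shortExact hS (g ≫ f)
    refine ⟨.splice _ hP (.hom (𝟙 _)), ?_⟩
    simp only [YonedaSeq.ext, h, Ext.comp_mk₀_id, Ext.mk₀_comp_mk₀_assoc]
  | splice S' hS' ξ ih =>
    obtain ⟨ζ, h⟩ := ih f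
    refine ⟨.splice S' hS' ζ, ?_⟩
    simp only [YonedaSeq.ext, h]
    exact (Ext.comp_assoc _ _ _ _ _ (by omega)).symm

variable [EnoughInjectives D]

/-- The short exact sequence `0 → Y → I → C → 0` with `I` an injective object that embeds `Y`. -/
noncomputable abbrev injSeq (Y : D) : ShortComplex D :=
  ShortComplex.mk (Injective.ι Y) (cokernel.π _) (cokernel.condition _)

omit [HasExt.{u} D] in
theorem injSeq_shortExact (Y : D) : (injSeq Y).ShortExact where
  exact := ShortComplex.exact_of_g_is_cokernel _ (cokernelIsCokernel _)
  mono_f := inferInstanceAs (Mono (Injective.ι Y))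
  epi_g := inferInstanceAs (Epi (cokernel.π (Injective.ι Y)))

instance (Y : D) : Injective (injSeq Y).X₂ := inferInstanceAs (Injective (Injective.under Y))

/-- Dimension shifting: positive Ext groups into the injective middle term vanish, so the connecting
map is onto. -/
theorem exists_comp_injSeq_extClass {X Y : D} {n : ℕ} (x : Ext.{u} X Y (n + 1)) :
    ∃ y : Ext.{u} X (injSeq Y).X₃ n, y.comp (injSeq_shortExact Y).extClass rfl = x :=
  Ext.covariant_sequence_exact₁ X (injSeq_shortExact Y) x (Ext.eq_zero_of_injective _) rfl

/-- A dimension shift lowers the degree, and the injective sequence is put back at the end of the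
sequence obtained by induction. The uniqueness of the pairing rests on this. -/
theorem YonedaSeq.ext_surjective {X Y : D} {n : ℕ} (x : Ext.{u} X Y n) :
    ∃ ξ : YonedaSeq X Y n, ξ.ext = x := by
  induction n generalizing Y with
  | zero => exact ⟨.hom (Ext.homEquiv₀ x), Ext.mk₀_homEquiv₀_apply x⟩
  | succ n ih =>
    obtain ⟨y, rfl⟩ := exists_comp_injSeq_extClass x
    obtain ⟨ξ, rfl⟩ := ih y
    obtain ⟨ζ, h⟩ := ξ.exists_ext_eq_comp_extClass (injSeq_shortExact Y) (𝟙 _)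
    exact ⟨ζ, by rw [h, Ext.mk₀_id_comp]⟩

omit [HasExt.{u} D] [EnoughInjectives D] in
/-- A morphism between the left ends of two short exact sequences extends to the short exact
sequences if the middle term of the second one is injective. -/
theorem exists_hom_shortComplex {S T : ShortComplex D} (hS : S.ShortExact) [Injective T.X₂]
    (f : S.X₁ ⟶ T.X₁) : ∃ a : S ⟶ T, a.τ₁ = f := by
  have := hS.mono_f
  have := hS.epi_g
  let b : S.X₂ ⟶ T.X₂ := Injective.factorThru (f ≫ T.f) S.f
  have hb : S.f ≫ b = f ≫ T.f := Injective.comp_factorThru _ _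
  have hc : S.f ≫ b ≫ T.g = 0 := by rw [reassoc_of% hb, T.zero, comp_zero]
  exact ⟨ShortComplex.Hom.mk f b (hS.exact.desc (b ≫ T.g) hc) hb.symm
    (hS.exact.g_desc (b ≫ T.g) hc).symm, rfl⟩

/-! ### The action of a contravariant exact functor on Ext groups. -/

section Contravariant

variable {D' : Type v₁} [Category.{w₁} D'] [Abelian D'] [HasExt.{u} D']
  (R : Type t) [CommRing R] [Linear R D] [Linear R D'] (F : Dᵒᵖ ⥤ D') [F.Additive]
  (hF : ∀ S : ShortComplex D, S.ShortExact → (S.op.map F).ShortExact)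

/-- The extension class of the image under `F` of a short exact sequence. -/
noncomputable def extClassMap {S : ShortComplex D} (hS : S.ShortExact) :
    Ext.{u} (F.obj (Opposite.op S.X₁)) (F.obj (Opposite.op S.X₃)) 1 :=
  (hF S hS).extClass

omit [HasExt.{u} D] [EnoughInjectives D] in
-- Contravariance turns `a : S ⟶ T` into a morphism from the image of `T` to the image of `S`, with
-- `F a.τ₃` now on the left and `F a.τ₁` on the right.
theorem extClassMap_naturality {S T : ShortComplex D} (hS : S.ShortExact) (hT : T.ShortExact)
    (a : S ⟶ T) :
    (extClassMap F hF hT).comp (Ext.mk₀ (F.map a.τ₃.op)) (add_zero 1) =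
      (Ext.mk₀ (F.map a.τ₁.op)).comp (extClassMap F hF hS) (zero_add 1) :=
  ShortComplex.ShortExact.extClass_naturality (hF T hT) (hF S hS)
    (F.mapShortComplex.map (ShortComplex.opMap a))

omit [HasExt.{u} D] [EnoughInjectives D] in
-- The vanishing of two consecutive maps in a long exact sequence, for the image of `S`. It makes
-- the degree-raising construction in `exists_succ` well defined.
theorem extClassMap_comp {S : ShortComplex D} (hS : S.ShortExact) :
    (extClassMap F hF hS).comp (Ext.mk₀ (F.map S.g.op)) (add_zero 1) = 0 :=
  (hF S hS).extClass_comp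

/-- Families of linear maps `Ext^n (X, Y) → Ext^n (F Y, F X)` natural in `Y`. -/
structure ExtTransformation (n : ℕ) where
  /-- The linear map from `Ext^n (X, Y)` to `Ext^n (F Y, F X)`. -/
  map : ∀ X Y : D, Ext.{u} X Y n →ₗ[R]
    Ext.{u} (F.obj (Opposite.op Y)) (F.obj (Opposite.op X)) n
  map_comp_mk₀ : ∀ {X Y Y' : D} (x : Ext.{u} X Y n) (g : Y ⟶ Y'),
    map X Y' (x.comp (Ext.mk₀ g) (add_zero n)) =
      (Ext.mk₀ (F.map g.op)).comp (map X Y x) (zero_add n)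

theorem exists_linearMap_comp_eq {M N P : Type*} [AddCommGroup M] [Module R M] [AddCommGroup N]
    [Module R N] [AddCommGroup P] [Module R P] (p : M →ₗ[R] N) (hp : Function.Surjective p)
    (q : M →ₗ[R] P) (h : ∀ x, p x = 0 → q x = 0) : ∃ f : N →ₗ[R] P, ∀ x, f (p x) = q x := by
  refine ⟨(LinearMap.ker p).liftQ q (fun x hx => h x hx) ∘ₗ
    (p.quotKerEquivOfSurjective hp).symm.toLinearMap, fun x => ?_⟩
  have : (p.quotKerEquivOfSurjective hp).symm (p x) = Submodule.Quotient.mk x := by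
    rw [LinearEquiv.symm_apply_eq]
    rfl
  simp only [LinearMap.comp_apply, LinearEquiv.coe_coe, this]
  exact Submodule.liftQ_apply _ _ _

/-- With `δ` the class of `0 → Y → I → C → 0`, every class of degree `n + 1` is a product of some
`x` of degree `n` into `C` with `δ`, so the displayed formula determines `T'`. If the product with
`δ` vanishes, then `x` comes from a class into `I`. By naturality `T x` then begins with `F` of the
map `I → C`, and the class of the image sequence kills it. -/
theorem ExtTransformation.exists_succ {n : ℕ} (T : ExtTransformation.{u} R F n) :
    ∃ T' : ExtTransformation.{u} R F (n + 1), ∀ {X Y : D} (x : Ext.{u} X (injSeq Y).X₃ n),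
      T'.map X Y (x.comp (injSeq_shortExact Y).extClass rfl) =
        (extClassMap F hF (injSeq_shortExact Y)).comp (T.map _ _ x) (Nat.add_comm 1 n) := by
  have key : ∀ X Y : D, ∃ f : Ext.{u} X Y (n + 1) →ₗ[R]
      Ext.{u} (F.obj (Opposite.op Y)) (F.obj (Opposite.op X)) (n + 1),
      ∀ x : Ext.{u} X (injSeq Y).X₃ n, f (x.comp (injSeq_shortExact Y).extClass rfl) =
        (extClassMap F hF (injSeq_shortExact Y)).comp (T.map _ _ x) (Nat.add_comm 1 n) := by
    intro X Y
    refine exists_linearMap_comp_eq R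
      ((injSeq_shortExact Y).extClass.postcompOfLinear R X rfl) exists_comp_injSeq_extClass
      ((extClassMap F hF (injSeq_shortExact Y)).precompOfLinear R _ (Nat.add_comm 1 n) ∘ₗ
        T.map X (injSeq Y).X₃) fun x hx => ?_
    obtain ⟨y, rfl⟩ := Ext.covariant_sequence_exact₃ X (injSeq_shortExact Y) x rfl hx
    change (extClassMap F hF (injSeq_shortExact Y)).comp (T.map _ _ _) (Nat.add_comm 1 n) = 0
    rw [T.map_comp_mk₀, ← Ext.comp_assoc_of_second_deg_zero, extClassMap_comp, Ext.zero_comp]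
  choose f hf using key
  refine ⟨⟨f, fun {X Y Y'} x g => ?_⟩, fun {X Y} x => hf X Y x⟩
  -- Naturality in `Y`: the class is a shift of `y`, and `g` extends to a morphism `a` of the
  -- injective sequences. Carrying `a.τ₁` through the connecting class turns it into `a.τ₃`, where
  -- the naturality of `T` applies; the same is then done on the side of `F`.
  obtain ⟨y, rfl⟩ := exists_comp_injSeq_extClass x
  obtain ⟨a, rfl⟩ := exists_hom_shortComplex (T := injSeq Y') (injSeq_shortExact Y) g
  have h := ShortComplex.ShortExact.extClass_naturality (injSeq_shortExact Y)
    (injSeq_shortExact Y') a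
  rw [Ext.comp_assoc_of_third_deg_zero, h, ← Ext.comp_assoc_of_second_deg_zero, hf, hf,
    T.map_comp_mk₀, ← Ext.comp_assoc_of_second_deg_zero, extClassMap_naturality, Ext.comp_assoc]
  omega

variable (hlin : ∀ {X Y : D} (r : R) (f : X ⟶ Y), F.map (r • f).op = r • F.map f.op)

/-- The map `f ↦ F f` in degree `0`. -/
noncomputable def ExtTransformation.zero : ExtTransformation.{u} R F 0 where
  map X Y :=
    { toFun := fun x => Ext.mk₀ (F.map (Ext.homEquiv₀ x).op)
      map_add' := fun x y => by
        obtain ⟨f, rfl⟩ := Ext.homEquiv₀.symm.surjective x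
        obtain ⟨g, rfl⟩ := Ext.homEquiv₀.symm.surjective y
        change Ext.mk₀ (F.map (Ext.homEquiv₀ (Ext.mk₀ f + Ext.mk₀ g)).op) = _
        rw [← Ext.mk₀_add]
        change Ext.mk₀ (F.map (Ext.homEquiv₀ (Ext.homEquiv₀.symm (f + g))).op) = _
        simp only [Equiv.apply_symm_apply]
        rw [← Ext.mk₀_add, ← F.map_add]
        rfl
      map_smul' := fun r x => by
        obtain ⟨f, rfl⟩ := Ext.homEquiv₀.symm.surjective x
        change Ext.mk₀ (F.map (Ext.homEquiv₀ (r • Ext.mk₀ f)).op) = _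
        rw [← Ext.mk₀_smul]
        change Ext.mk₀ (F.map (Ext.homEquiv₀ (Ext.homEquiv₀.symm (r • f))).op) = _
        simp only [Equiv.apply_symm_apply, RingHom.id_apply]
        rw [← Ext.mk₀_smul, hlin] }
  map_comp_mk₀ {X Y Y'} x g := by
    obtain ⟨f, rfl⟩ := Ext.homEquiv₀.symm.surjective x
    change Ext.mk₀ (F.map (Ext.homEquiv₀ ((Ext.mk₀ f).comp (Ext.mk₀ g) _)).op) =
      (Ext.mk₀ _).comp (Ext.mk₀ (F.map (Ext.homEquiv₀ (Ext.homEquiv₀.symm f)).op)) _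
    rw [Ext.mk₀_comp_mk₀]
    change Ext.mk₀ (F.map (Ext.homEquiv₀ (Ext.homEquiv₀.symm (f ≫ g))).op) = _
    simp only [Equiv.apply_symm_apply, Ext.mk₀_comp_mk₀, op_comp, F.map_comp]

omit [EnoughInjectives D] in
theorem ExtTransformation.zero_mk₀ {X Y : D} (f : X ⟶ Y) :
    (ExtTransformation.zero.{u} R F hlin).map X Y (Ext.mk₀ f) = Ext.mk₀ (F.map f.op) :=
  congrArg (fun g : X ⟶ Y => Ext.mk₀ (F.map g.op)) (Ext.homEquiv₀.apply_symm_apply f)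

/-- The maps `Ext^n (X, Y) → Ext^n (F Y, F X)` induced by a contravariant exact functor `F`. -/
noncomputable def extTransformation : ∀ n : ℕ, ExtTransformation.{u} R F n
  | 0 => ExtTransformation.zero R F hlin
  | n + 1 => (ExtTransformation.exists_succ R F hF (extTransformation n)).choose

theorem extTransformation_comp_extClass {n : ℕ} {X Y : D} (x : Ext.{u} X (injSeq Y).X₃ n) :
    (extTransformation R F hF hlin (n + 1)).map X Y
        (x.comp (injSeq_shortExact Y).extClass rfl) =
      (extClassMap F hF (injSeq_shortExact Y)).comp
        ((extTransformation R F hF hlin n).map _ _ x) (Nat.add_comm 1 n) :=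
  (ExtTransformation.exists_succ R F hF (extTransformation R F hF hlin n)).choose_spec x

/-- The maps were defined by splitting off an injective sequence at `Y`; here an arbitrary sequence
is split off at the other end. In degree `0` the morphism `S.X₁ ⟶ Y` extends to a morphism from `S`
to the injective sequence of `Y`, which converts one kind of splitting into the other. In higher
degrees the two splittings take place at opposite ends of a product, so associativity and the
induction hypothesis suffice. -/
theorem extTransformation_extClass_comp {n : ℕ} {S : ShortComplex D} (hS : S.ShortExact) {Y : D}
    (x : Ext.{u} S.X₁ Y n) :
    (extTransformation R F hF hlin (n + 1)).map S.X₃ Y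
        (hS.extClass.comp x (Nat.add_comm 1 n)) =
      ((extTransformation R F hF hlin n).map _ _ x).comp (extClassMap F hF hS) rfl := by
  induction n generalizing Y with
  | zero =>
    obtain ⟨f, rfl⟩ := Ext.homEquiv₀.symm.surjective x
    obtain ⟨a, rfl⟩ := exists_hom_shortComplex (T := injSeq Y) hS f
    change (extTransformation R F hF hlin 1).map S.X₃ Y (hS.extClass.comp (Ext.mk₀ a.τ₁) _) =
      ((extTransformation R F hF hlin 0).map _ _ (Ext.mk₀ a.τ₁)).comp _ _
    have h := ShortComplex.ShortExact.extClass_naturality hS (injSeq_shortExact Y) a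
    -- By `h` the product of the class of `S` with `a.τ₁` is the product of `a.τ₃` with the
    -- injective class, and on such products the degree `1` map is known by construction.
    have h₀ := extTransformation_comp_extClass R F hF hlin (Ext.mk₀ a.τ₃)
    rw [h]
    refine h₀.trans ?_
    change (extClassMap F hF _).comp
        ((ExtTransformation.zero R F hlin).map _ _ (Ext.mk₀ a.τ₃)) _ =
      ((ExtTransformation.zero R F hlin).map _ _ (Ext.mk₀ a.τ₁)).comp _ _
    rw [ExtTransformation.zero_mk₀, ExtTransformation.zero_mk₀]
    exact extClassMap_naturality F hF hS (injSeq_shortExact Y) a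
  | succ n ih =>
    obtain ⟨y, rfl⟩ := exists_comp_injSeq_extClass x
    rw [extTransformation_comp_extClass,
      Ext.comp_assoc (a₁₂ := n + 1) _ _ _ (by omega) rfl (by omega),
      ← ih, ← extTransformation_comp_extClass, Ext.comp_assoc]
    omega

/-- Hence the class of the image sequence depends only on the class of `ξ`, and it does so linearly;
this makes the pairing well defined on Ext groups. -/
theorem extTransformation_ext {X Y : D} {n : ℕ} (ξ : YonedaSeq X Y n) :
    (extTransformation R F hF hlin n).map X Y ξ.ext = ξ.extMap F hF := by
  induction ξ with
  | hom f => exact ExtTransformation.zero_mk₀ R F hlin f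
  | splice S hS ξ ih =>
    refine (extTransformation_extClass_comp R F hF hlin hS ξ.ext).trans ?_
    rw [ih]
    rfl

end Contravariant

end YonedaExt

/-! ## Generators of the cyclic category -/

namespace CycCat

/-- The coface `δ i : [n] ⟶ [n + 1]` of `Λ`. -/
def δ (n i : ℕ) (h : i ≤ n + 1) : mk n ⟶ mk (n + 1) :=
  (CategoryTheory.Quotient.functor CycQuiver.Rel).map (CycQuiver.δ n i h)

/-- The codegeneracy `σ i : [n + 1] ⟶ [n]` of `Λ`. -/
def σ (n i : ℕ) (h : i ≤ n) : mk (n + 1) ⟶ mk n :=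
  (CategoryTheory.Quotient.functor CycQuiver.Rel).map (CycQuiver.σ n i h)

/-- The cyclic operator `τ : [n] ⟶ [n]` of `Λ`. -/
def τ (n : ℕ) : mk n ⟶ mk n :=
  (CategoryTheory.Quotient.functor CycQuiver.Rel).map (CycQuiver.τ n)

/-- The number `n` for the object `[n]` of `Λ`. -/
abbrev deg (X : CycCat) : ℕ := X.as

/-- Every morphism of `Λ` is the class of a path of generators, so induction on the path suffices;
the relations play no role. -/
theorem hom_induction {P : ∀ m n : ℕ, (mk m ⟶ mk n) → Prop} (id : ∀ n, P n n (𝟙 (mk n)))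
    (comp : ∀ l m n (f : mk l ⟶ mk m) (g : mk m ⟶ mk n), P l m f → P m n g → P l n (f ≫ g))
    (δ : ∀ n i h, P n (n + 1) (δ n i h)) (σ : ∀ n i h, P (n + 1) n (σ n i h))
    (τ : ∀ n, P n n (τ n)) {m n : ℕ} (f : mk m ⟶ mk n) : P m n f := by
  obtain ⟨p, rfl⟩ := (CategoryTheory.Quotient.functor CycQuiver.Rel).map_surjective
    (X := CycQuiver.pt m) (Y := CycQuiver.pt n) f
  refine Paths.induction (V := CycQuiver) (fun {a b} p => P a b
    ((CategoryTheory.Quotient.functor CycQuiver.Rel).map p)) (fun {v} => ?_) ?_ p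
  · have h := (CategoryTheory.Quotient.functor CycQuiver.Rel).map_id ((Paths.of CycQuiver).obj v)
    exact Eq.mpr (congrArg (P v v) h) (id v)
  · intro a b c p q hp
    have h := (CategoryTheory.Quotient.functor CycQuiver.Rel).map_comp p
      ((Paths.of CycQuiver).map q)
    refine Eq.mpr (congrArg (P a c) h) (comp a b c _ _ hp ?_)
    change CycGen b c at q
    cases q with
    | δ _ i hi => exact δ b i hi
    | σ _ i hi => exact σ c i hi
    | τ => exact τ b

/-- A natural transformation of contravariant functors on `Λ` is given by components that are
compatible with the generators. -/
def natTrans {D : Type u} [Category.{v} D] {F G : CycCatᵒᵖ ⥤ D}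
    (app : ∀ n, F.obj (Opposite.op (mk n)) ⟶ G.obj (Opposite.op (mk n)))
    (hδ : ∀ n i h, F.map (δ n i h).op ≫ app n = app (n + 1) ≫ G.map (δ n i h).op)
    (hσ : ∀ n i h, F.map (σ n i h).op ≫ app (n + 1) = app n ≫ G.map (σ n i h).op)
    (hτ : ∀ n, F.map (τ n).op ≫ app n = app n ≫ G.map (τ n).op) : F ⟶ G where
  -- Every object of `Λ` is definitionally `mk` of its number, so components indexed by numbers are
  -- enough.
  app X := app X.unop.deg
  naturality X Y f := by
    refine hom_induction (P := fun m n f => F.map f.op ≫ app m = app n ≫ G.map f.op)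
      (fun n => ?_) (fun l m n f g hf hg => ?_) hδ hσ hτ (m := Y.unop.deg) (n := X.unop.deg) f.unop
    · rw [op_id, F.map_id, G.map_id, Category.id_comp, Category.comp_id]
    · rw [op_comp, F.map_comp, G.map_comp, Category.assoc, hf, ← Category.assoc, hg,
        Category.assoc]

end CycCat

/-! ### Values on the generators of the functors built from para-(co)cyclic modules. -/

section Generators

variable {D : Type u} [Category.{v} D] (P : CocyclicData D)

theorem CocyclicData.functor_map_δ (n i : ℕ) (hi : i ≤ n + 1) :
    P.functor.map (CycCat.δ n i hi) = P.δ n i hi := by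
  change (Paths.lift P.prefunctor).map (CycQuiver.δ n i hi) = P.δ n i hi
  exact Paths.lift_toPath _ _

theorem CocyclicData.functor_map_σ (n i : ℕ) (hi : i ≤ n) :
    P.functor.map (CycCat.σ n i hi) = P.σ n i hi := by
  change (Paths.lift P.prefunctor).map (CycQuiver.σ n i hi) = P.σ n i hi
  exact Paths.lift_toPath _ _

theorem CocyclicData.functor_map_τ (n : ℕ) : P.functor.map (CycCat.τ n) = P.τ n := by
  change (Paths.lift P.prefunctor).map (CycQuiver.τ n) = P.τ n
  exact Paths.lift_toPath _ _

variable {k : Type u} [Field k]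

theorem ParaCocyclic.toCocyclic_map_δ (P : ParaCocyclic k) (h : ∀ n x, (P.t n ^ (n + 1)) x = x)
    (n i : ℕ) (hi : i ≤ n + 1) :
    (P.toCocyclic h).map (CycCat.δ n i hi) = ModuleCat.ofHom (P.d n i hi) :=
  CocyclicData.functor_map_δ _ n i hi

theorem ParaCocyclic.toCocyclic_map_σ (P : ParaCocyclic k) (h : ∀ n x, (P.t n ^ (n + 1)) x = x)
    (n i : ℕ) (hi : i ≤ n) :
    (P.toCocyclic h).map (CycCat.σ n i hi) = ModuleCat.ofHom (P.s n i hi) :=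
  CocyclicData.functor_map_σ _ n i hi

theorem ParaCocyclic.toCocyclic_map_τ (P : ParaCocyclic k) (h : ∀ n x, (P.t n ^ (n + 1)) x = x)
    (n : ℕ) : (P.toCocyclic h).map (CycCat.τ n) = ModuleCat.ofHom (P.t n).toLinearMap :=
  CocyclicData.functor_map_τ _ n

theorem ParaCyclic.toCyclic_map_δ (P : ParaCyclic k) (h : ∀ n x, (P.t n ^ (n + 1)) x = x)
    (n i : ℕ) (hi : i ≤ n + 1) :
    (P.toCyclic h).map (CycCat.δ n i hi).op = ModuleCat.ofHom (P.d n i hi) := by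
  unfold ParaCyclic.toCyclic
  rw [Functor.leftOp_map]
  exact congrArg Quiver.Hom.unop (CocyclicData.functor_map_δ _ n i hi)

theorem ParaCyclic.toCyclic_map_σ (P : ParaCyclic k) (h : ∀ n x, (P.t n ^ (n + 1)) x = x)
    (n i : ℕ) (hi : i ≤ n) :
    (P.toCyclic h).map (CycCat.σ n i hi).op = ModuleCat.ofHom (P.s n i hi) := by
  unfold ParaCyclic.toCyclic
  rw [Functor.leftOp_map]
  exact congrArg Quiver.Hom.unop (CocyclicData.functor_map_σ _ n i hi)

theorem ParaCyclic.toCyclic_map_τ (P : ParaCyclic k) (h : ∀ n x, (P.t n ^ (n + 1)) x = x)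
    (n : ℕ) : (P.toCyclic h).map (CycCat.τ n).op = ModuleCat.ofHom (P.t n).toLinearMap := by
  unfold ParaCyclic.toCyclic
  rw [Functor.leftOp_map]
  exact congrArg Quiver.Hom.unop (CocyclicData.functor_map_τ _ n)

end Generators

/-! ## The isomorphism `diagHom (k_•, Y) ≅ Y` -/

section Unit

variable (k : Type u) [Field k]

/-- The unit of `k` is grouplike, so comultiplying one slot of a tensor of ones only makes the
tensor longer. -/
theorem coD_one (n i : ℕ) (hi : i ≤ n) :
    coD k k k n i (tens k (n + 1) (fun _ => (1 : k)) (1 : k)) =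
      tens k (n + 2) (fun _ => (1 : k)) (1 : k) := by
  induction n generalizing i with
  | zero =>
    obtain rfl : i = 0 := by omega
    rw [coD_zero]
    change cF k k (tpow k k k 0) ((1 : k) ⊗ₜ tens k 0 (fun _ => (1 : k)) (1 : k)) = _
    simp [cF, tens]
    rfl
  | succ n ih =>
    match i with
    | 0 =>
      rw [coD_zero]
      change cF k k (tpow k k k (n + 1)) ((1 : k) ⊗ₜ tens k (n + 1) (fun _ => (1 : k)) (1 : k)) = _
      simp [cF, tens]
      rfl
    | i + 1 =>
      exact congrArg (fun z => ((1 : k) ⊗ₜ[k] z : k ⊗[k] tpow k k k (n + 2))) (ih i (by omega))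

theorem coE_one (n i : ℕ) (hi : i ≤ n) :
    coE k k k n i (tens k (n + 1) (fun _ => (1 : k)) (1 : k)) =
      tens k n (fun _ => (1 : k)) (1 : k) := by
  have h : ∀ n, eF k k (tpow k k k n) ((1 : k) ⊗ₜ tens k n (fun _ => (1 : k)) (1 : k)) =
      tens k n (fun _ => (1 : k)) (1 : k) := fun n => by
    rw [eF_tmul, CommSemiring.counit_apply, one_smul]
  induction n generalizing i with
  | zero =>
    obtain rfl : i = 0 := by omega
    exact h 0
  | succ n ih =>
    match i with
    | 0 => exact h (n + 1)
    | i + 1 =>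
      exact congrArg (fun z => ((1 : k) ⊗ₜ[k] z : k ⊗[k] tpow k k k n)) (ih i (by omega))

theorem push_refl_one (n : ℕ) :
    push k (LinearEquiv.refl k (k ⊗[k] k)) n (tens k (n + 1) (fun _ => (1 : k)) (1 : k)) =
      tens k (n + 1) (fun _ => (1 : k)) (1 : k) :=
  (push_refl_tens k n _ _).trans (tens_congr k _ fun i _ => by simp)

/-- This is what makes evaluation at `1 ⊗ ⋯ ⊗ 1` natural on `Λ`. It is enough to check the
generators, where it holds because `1` is grouplike and a rotation of equal factors changes nothing.
-/
theorem kCocyc_map_one {m n : ℕ} (f : CycCat.mk m ⟶ CycCat.mk n) :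
    ((kCocyc k).map f).hom (cocycCoalg.cls k m fun _ => (1 : k)) =
      cocycCoalg.cls k n fun _ => (1 : k) := by
  refine CycCat.hom_induction (P := fun m n f => ((kCocyc k).map f).hom
    (cocycCoalg.cls k m fun _ => (1 : k)) = cocycCoalg.cls k n fun _ => (1 : k))
    (fun n => ?_) (fun l m n f g hf hg => ?_) (fun n i h => ?_) (fun n i h => ?_) (fun n => ?_) f
  · rw [CategoryTheory.Functor.map_id]; rfl
  · rw [CategoryTheory.Functor.map_comp, ModuleCat.hom_comp, LinearMap.comp_apply, hf, hg]
  · refine (congrArg (fun g => g.hom (cocycCoalg.cls k n fun _ => (1 : k)))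
      (ParaCocyclic.toCocyclic_map_δ _ _ n i h)).trans ?_
    change coFace k (coTwistRefl k k) n i (tens k (n + 1) (fun _ => (1 : k)) (1 : k)) =
      tens k (n + 2) (fun _ => (1 : k)) (1 : k)
    rcases Nat.lt_or_ge n i with hlt | hle
    · obtain rfl : i = n + 1 := by omega
      rw [coFace_last, LinearMap.comp_apply, coD_one k n 0 (by omega)]
      exact push_refl_one k (n + 1)
    · rw [coFace_le k _ hle, coD_one k n i hle]
  · refine (congrArg (fun g => g.hom (cocycCoalg.cls k (n + 1) fun _ => (1 : k)))
      (ParaCocyclic.toCocyclic_map_σ _ _ n i h)).trans ?_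
    exact coE_one k (n + 1) (i + 1) (by omega)
  · refine (congrArg (fun g => g.hom (cocycCoalg.cls k n fun _ => (1 : k)))
      (ParaCocyclic.toCocyclic_map_τ _ _ n)).trans ?_
    exact push_refl_one k n

/-- `k^{⊗ n} ≅ k`. -/
def tpowEquiv : ∀ n : ℕ, tpow k k k n ≃ₗ[k] k
  | 0 => LinearEquiv.refl k k
  | n + 1 => (TensorProduct.lid k (tpow k k k n)).trans (tpowEquiv n)

theorem tpowEquiv_one (n : ℕ) : tpowEquiv k n (tens k n (fun _ => (1 : k)) (1 : k)) = 1 := by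
  induction n with
  | zero => rfl
  | succ n ih =>
    refine (congrArg (tpowEquiv k n) (TensorProduct.lid_tmul _ _)).trans ?_
    rw [one_smul, ih]

/-- Linear maps out of `k^{⊗ n}` are determined by their value at `1 ⊗ ⋯ ⊗ 1`. -/
def evalOneEquiv (n : ℕ) (W : Type u) [AddCommGroup W] [Module k W] :
    (tpow k k k n →ₗ[k] W) ≃ₗ[k] W where
  toFun g := g (tens k n (fun _ => (1 : k)) (1 : k))
  map_add' _ _ := rfl
  map_smul' _ _ := rfl
  invFun x := LinearMap.toSpanSingleton k W x ∘ₗ (tpowEquiv k n).toLinearMap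
  left_inv g := by
    refine LinearMap.ext fun z => ?_
    have hz : z = tpowEquiv k n z • tens k n (fun _ => (1 : k)) (1 : k) := by
      apply (tpowEquiv k n).injective
      rw [map_smul, tpowEquiv_one, smul_eq_mul, mul_one]
    conv_rhs => rw [hz, map_smul]
    rfl
  right_inv x := by
    change tpowEquiv k n (tens k n (fun _ => (1 : k)) (1 : k)) • x = x
    rw [tpowEquiv_one, one_smul]

/-- The isomorphism `diagHom (k_•, Y) ≅ Y`, `g ↦ g (1 ⊗ ⋯ ⊗ 1)`. -/
def diagHomUnitIso (Y : CyclicModule k) : diagHom (kCocyc k) Y ≅ Y :=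
  NatIso.ofComponents
    (fun X => (evalOneEquiv k (X.unop.deg + 1) (Y.obj X)).toModuleIso)
    (fun {X X'} f => by
      ext g
      -- A morphism `f` acts by `g ↦ Y(f) ∘ g ∘ k_•(f)`, and `k_•(f)` fixes the tensor of ones.
      exact congrArg (fun z => (Y.map f).hom
        ((show (kCocyc k).obj X.unop →ₗ[k] Y.obj X from g) z))
          (kCocyc_map_one k (m := X'.unop.deg) (n := X.unop.deg) f.unop))

end Unit

/-! ## An explicit description of `J` -/

section SpanJ

theorem map_zpow_apply {k : Type*} [Field k] {M N : Type*} [AddCommGroup M] [Module k M]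
    [AddCommGroup N] [Module k N] (f : M →ₗ[k] N) (a : M ≃ₗ[k] M) (b : N ≃ₗ[k] N)
    (h : ∀ x, f (a x) = b (f x)) (i : ℤ) (x : M) : f ((a ^ i) x) = (b ^ i) (f x) := by
  have h' : ∀ x, f (a⁻¹ x) = b⁻¹ (f x) := fun x => by
    apply b.injective
    rw [← h]
    exact (congrArg f (a.apply_symm_apply x)).trans (b.apply_symm_apply (f x)).symm
  induction i generalizing x with
  | zero => rfl
  | succ i ih => rw [zpow_add_one, zpow_add_one, LinearEquiv.mul_apply, LinearEquiv.mul_apply, ih, h]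
  | pred i ih =>
    rw [zpow_sub_one, zpow_sub_one, LinearEquiv.mul_apply, LinearEquiv.mul_apply, ih, h']

/-! ### Stability of the span of commutators, and maps out of the cocyclic quotient. -/

namespace HParaCocyclic

variable {k : Type u} [Field k] {H : Type w} (P : HParaCocyclic k H)

/-- The submodule spanned by the commutators `[L_h, t ^ i] Ψ` and by the elements
`(t ^ (n + 1) - 1) Φ`. -/
def commSub (n : ℕ) : Submodule k (P.X n) :=
  Submodule.span k ({y | ∃ (h : H) (i : ℤ) (Ψ : P.X n),
    y = P.L n h ((P.t n ^ i) Ψ) - (P.t n ^ i) (P.L n h Ψ)} ∪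
      {y | ∃ Φ : P.X n, y = (P.t n ^ (n + 1)) Φ - Φ})

theorem comm_mem_commSub {n : ℕ} (h : H) (i : ℤ) (Ψ : P.X n) :
    P.L n h ((P.t n ^ i) Ψ) - (P.t n ^ i) (P.L n h Ψ) ∈ P.commSub n :=
  Submodule.subset_span (Or.inl ⟨h, i, Ψ, rfl⟩)

theorem pow_sub_mem_commSub {n : ℕ} (Φ : P.X n) : (P.t n ^ (n + 1)) Φ - Φ ∈ P.commSub n :=
  Submodule.subset_span (Or.inr ⟨Φ, rfl⟩)

theorem map_commSub {m : ℕ} {W : Type*} [AddCommGroup W] [Module k W] (N : Submodule k W)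
    (f : P.X m →ₗ[k] W)
    (h₁ : ∀ (h : H) (i : ℤ) (Ψ : P.X m), f (P.L m h ((P.t m ^ i) Ψ) - (P.t m ^ i) (P.L m h Ψ)) ∈ N)
    (h₂ : ∀ Φ, f ((P.t m ^ (m + 1)) Φ - Φ) ∈ N) {x : P.X m} (hx : x ∈ P.commSub m) : f x ∈ N := by
  refine (Submodule.span_le (p := N.comap f)).2 ?_ hx
  rintro _ (⟨h, i, Ψ, rfl⟩ | ⟨Φ, rfl⟩)
  · exact h₁ h i Ψ
  · exact h₂ Φ

theorem t_zpow_add (n : ℕ) (i j : ℤ) (x : P.X n) :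
    (P.t n ^ (i + j)) x = (P.t n ^ i) ((P.t n ^ j) x) := by
  rw [zpow_add, LinearEquiv.mul_apply]

/-- The reason is `t ^ j [L_h, t ^ i] = [L_h, t ^ (j + i)] - [L_h, t ^ j] t ^ i`. Commutators with
all integer powers are therefore needed in the span, not only those with `t`. -/
theorem t_zpow_mem_commSub (n : ℕ) (j : ℤ) {x : P.X n} (hx : x ∈ P.commSub n) :
    (P.t n ^ j) x ∈ P.commSub n := by
  refine P.map_commSub (P.commSub n) (P.t n ^ j).toLinearMap (fun h i Ψ => ?_) (fun Φ => ?_) hx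
  · have h₁ := P.comm_mem_commSub h j ((P.t n ^ i) Ψ)
    have h₂ := P.comm_mem_commSub h (j + i) Ψ
    rw [t_zpow_add, t_zpow_add] at h₂
    have h₃ := Submodule.sub_mem _ h₂ h₁
    simp only [LinearEquiv.coe_coe, map_sub]
    convert h₃ using 1
    abel
  · have h := P.pow_sub_mem_commSub ((P.t n ^ j) Φ)
    rw [LinearEquiv.coe_coe, map_sub]
    rwa [← zpow_natCast, ← t_zpow_add, add_comm, t_zpow_add, zpow_natCast] at h

/-- Two identities give this: `L_g [L_h, t ^ i] = [L_{gh}, t ^ i] - [L_g, t ^ i] L_h` and `L_g (t ^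
(n + 1) - 1) = [L_g, t ^ (n + 1)] + (t ^ (n + 1) - 1) L_g`. -/
theorem L_mem_commSub [Mul H] (hL : ∀ n g h x, P.L n g (P.L n h x) = P.L n (g * h) x) (n : ℕ)
    (g : H) {x : P.X n} (hx : x ∈ P.commSub n) : P.L n g x ∈ P.commSub n := by
  refine P.map_commSub (P.commSub n) (P.L n g) (fun h i Ψ => ?_) (fun Φ => ?_) hx
  · have h₁ := P.comm_mem_commSub (g * h) i Ψ
    have h₂ := P.comm_mem_commSub g i (P.L n h Ψ)
    have h₃ := Submodule.sub_mem _ h₁ h₂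
    rw [map_sub, hL]
    rw [hL] at h₃
    convert h₃ using 1
    abel
  · have h₁ := P.comm_mem_commSub g (n + 1 : ℕ) Φ
    have h₂ := P.pow_sub_mem_commSub (P.L n g Φ)
    rw [zpow_natCast] at h₁
    have h₃ := Submodule.add_mem _ h₁ h₂
    rw [map_sub]
    convert h₃ using 1
    abel

/-- A linear map that commutes with `H` and with `t ^ (n + 1)`, and whose composites with powers of
`t` can be rewritten with maps that commute with `H`, preserves `commSub`. -/
theorem map_mem_commSub {m n : ℕ} (f : P.X m →ₗ[k] P.X n)
    (hf : ∀ h x, P.L n h (f x) = f (P.L m h x))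
    (ht : ∀ x, f ((P.t m ^ (m + 1)) x) = (P.t n ^ (n + 1)) (f x))
    (hr : ∀ r ≤ m, ∃ (a : ℕ) (f' : P.X m →ₗ[k] P.X n),
      (∀ h x, P.L n h (f' x) = f' (P.L m h x)) ∧ ∀ x, f ((P.t m ^ r) x) = (P.t n ^ a) (f' x))
    {x : P.X m} (hx : x ∈ P.commSub m) : f x ∈ P.commSub n := by
  refine P.map_commSub (P.commSub n) f (fun h i Ψ => ?_) (fun Φ => ?_) hx
  · obtain ⟨a, f', hf', h'⟩ := hr (i % (m + 1 : ℕ)).toNat (by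
      have := Int.emod_lt_of_pos i (show (0 : ℤ) < (m + 1 : ℕ) by omega)
      omega)
    have key : ∀ x, f ((P.t m ^ i) x) =
        (P.t n ^ (((n + 1 : ℕ) : ℤ) * (i / (m + 1 : ℕ)) + (a : ℤ))) (f' x) := by
      intro x
      have hi : i = ((m + 1 : ℕ) : ℤ) * (i / (m + 1 : ℕ)) + ((i % (m + 1 : ℕ)).toNat : ℕ) := by
        rw [Int.toNat_of_nonneg (Int.emod_nonneg _ (by omega))]
        exact (Int.mul_ediv_add_emod i _).symm
      conv_lhs => rw [hi]
      rw [t_zpow_add, t_zpow_add, zpow_mul, zpow_mul, zpow_natCast, zpow_natCast, zpow_natCast,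
        zpow_natCast, map_zpow_apply f _ _ ht, h']
    -- With `b = (n + 1) q + a` the result is `f [L_h, t ^ i] Ψ = [L_h, t ^ b] (f' Ψ)`.
    rw [map_sub, ← hf, key, key, ← hf']
    exact P.comm_mem_commSub h _ _
  · rw [map_sub, ht]
    exact P.pow_sub_mem_commSub _

/-- The relation `d i ∘ t = t ∘ d (i + 1)` iterated. It trades `d 0` for `d j`, which commutes with
`H` as long as `j ≤ n`, and it also expresses every `d j` through `d 0` and powers of `t`. -/
theorem d_t_pow (n j : ℕ) (hj : j ≤ n + 1) (x : P.X n) :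
    P.d n 0 (by omega) ((P.t n ^ j) x) = (P.t (n + 1) ^ j) (P.d n j hj x) := by
  induction j generalizing x with
  | zero => rfl
  | succ j ih =>
    rw [pow_succ, LinearEquiv.mul_apply, ih (by omega), pow_succ, LinearEquiv.mul_apply,
      P.td_succ n j (by omega)]

theorem s_t_pow (n j : ℕ) (hj : j ≤ n) (x : P.X (n + 1)) :
    P.s n 0 (by omega) ((P.t (n + 1) ^ j) x) = (P.t n ^ j) (P.s n j hj x) := by
  induction j generalizing x with
  | zero => rfl
  | succ j ih =>
    rw [pow_succ, LinearEquiv.mul_apply, ih (by omega), pow_succ, LinearEquiv.mul_apply,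
      P.ts_succ n j (by omega)]

variable [Mul H] (hL : ∀ n g h x, P.L n g (P.L n h x) = P.L n (g * h) x)
  (hs : ∀ n h (x : P.X (n + 1)), P.L n h (P.s n n le_rfl (P.t (n + 1) x)) =
    P.s n n le_rfl (P.t (n + 1) (P.L (n + 1) h x)))

omit [Mul H] in
-- The remainders `r ≤ n` only produce the cofaces `d r` with `r ≤ n`, which commute with `H`; the
-- last coface does not occur. The full turn gives `d 0 ∘ t ^ (n + 1) = t ^ (n + 1) ∘ d (n + 1) = t
-- ^ (n + 2) ∘ d 0`.
theorem d_zero_mem_commSub (n : ℕ) {x : P.X n} (hx : x ∈ P.commSub n) :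
    P.d n 0 (by omega) x ∈ P.commSub (n + 1) := by
  refine P.map_mem_commSub (P.d n 0 (by omega)) (P.L_d n 0 (by omega)) (fun x => ?_)
    (fun r hr => ⟨r, P.d n r (by omega), P.L_d n r hr, P.d_t_pow n r (by omega)⟩) hx
  rw [d_t_pow P n (n + 1) le_rfl, ← P.td_zero, ← LinearEquiv.mul_apply, ← pow_succ]

omit [Mul H] in
include hs in
-- The source has one remainder more than there are codegeneracies. For `r = n + 1` the formula is
-- `s 0 ∘ t ^ (n + 1) = t ^ n ∘ (s n ∘ t)`, and `hs` provides the `H`-linearity of the extra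
-- degeneracy `s n ∘ t`. The full turn uses `s n ∘ t ^ 2 = t ∘ s 0`.
theorem s_zero_mem_commSub (n : ℕ) {x : P.X (n + 1)} (hx : x ∈ P.commSub (n + 1)) :
    P.s n 0 (by omega) x ∈ P.commSub n := by
  have h₁ : ∀ x, P.s n 0 (by omega) ((P.t (n + 1) ^ (n + 1)) x) =
      (P.t n ^ n) (P.s n n le_rfl (P.t (n + 1) x)) := fun x => by
    rw [pow_succ, LinearEquiv.mul_apply, P.s_t_pow n n le_rfl]
  refine P.map_mem_commSub (P.s n 0 (by omega)) (P.L_s n 0 (by omega)) (fun x => ?_)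
    (fun r hr => ?_) hx
  · rw [pow_succ, LinearEquiv.mul_apply, h₁, ← P.ts_zero, ← LinearEquiv.mul_apply, ← pow_succ]
  · rcases Nat.lt_or_ge n r with hlt | hle
    · obtain rfl : r = n + 1 := by omega
      exact ⟨n, P.s n n le_rfl ∘ₗ (P.t (n + 1)).toLinearMap, hs n, h₁⟩
    · exact ⟨r, P.s n r hle, P.L_s n r hle, P.s_t_pow n r hle⟩

include hL hs in
-- Since `d i = t ^ (-i) ∘ d 0 ∘ t ^ i` and `s i = t ^ (-i) ∘ s 0 ∘ t ^ i`, stability under `t ^ j`,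
-- `d 0` and `s 0` is enough.
theorem commSub_admissible : P.Admissible P.commSub where
  d n i hi x hx := by
    have h := P.t_zpow_mem_commSub (n + 1) (-i : ℤ)
      (P.d_zero_mem_commSub n (P.t_zpow_mem_commSub n i hx))
    rwa [zpow_natCast, P.d_t_pow n i hi, ← zpow_natCast, ← t_zpow_add, neg_add_cancel,
      zpow_zero] at h
  s n i hi x hx := by
    have h := P.t_zpow_mem_commSub n (-i : ℤ)
      (P.s_zero_mem_commSub hs n (P.t_zpow_mem_commSub (n + 1) i hx))
    rwa [zpow_natCast, P.s_t_pow n i hi, ← zpow_natCast, ← t_zpow_add, neg_add_cancel,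
      zpow_zero] at h
  t n x hx := by
    have h := P.t_zpow_mem_commSub n 1 hx
    rwa [zpow_one] at h
  t_symm n x hx := by
    have h := P.t_zpow_mem_commSub n (-1) hx
    rwa [zpow_neg_one] at h
  L n h x hx := P.L_mem_commSub hL n h hx
  gen n h i Ψ Φ := Submodule.add_mem _ (P.comm_mem_commSub h i Ψ) (P.pow_sub_mem_commSub Φ)

include hL hs in
-- A property of the elements of `J` that is closed under linear combinations can now be tested on
-- commutators and on `t ^ (n + 1) - 1`, with no reference to cofaces or codegeneracies.
theorem J_le_commSub (n : ℕ) {x : P.X n} (hx : x ∈ P.J n) : x ∈ P.commSub n :=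
  P.mem_J.1 hx _ (P.commSub_admissible hL hs)

omit [Mul H] in
theorem toHopf_surjective [Nonempty H] (ε : H → k) (n : ℕ) :
    Function.Surjective (P.toHopf ε n) :=
  (P.Q.quotMk_surjective (P.augSub ε) (P.augSub_isSub ε) n).comp (P.toQ_surjective n)

omit [Mul H] in
/-- A linear map on `T` that kills `J` and is `H`-linear for the trivial action on its target
factors through `k ⊗_H (T / J)`. -/
theorem exists_lift_toHopf [Nonempty H] (ε : H → k) {n : ℕ} {W : Type*} [AddCommGroup W]
    [Module k W] (B : P.X n →ₗ[k] W) (hJ : ∀ y ∈ P.J n, B y = 0)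
    (hB : ∀ h y, B (P.L n h y) = ε h • B y) :
    ∃ f : (P.hopf ε).deg n →ₗ[k] W, ∀ y, f (P.toHopf ε n y) = B y := by
  obtain ⟨f, hf⟩ := exists_linearMap_comp_eq k (P.toQ n) (P.toQ_surjective n) B
    fun x hx => hJ x ((Submodule.Quotient.mk_eq_zero (P.J n)).1 hx)
  obtain ⟨g, hg⟩ := exists_linearMap_comp_eq k (P.Q.quotMk (P.augSub ε) (P.augSub_isSub ε) n)
    (P.Q.quotMk_surjective (P.augSub ε) (P.augSub_isSub ε) n) f fun x hx => by
      refine (Submodule.span_le (p := LinearMap.ker f)).2 ?_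
        ((Submodule.Quotient.mk_eq_zero (P.augSub ε n)).1 hx)
      rintro _ ⟨h, x, rfl⟩
      obtain ⟨x, rfl⟩ := P.toQ_surjective n x
      change f (P.toQ n (P.L n h x) - ε h • P.toQ n x) = 0
      rw [map_sub, map_smul, hf, hf, hB, sub_self]
  exact ⟨g, fun y => (hg _).trans (hf y)⟩

omit [Mul H] in
theorem hopf_map_δ [Nonempty H] (ε : H → k) (n i : ℕ) (hi : i ≤ n + 1) (x : P.X n) :
    ((P.hopf ε).map (CycCat.δ n i hi)).hom (P.toHopf ε n x) =
      P.toHopf ε (n + 1) (P.d n i hi x) :=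
  congrArg (fun g => g.hom (P.toHopf ε n x)) (ParaCocyclic.toCocyclic_map_δ _ _ n i hi)

omit [Mul H] in
theorem hopf_map_σ [Nonempty H] (ε : H → k) (n i : ℕ) (hi : i ≤ n) (x : P.X (n + 1)) :
    ((P.hopf ε).map (CycCat.σ n i hi)).hom (P.toHopf ε (n + 1) x) =
      P.toHopf ε n (P.s n i hi x) :=
  congrArg (fun g => g.hom (P.toHopf ε (n + 1) x)) (ParaCocyclic.toCocyclic_map_σ _ _ n i hi)

omit [Mul H] in
theorem hopf_map_τ [Nonempty H] (ε : H → k) (n : ℕ) (x : P.X n) :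
    ((P.hopf ε).map (CycCat.τ n)).hom (P.toHopf ε n x) = P.toHopf ε n (P.t n x) :=
  congrArg (fun g => g.hom (P.toHopf ε n x)) (ParaCocyclic.toCocyclic_map_τ _ _ n)

end HParaCocyclic

/-! ### The projection onto the cyclic quotient `k ⊗_H (T / J)`. -/

namespace HParaCyclic

variable {k : Type u} [Field k] {H : Type w} [Nonempty H] (P : HParaCyclic k H) (ε : H → k)

theorem toHopf_eq_zero {n : ℕ} {x : P.X n} (hx : x ∈ P.J n) : P.toHopf ε n x = 0 := by
  have h : P.toQ n x = 0 := (Submodule.Quotient.mk_eq_zero (P.J n)).2 hx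
  exact (congrArg (P.Q.quotMk (P.augSub ε) (P.augSub_isSub ε) n) h).trans (map_zero _)

theorem toHopf_L {n : ℕ} (h : H) (x : P.X n) :
    P.toHopf ε n (P.L n h x) = ε h • P.toHopf ε n x := by
  rw [← map_smul]
  exact (Submodule.Quotient.eq (P.augSub ε n)).2 (Submodule.subset_span ⟨h, P.toQ n x, by
    rw [map_smul]; rfl⟩)

theorem hopf_map_δ (n i : ℕ) (hi : i ≤ n + 1) (x : P.X (n + 1)) :
    ((P.hopf ε).map (CycCat.δ n i hi).op).hom (P.toHopf ε (n + 1) x) =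
      P.toHopf ε n (P.d n i hi x) :=
  congrArg (fun g => g.hom (P.toHopf ε (n + 1) x)) (ParaCyclic.toCyclic_map_δ _ _ n i hi)

theorem hopf_map_σ (n i : ℕ) (hi : i ≤ n) (x : P.X n) :
    ((P.hopf ε).map (CycCat.σ n i hi).op).hom (P.toHopf ε n x) =
      P.toHopf ε (n + 1) (P.s n i hi x) :=
  congrArg (fun g => g.hom (P.toHopf ε n x)) (ParaCyclic.toCyclic_map_σ _ _ n i hi)

theorem hopf_map_τ (n : ℕ) (x : P.X n) :
    ((P.hopf ε).map (CycCat.τ n).op).hom (P.toHopf ε n x) = P.toHopf ε n (P.t n x) :=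
  congrArg (fun g => g.hom (P.toHopf ε n x)) (ParaCyclic.toCyclic_map_τ _ _ n)

end HParaCyclic

end SpanJ

/-! ## The pairing `A^{⊗ n + 1} ⊗ (C^{⊗ n + 1} ⊗ M) → A^{⊗ n + 1} ⊗ M` -/

section Pairing

variable (k : Type u) [Field k] {C A : Type u} [AddCommGroup C] [Module k C]
  [Ring A] [Algebra k A] (φ : C →ₗ[k] A →ₗ[k] A)
  (M : Type u) [AddCommGroup M] [Module k M]

/-- `(a 0 ⊗ ⋯ ⊗ a (n - 1)) ⊗ (c 0 ⊗ ⋯ ⊗ c (n - 1) ⊗ m) ↦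
φ (c 0, a 0) ⊗ ⋯ ⊗ φ (c (n - 1), a (n - 1)) ⊗ m`. -/
def tpowPair : ∀ n : ℕ, tpow k A k n →ₗ[k] tpow k C M n →ₗ[k] tpow k A M n
  -- The spare last factor `k` of the classical cyclic module acts on `M` by scalars.
  | 0 => LinearMap.lsmul k M
  | n + 1 => TensorProduct.map₂ φ.flip (tpowPair n)

theorem tpowPair_tmul (n : ℕ) (a : A) (x : tpow k A k n) (c : C) (y : tpow k C M n) :
    tpowPair k φ M (n + 1) (a ⊗ₜ[k] x : A ⊗[k] tpow k A k n) (c ⊗ₜ[k] y : C ⊗[k] tpow k C M n) =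
      (φ c a ⊗ₜ[k] tpowPair k φ M n x y : A ⊗[k] tpow k A M n) := by
  change TensorProduct.map₂ φ.flip (tpowPair k φ M n) (a ⊗ₜ[k] x) (c ⊗ₜ[k] y) = _
  rw [TensorProduct.map₂_apply_tmul, TensorProduct.map_tmul, LinearMap.flip_apply]

theorem tpowPair_tens (n : ℕ) (a : ℕ → A) (c : ℕ → C) (m : M) :
    tpowPair k φ M n (tens k n a (1 : k)) (tens k n c m) = tens k n (fun i => φ (c i) (a i)) m := by
  induction n generalizing a c with
  | zero => exact one_smul k m
  | succ n ih =>
    refine (tpowPair_tmul k φ M n _ _ _ _).trans ?_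
    rw [ih]
    rfl

/-! ### The pairing on single tensor slots. -/

section Slots

variable {k}
variable {X X' Y Y' Z Z' : Type u} [AddCommGroup X] [Module k X] [AddCommGroup X'] [Module k X']
  [AddCommGroup Y] [Module k Y] [AddCommGroup Y'] [Module k Y'] [AddCommGroup Z] [Module k Z]
  [AddCommGroup Z'] [Module k Z'] {φ}

theorem map₂_lTensor_lTensor {ψ : A →ₗ[k] C →ₗ[k] A} {G : X →ₗ[k] Y →ₗ[k] Z}
    {G' : X' →ₗ[k] Y' →ₗ[k] Z'} {f : Z →ₗ[k] Z'} {g : Y →ₗ[k] Y'} {r : X →ₗ[k] X'}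
    (h : ∀ x y, G' (r x) (g y) = f (G x y)) (x : A ⊗[k] X) (y : C ⊗[k] Y) :
    TensorProduct.map₂ ψ G' (LinearMap.lTensor A r x) (LinearMap.lTensor C g y) =
      LinearMap.lTensor A f (TensorProduct.map₂ ψ G x y) := by
  induction x with
  | zero => simp
  | add x x' hx hx' => simp only [map_add, LinearMap.add_apply, hx, hx']
  | tmul a x =>
    induction y with
    | zero => simp
    | add y y' hy hy' => simp only [map_add, hy, hy']
    | tmul c y => simp [h]

/-- The inductive step for operators that leave the first slot alone. The hypothesis has the
dinatural shape of `diagHom`: an operator applied before and after the pairing equals the operator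
applied to the algebra variable. -/
theorem lTensor_map₂_lTensor {ψ : A →ₗ[k] C →ₗ[k] A} {G : X →ₗ[k] Y →ₗ[k] Z}
    {G' : X' →ₗ[k] Y' →ₗ[k] Z'} {f : Z →ₗ[k] Z'} {g : Y' →ₗ[k] Y} {r : X →ₗ[k] X'}
    (h : ∀ x y, f (G x (g y)) = G' (r x) y) (x : A ⊗[k] X) (y : C ⊗[k] Y') :
    LinearMap.lTensor A f (TensorProduct.map₂ ψ G x (LinearMap.lTensor C g y)) =
      TensorProduct.map₂ ψ G' (LinearMap.lTensor A r x) y := by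
  induction x with
  | zero => simp
  | add x x' hx hx' => simp only [map_add, LinearMap.add_apply, hx, hx']
  | tmul a x =>
    induction y with
    | zero => simp
    | add y y' hy hy' => simp only [map_add, hy, hy']
    | tmul c y => simp [h]

theorem map₂_leftComm (ψ : A →ₗ[k] C →ₗ[k] A) (G : X →ₗ[k] Y →ₗ[k] Z)
    (x : A ⊗[k] (A ⊗[k] X)) (y : C ⊗[k] (C ⊗[k] Y)) :
    TensorProduct.map₂ ψ (TensorProduct.map₂ ψ G) (TensorProduct.leftComm k A A X x)
        (TensorProduct.leftComm k C C Y y) =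
      TensorProduct.leftComm k A A Z (TensorProduct.map₂ ψ (TensorProduct.map₂ ψ G) x y) := by
  induction x with
  | zero => simp
  | add x x' hx hx' => simp only [map_add, LinearMap.add_apply, hx, hx']
  | tmul a x =>
  induction x with
  | zero => simp
  | add x x' hx hx' =>
    simp only [TensorProduct.tmul_add, map_add, LinearMap.add_apply, hx, hx']
  | tmul b x =>
  induction y with
  | zero => simp
  | add y y' hy hy' => simp only [map_add, hy, hy']
  | tmul c y =>
  induction y with
  | zero => simp
  | add y y' hy hy' => simp only [TensorProduct.tmul_add, map_add, hy, hy']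
  | tmul d y => simp

/-- `H` acts on the coalgebra variable and on the value but not on the algebra variable, as in `h φ
(c, a) = φ (h c, a)`; the same comultiplication of `h` distributes over the slots on both sides. -/
theorem map₂_diagAct {H : Type w} [Ring H] [HopfAlgebra k H] {ρC : H →ₗ[k] C →ₗ[k] C}
    {ρA : H →ₗ[k] A →ₗ[k] A} {ρY : H →ₗ[k] Y →ₗ[k] Y} {ρZ : H →ₗ[k] Z →ₗ[k] Z}
    {ψ : A →ₗ[k] C →ₗ[k] A} {G : X →ₗ[k] Y →ₗ[k] Z} (hψ : ∀ h a c, ρA h (ψ a c) = ψ a (ρC h c))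
    (hG : ∀ h x y, ρZ h (G x y) = G x (ρY h y)) (h : H) (x : A ⊗[k] X) (y : C ⊗[k] Y) :
    diagAct k ρA ρZ h (TensorProduct.map₂ ψ G x y) =
      TensorProduct.map₂ ψ G x (diagAct k ρC ρY h y) := by
  simp only [diagAct, LinearMap.comp_apply]
  induction x with
  | zero => simp
  | add x x' hx hx' => simp only [map_add, LinearMap.add_apply, hx, hx']
  | tmul a x =>
  induction y with
  | zero => simp
  | add y y' hy hy' => simp only [map_add, hy, hy']
  | tmul c y =>
  induction Coalgebra.comul (R := k) h with
  | zero => simp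
  | add p q hp hq => simp only [map_add, LinearMap.add_apply, hp, hq]
  | tmul p q => simp [hψ, hG]

theorem diagAct_mul {H : Type w} [Ring H] [HopfAlgebra k H] {ρY : H →ₗ[k] Y →ₗ[k] Y}
    {ρZ : H →ₗ[k] Z →ₗ[k] Z} (hY : ∀ g h y, ρY g (ρY h y) = ρY (g * h) y)
    (hZ : ∀ g h z, ρZ g (ρZ h z) = ρZ (g * h) z) (g h : H) (x : Y ⊗[k] Z) :
    diagAct k ρY ρZ g (diagAct k ρY ρZ h x) = diagAct k ρY ρZ (g * h) x := by
  simp only [diagAct, LinearMap.comp_apply, Bialgebra.comul_mul]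
  induction x with
  | zero => simp
  | add x x' hx hx' => simp only [map_add, hx, hx']
  | tmul y z =>
  induction Coalgebra.comul (R := k) g with
  | zero => simp
  | add p q hp hq => simp only [map_add, LinearMap.add_apply, add_mul, hp, hq]
  | tmul p p' =>
  induction Coalgebra.comul (R := k) h with
  | zero => simp
  | add q r hq hr => simp only [map_add, LinearMap.add_apply, mul_add, hq, hr]
  | tmul q q' => simp [hY, hZ]

variable [Coalgebra k C] {H : Type w} [Ring H] [HopfAlgebra k H] [Module H C] [Module H A]
  (hφ : IsEquivariantAction k H φ)

include hφ

/-- The axiom `φ (c₍₁₎, a) φ (c₍₂₎, b) = φ (c, a b)` in the first slot, with the tail carried along.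
-/
theorem IsEquivariantAction.mF_map₂_cF (G : X →ₗ[k] Y →ₗ[k] Z) (x : A ⊗[k] (A ⊗[k] X))
    (y : C ⊗[k] Y) :
    mF k A Z (TensorProduct.map₂ φ.flip (TensorProduct.map₂ φ.flip G) x (cF k C Y y)) =
      TensorProduct.map₂ φ.flip G (mF k A X x) y := by
  induction x with
  | zero => simp
  | add x x' hx hx' => simp only [map_add, LinearMap.add_apply, hx, hx']
  | tmul a x =>
  induction x with
  | zero => simp
  | add x x' hx hx' =>
    simp only [TensorProduct.tmul_add, map_add, LinearMap.add_apply, hx, hx']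
  | tmul b x =>
  induction y with
  | zero => simp
  | add y y' hy hy' => simp only [map_add, hy, hy']
  | tmul c y =>
  have h₁ : ∀ z : C ⊗[k] C, mF k A Z (TensorProduct.map₂ φ.flip (TensorProduct.map₂ φ.flip G)
      (a ⊗ₜ (b ⊗ₜ x)) (TensorProduct.assoc k C C Y (z ⊗ₜ y))) =
      (LinearMap.mul' k A (TensorProduct.map₂ φ φ z (a ⊗ₜ b))) ⊗ₜ G x y := by
    intro z
    induction z with
    | zero => simp
    | add p q hp hq =>
      simp only [TensorProduct.add_tmul, map_add, LinearMap.add_apply, hp, hq]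
    | tmul p q => simp [mF_tmul]
  refine (h₁ (Coalgebra.comul c)).trans ?_
  rw [← hφ.map_mul, mF_tmul, TensorProduct.map₂_apply_tmul, TensorProduct.map_tmul,
    LinearMap.flip_apply]

/-- The axiom `φ (c, 1) = ε (c) 1` in the first slot. -/
theorem IsEquivariantAction.uF_eF (G : X →ₗ[k] Y →ₗ[k] Z) (x : X) (y : C ⊗[k] Y) :
    uF k A Z (G x (eF k C Y y)) = TensorProduct.map₂ φ.flip G (uF k A X x) y := by
  induction y with
  | zero => simp
  | add y y' hy hy' => simp only [map_add, hy, hy']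
  | tmul c y =>
    rw [eF_tmul, map_smul, map_smul, uF, uF, TensorProduct.mk_apply, TensorProduct.mk_apply,
      TensorProduct.map₂_apply_tmul, TensorProduct.map_tmul, LinearMap.flip_apply, hφ.map_one,
      TensorProduct.smul_tmul']

end Slots

variable {k φ} [Coalgebra k C] {H : Type w} [Ring H] [HopfAlgebra k H] [Module H C] [Module H A]
  (hφ : IsEquivariantAction k H φ)

include hφ

theorem IsEquivariantAction.alD_tpowPair_coD (n i : ℕ) (hi : i ≤ n) (x : tpow k A k (n + 2))
    (y : tpow k C M (n + 1)) :
    alD k M A n i (tpowPair k φ M (n + 2) x (coD k M C n i y)) =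
      tpowPair k φ M (n + 1) (alD k k A n i x) y := by
  induction n generalizing i with
  | zero =>
    obtain rfl : i = 0 := by omega
    exact hφ.mF_map₂_cF _ _ _
  | succ n ih =>
    match i with
    | 0 => exact hφ.mF_map₂_cF _ _ _
    | i + 1 => exact lTensor_map₂_lTensor (fun x y => ih i (by omega) x y) x y

theorem IsEquivariantAction.alU_tpowPair_coE (n i : ℕ) (hi : i ≤ n) (x : tpow k A k n)
    (y : tpow k C M (n + 1)) :
    alU k M A n i (tpowPair k φ M n x (coE k M C n i y)) =
      tpowPair k φ M (n + 1) (alU k k A n i x) y := by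
  induction n generalizing i with
  | zero =>
    obtain rfl : i = 0 := by omega
    exact hφ.uF_eF _ _ _
  | succ n ih =>
    match i with
    | 0 => exact hφ.uF_eF _ _ _
    | i + 1 => exact lTensor_map₂_lTensor (fun x y => ih i (by omega) x y) x y

/-! ### Compatibility of the pairing with the diagonal action and with the cyclic operators. -/

section

variable [IsScalarTower k H C] [IsScalarTower k H A]

theorem IsEquivariantAction.tpowAct_tpowPair (ρ : H →ₗ[k] M →ₗ[k] M) (n : ℕ) (h : H)
    (x : tpow k A k n) (y : tpow k C M n) :
    tpowAct k (act k H A) ρ n h (tpowPair k φ M n x y) =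
      tpowPair k φ M n x (tpowAct k (act k H C) ρ n h y) := by
  induction n generalizing h with
  | zero => exact (ρ h).map_smul x y
  | succ n ih =>
    exact map₂_diagAct (fun h a c => hφ.smul_map h c a) (fun h x y => ih h x y) h x y

variable [LeftComodule k H M] (hS : Function.Bijective (HopfAlgebra.antipode k : H →ₗ[k] H))

/-- By equivariance the twist `m₍₋₁₎ c` of the slot moved to the end becomes `m₍₋₁₎ φ (c, a)`, so
the algebra variable is rotated without a twist. All three maps rotate in the same direction: this
is `t` on the coalgebra side, but the inverse of `t` on both algebra sides. -/
theorem IsEquivariantAction.tpowPair_push (n : ℕ) (x : tpow k A k (n + 1))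
    (y : tpow k C M (n + 1)) :
    tpowPair k φ M (n + 1) (push k (LinearEquiv.refl k (A ⊗[k] k)) n x)
        (push k (hopfTwist k C M hS) n y) =
      push k (hopfTwist k A M hS) n (tpowPair k φ M (n + 1) x y) := by
  induction n with
  | zero =>
    have h : ∀ (x : A ⊗[k] k) (y : C ⊗[k] M), TensorProduct.map₂ φ.flip (LinearMap.lsmul k M) x
        (wMap k C M (LinearMap.id : H →ₗ[k] H) y) =
        wMap k A M (LinearMap.id : H →ₗ[k] H)
          (TensorProduct.map₂ φ.flip (LinearMap.lsmul k M) x y) := by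
      intro x y
      induction x with
      | zero => simp
      | add x x' hx hx' => simp only [map_add, LinearMap.add_apply, hx, hx']
      | tmul a r =>
      induction y with
      | zero => simp
      | add y y' hy hy' => simp only [map_add, hy, hy']
      | tmul c m =>
      rw [TensorProduct.map₂_apply_tmul, TensorProduct.map_tmul, wMap_tmul, wMap_tmul,
        LinearMap.lsmul_apply, map_smul, LinearMap.flip_apply]
      induction (LeftComodule.coact m : H ⊗[k] M) with
      | zero => simp
      | add p q hp hq => simp only [map_add, smul_add, hp, hq]
      | tmul p m => simp [slotAct, hφ.smul_map]
    exact h x y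
  | succ n ih =>
    -- `push` swaps the first two slots and then pushes within the tail. The tail is the induction
    -- hypothesis and the swap is compatible with the slotwise pairing.
    refine (map₂_lTensor_lTensor (ψ := φ.flip) (G := tpowPair k φ M (n + 1))
      (G' := tpowPair k φ M (n + 1)) (f := (push k (hopfTwist k A M hS) n).toLinearMap)
      (g := (push k (hopfTwist k C M hS) n).toLinearMap)
      (r := (push k (LinearEquiv.refl k (A ⊗[k] k)) n).toLinearMap) ih _ _).trans ?_
    exact congrArg (LinearMap.lTensor A (push k (hopfTwist k A M hS) n).toLinearMap)
      (map₂_leftComm φ.flip (tpowPair k φ M n) x y)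

end

end Pairing

/-! ## The morphism `α` -/

section Alpha

variable {k : Type u} [Field k] {H : Type w} [Ring H] [HopfAlgebra k H]
  (hS : Function.Bijective (HopfAlgebra.antipode k : H →ₗ[k] H))
  {C A M : Type u} [AddCommGroup C] [Module k C] [Coalgebra k C] [Module H C]
  [IsScalarTower k H C] [ModuleCoalgebra k H C]
  [Ring A] [Algebra k A] [Module H A] [IsScalarTower k H A] [ModuleAlgebra k H A]
  [AddCommGroup M] [Module k M] [Module H M] [IsScalarTower k H M] [LeftComodule k H M]

theorem diagHomFunctor_map_smul (Y : CyclicModule k) {X X' : CocyclicModule k} (r : k)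
    (f : X ⟶ X') : (diagHomFunctor Y).map (r • f).op = r • (diagHomFunctor Y).map f.op := by
  ext n g
  exact LinearMap.ext fun x => map_smul (show X'.obj n.unop →ₗ[k] Y.obj n from g) r
    ((f.app n.unop).hom x)

theorem tpowAct_mul {V M : Type u} [AddCommGroup V] [Module k V] [AddCommGroup M] [Module k M]
    {ρ : H →ₗ[k] V →ₗ[k] V} {ρ' : H →ₗ[k] M →ₗ[k] M} (h₁ : ∀ g h y, ρ g (ρ h y) = ρ (g * h) y)
    (h₂ : ∀ g h z, ρ' g (ρ' h z) = ρ' (g * h) z) (n : ℕ) (g h : H) (x : tpow k V M n) :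
    tpowAct k ρ ρ' n g (tpowAct k ρ ρ' n h x) = tpowAct k ρ ρ' n (g * h) x := by
  induction n generalizing g h with
  | zero => exact h₂ g h x
  | succ n ih => exact diagAct_mul h₁ (fun g h x => ih g h x) g h x

theorem act_mul (X : Type u) [AddCommGroup X] [Module k X] [Module H X] [IsScalarTower k H X]
    (g h : H) (x : X) : act k H X g (act k H X h x) = act k H X (g * h) x :=
  (mul_smul g h x).symm

/-- `t` moves `m₍₋₁₎ c⁰` to the last slot, to which `s n` applies the counit. As `ε (m₍₋₁₎ c⁰) m₍₀₎
= ε (c⁰) m`, the composite is the counit on slot `0`, which is `H`-linear although `t` need not be.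
-/
theorem coverC_L_s_t (n : ℕ) (h : H) (x : (coverC k hS C M).X (n + 1)) :
    (coverC k hS C M).L n h ((coverC k hS C M).s n n le_rfl ((coverC k hS C M).t (n + 1) x)) =
      (coverC k hS C M).s n n le_rfl
        ((coverC k hS C M).t (n + 1) ((coverC k hS C M).L (n + 1) h x)) := by
  have h₁ : ∀ x, (coverC k hS C M).s n n le_rfl ((coverC k hS C M).t (n + 1) x) =
      coE k M C (n + 1) 0 x :=
    LinearMap.congr_fun (coE_push k (hopfCoTwist k hS C M) (n + 1))
  rw [h₁, h₁]
  exact tpowAct_coE k _ (n + 1) 0 (Nat.zero_le _) h x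

theorem coverC_J_le_commSub (n : ℕ) {x : (coverC k hS C M).X n}
    (hx : x ∈ (coverC k hS C M).J n) : x ∈ (coverC k hS C M).commSub n :=
  (coverC k hS C M).J_le_commSub
    (fun n g h x => tpowAct_mul (act_mul C) (act_mul M) (n + 1) g h x) (coverC_L_s_t hS) n hx

variable {φ : C →ₗ[k] A →ₗ[k] A} (hφ : IsEquivariantAction k H φ)

variable (φ) in
/-- The pairing `A^{⊗ n + 1} ⊗ T_n (C, M) → T_n (A, M)` of the cover complexes. -/
def coverPair (n : ℕ) :
    tpow k A k (n + 1) →ₗ[k] (coverC k hS C M).X n →ₗ[k] (coverA k hS A M).X n :=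
  tpowPair k φ M (n + 1)

include hφ

theorem coverPair_L (n : ℕ) (h : H) (x : tpow k A k (n + 1)) (y : (coverC k hS C M).X n) :
    coverPair hS φ n x ((coverC k hS C M).L n h y) =
      (coverA k hS A M).L n h (coverPair hS φ n x y) :=
  (hφ.tpowAct_tpowPair M (act k H M) (n + 1) h x y).symm

/-- The exponent changes sign because `t` on `T_n (A, M)` is the inverse of a push. Viewing the
pairing as one linear map on the tensor product reduces all integer exponents to the single rotation
`tpowPair_push`. -/
theorem coverPair_t_zpow (n : ℕ) (i : ℤ) (x : tpow k A k (n + 1)) (y : (coverC k hS C M).X n) :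
    coverPair hS φ n ((push k (LinearEquiv.refl k (A ⊗[k] k)) n ^ i) x)
        (((coverC k hS C M).t n ^ i) y) =
      ((coverA k hS A M).t n ^ (-i)) (coverPair hS φ n x y) := by
  have h := map_zpow_apply (TensorProduct.lift (coverPair hS φ n))
    (TensorProduct.congr (push k (LinearEquiv.refl k (A ⊗[k] k)) n) ((coverC k hS C M).t n))
    ((coverA k hS A M).t n)⁻¹ (fun z => by
      induction z with
      | zero => simp
      | add z z' hz hz' => simp only [map_add, hz, hz']
      | tmul x y =>
        rw [TensorProduct.congr_tmul, TensorProduct.lift.tmul, TensorProduct.lift.tmul]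
        exact hφ.tpowPair_push M hS n x y) i (x ⊗ₜ y)
  rw [TensorProduct.congr_zpow, TensorProduct.congr_tmul, TensorProduct.lift.tmul,
    TensorProduct.lift.tmul] at h
  rw [h, zpow_neg, ← inv_zpow]

/-- The step on which the descent of the pairing depends. A commutator `[L_h, t ^ i] Ψ` paired with
`x` becomes `[L_h, t ^ (-i)]` applied to the pairing of a rotated `x` with `Ψ`. The element `(t ^ (n
+ 1) - 1) Φ` becomes `t ^ (-(n + 1)) - 1` applied to a pairing, because a full turn of `x` is the
identity. -/
theorem coverPair_mem_J (n : ℕ) (x : tpow k A k (n + 1)) {y : (coverC k hS C M).X n}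
    (hy : y ∈ (coverC k hS C M).J n) : coverPair hS φ n x y ∈ (coverA k hS A M).J n := by
  -- The rotation is moved from `y` to `x`. The rotated `x` does not involve `h`, so both terms of a
  -- commutator see the same algebra variable.
  have key : ∀ (i : ℤ) (x : tpow k A k (n + 1)) (y : (coverC k hS C M).X n),
      coverPair hS φ n x (((coverC k hS C M).t n ^ i) y) =
      ((coverA k hS A M).t n ^ (-i)) (coverPair hS φ n
        ((push k (LinearEquiv.refl k (A ⊗[k] k)) n ^ (-i)) x) y) := by
    intro i x y
    rw [← coverPair_t_zpow hS hφ, ← LinearEquiv.mul_apply, ← zpow_add, add_neg_cancel, zpow_zero]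
    rfl
  refine (coverC k hS C M).map_commSub ((coverA k hS A M).J n) (coverPair hS φ n x)
    (fun h i Ψ => ?_) (fun Φ => ?_) (coverC_J_le_commSub hS n hy)
  · have h₁ := (coverA k hS A M).J_admissible.gen n h (-i) (coverPair hS φ n
      ((push k (LinearEquiv.refl k (A ⊗[k] k)) n ^ (-i)) x) Ψ) 0
    rw [map_zero, sub_zero, add_zero] at h₁
    rw [map_sub, coverPair_L hS hφ, key, key, coverPair_L hS hφ]
    exact h₁
  · have h₁ := key (n + 1 : ℕ) x Φ
    have h₂ : (push k (LinearEquiv.refl k (A ⊗[k] k)) n ^ (-((n + 1 : ℕ) : ℤ))) x = x := by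
      rw [zpow_neg, zpow_natCast]
      exact (LinearEquiv.symm_apply_eq _).2 (push_refl_pow k n x).symm
    rw [h₂, zpow_natCast] at h₁
    rw [map_sub, h₁]
    -- The commutator part of the generator is zero. With `z` the pairing of `x` and `Φ`, the choice
    -- `-t ^ (-(n + 1)) z` for its second argument turns `t ^ (n + 1) - 1` into the required `t ^
    -- (-(n + 1)) z - z`.
    have h₃ := (coverA k hS A M).J_admissible.gen n (0 : H) 0 0
      (-(((coverA k hS A M).t n ^ (-((n + 1 : ℕ) : ℤ))) (coverPair hS φ n x Φ)))
    rw [← zpow_natCast, map_neg, ← LinearEquiv.mul_apply, ← zpow_add, add_neg_cancel, zpow_zero,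
      map_zero, map_zero, map_zero, sub_zero, zero_add, sub_neg_eq_add, neg_add_eq_sub] at h₃
    exact h₃

/-- The pairing maps `J` into `J` and is `H`-linear, while `h` acts by `ε h` on the target. The
factorization is made with values in the linear maps on `A^{⊗ n + 1}`, so that linearity in both
variables comes for free. -/
theorem exists_alphaDeg (n : ℕ) : ∃ f : tpow k A k (n + 1) →ₗ[k]
    (hopfC k hS C M).deg n →ₗ[k] (hopfA k hS A M).deg n, ∀ x y,
      f x ((coverC k hS C M).toHopf (Coalgebra.counit (R := k) (A := H)) n y) =
        (coverA k hS A M).toHopf (Coalgebra.counit (R := k) (A := H)) n (coverPair hS φ n x y) := by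
  obtain ⟨f, hf⟩ := (coverC k hS C M).exists_lift_toHopf (Coalgebra.counit (R := k) (A := H))
    ((coverPair hS φ n).compr₂
      ((coverA k hS A M).toHopf (Coalgebra.counit (R := k) (A := H)) n)).flip
    (fun y hy => LinearMap.ext fun x =>
      (coverA k hS A M).toHopf_eq_zero _ (coverPair_mem_J hS hφ n x hy))
    (fun h y => LinearMap.ext fun x =>
      (congrArg _ (coverPair_L hS hφ n h x y)).trans ((coverA k hS A M).toHopf_L _ h _))
  exact ⟨f.flip, fun x y => LinearMap.congr_fun (hf y) x⟩

/-- The component of `α` in degree `n`. -/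
noncomputable def alphaDeg (n : ℕ) :
    tpow k A k (n + 1) →ₗ[k] (hopfC k hS C M).deg n →ₗ[k] (hopfA k hS A M).deg n :=
  (exists_alphaDeg hS hφ n).choose

theorem alphaDeg_toHopf (n : ℕ) (x : tpow k A k (n + 1)) (y : (coverC k hS C M).X n) :
    alphaDeg hS hφ n x ((coverC k hS C M).toHopf (Coalgebra.counit (R := k) (A := H)) n y) =
      (coverA k hS A M).toHopf (Coalgebra.counit (R := k) (A := H)) n (coverPair hS φ n x y) :=
  (exists_alphaDeg hS hφ n).choose_spec x y

theorem coverPair_d (n i : ℕ) (hi : i ≤ n + 1) (x : tpow k A k (n + 2))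
    (y : (coverC k hS C M).X n) :
    coverPair hS φ n (alFace k (alTwistRefl k A) n i x) y =
      (coverA k hS A M).d n i hi (coverPair hS φ (n + 1) x ((coverC k hS C M).d n i hi y)) := by
  change tpowPair k φ M (n + 1) (alFace k (alTwistRefl k A) n i x) y =
    alFace k (hopfAlTwist k hS A M) n i
      (tpowPair k φ M (n + 2) x (coFace k (hopfCoTwist k hS C M) n i y))
  change tpow k C M (n + 1) at y
  rcases Nat.lt_or_ge n i with hlt | hle
  · obtain rfl : i = n + 1 := by omega
    -- The last operator is `d 0` after the inverse push on the algebra sides and the push after `d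
    -- 0` on the coalgebra side. With `x` written as a push, all rotations cancel and the case of `d
    -- 0` remains.
    obtain ⟨x, rfl⟩ := (push k (alTwistRefl k A).w (n + 1)).surjective x
    rw [alFace_last, alFace_last, coFace_last]
    simp only [LinearMap.comp_apply, LinearEquiv.coe_coe, LinearEquiv.symm_apply_apply]
    rw [← hφ.alD_tpowPair_coD M n 0 (Nat.zero_le n)]
    refine (congrArg (alD k M A n 0) ((LinearEquiv.symm_apply_eq _).2 ?_)).symm
    exact hφ.tpowPair_push M hS (n + 1) x _
  · rw [alFace_le k _ hle, alFace_le k _ hle, coFace_le k _ hle]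
    exact (hφ.alD_tpowPair_coD M n i hle x y).symm

theorem coverPair_s (n i : ℕ) (hi : i ≤ n) (x : tpow k A k (n + 1))
    (y : (coverC k hS C M).X (n + 1)) :
    coverPair hS φ (n + 1) (alU k k A (n + 1) (i + 1) x) y =
      (coverA k hS A M).s n i hi (coverPair hS φ n x ((coverC k hS C M).s n i hi y)) :=
  (hφ.alU_tpowPair_coE M (n + 1) (i + 1) (by omega) x y).symm

theorem coverPair_t (n : ℕ) (x : tpow k A k (n + 1)) (y : (coverC k hS C M).X n) :
    coverPair hS φ n ((push k (LinearEquiv.refl k (A ⊗[k] k)) n).symm x) y =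
      (coverA k hS A M).t n (coverPair hS φ n x ((coverC k hS C M).t n y)) := by
  obtain ⟨x, rfl⟩ := (push k (LinearEquiv.refl k (A ⊗[k] k)) n).surjective x
  rw [LinearEquiv.symm_apply_apply]
  exact ((LinearEquiv.symm_apply_eq _).2 (hφ.tpowPair_push M hS n x y)).symm

/-- `a`, `b` and `c` describe the action of `f` on representatives. Since the projection from `T_m
(C, M)` is onto, naturality of `α` at `f` reduces to the dinaturality `h` of the pairing on the
cover complexes. -/
theorem alphaDeg_naturality {m n : ℕ} (f : CycCat.mk m ⟶ CycCat.mk n)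
    (a : tpow k A k (n + 1) → tpow k A k (m + 1))
    (b : (coverA k hS A M).X n → (coverA k hS A M).X m)
    (c : (coverC k hS C M).X m → (coverC k hS C M).X n)
    (ha : ∀ x, ((cycAlg k A).map f.op).hom x = a x)
    (hb : ∀ z, ((hopfA k hS A M).map f.op).hom
      ((coverA k hS A M).toHopf (Coalgebra.counit (R := k) (A := H)) n z) =
        (coverA k hS A M).toHopf (Coalgebra.counit (R := k) (A := H)) m (b z))
    (hc : ∀ y, ((hopfC k hS C M).map f).hom
      ((coverC k hS C M).toHopf (Coalgebra.counit (R := k) (A := H)) m y) =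
        (coverC k hS C M).toHopf (Coalgebra.counit (R := k) (A := H)) n (c y))
    (h : ∀ x y, coverPair hS φ m (a x) y = b (coverPair hS φ n x (c y))) :
    (cycAlg k A).map f.op ≫ ModuleCat.ofHom (alphaDeg hS hφ m) =
      ModuleCat.ofHom (alphaDeg hS hφ n) ≫
        (diagHom (hopfC k hS C M) (hopfA k hS A M)).map f.op := by
  ext x z
  obtain ⟨y, rfl⟩ := (coverC k hS C M).toHopf_surjective _ m z
  refine (congrArg (fun x => alphaDeg hS hφ m x _) (ha x)).trans ?_
  refine (alphaDeg_toHopf hS hφ m (a x) y).trans ?_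
  refine (congrArg _ (h x y)).trans ((hb _).symm.trans ?_)
  exact congrArg ((hopfA k hS A M).map f.op).hom ((alphaDeg_toHopf hS hφ n x (c y)).symm.trans
    (congrArg (alphaDeg hS hφ n x) (hc y).symm))

/-- The morphism `α : Cyc_• (A) → diagHom (C_• (C, M), C_• (A, M))`. -/
noncomputable def alpha : cycAlg k A ⟶ diagHom (hopfC k hS C M) (hopfA k hS A M) :=
  CycCat.natTrans (fun n => ModuleCat.ofHom (alphaDeg hS hφ n))
    (fun n i hi => alphaDeg_naturality hS hφ _ _ _ _
      (fun x => congrArg (fun g => g.hom x) (ParaCyclic.toCyclic_map_δ _ _ n i hi))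
      ((coverA k hS A M).hopf_map_δ _ n i hi) ((coverC k hS C M).hopf_map_δ _ n i hi)
      (coverPair_d hS hφ n i hi))
    (fun n i hi => alphaDeg_naturality hS hφ _ _ _ _
      (fun x => congrArg (fun g => g.hom x) (ParaCyclic.toCyclic_map_σ _ _ n i hi))
      ((coverA k hS A M).hopf_map_σ _ n i hi) ((coverC k hS C M).hopf_map_σ _ n i hi)
      (coverPair_s hS hφ n i hi))
    (fun n => alphaDeg_naturality hS hφ _ _ _ _
      (fun x => congrArg (fun g => g.hom x) (ParaCyclic.toCyclic_map_τ _ _ n))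
      ((coverA k hS A M).hopf_map_τ _ n) ((coverC k hS C M).hopf_map_τ _ n)
      (coverPair_t hS hφ n))

end Alpha

end HopfCyclic

/-! ### The theorem. -/

open HopfCyclic

theorem mainTheorem1 {k : Type u} [Field k] {H : Type w} [Ring H] [HopfAlgebra k H]
    (hS : Function.Bijective (HopfAlgebra.antipode k : H →ₗ[k] H))
    {C : Type u} [AddCommGroup C] [Module k C] [Coalgebra k C] [Module H C] [IsScalarTower k H C]
    [ModuleCoalgebra k H C]
    {A : Type u} [Ring A] [Algebra k A] [Module H A] [IsScalarTower k H A] [ModuleAlgebra k H A]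
    (φ : C →ₗ[k] A →ₗ[k] A) (hφ : IsEquivariantAction k H φ)
    {M : Type u} [AddCommGroup M] [Module k M] [Module H M] [IsScalarTower k H M]
    [LeftComodule k H M] :
    ∃ (α : cycAlg k A ⟶ diagHom (hopfC k hS C M) (hopfA k hS A M))
      (e : diagHom (kCocyc k) (hopfA k hS A M) ≅ hopfA k hS A M),
      (∀ (n : ℕ) (a : ℕ → A) (c : ℕ → C) (m : M),
        diagHom.eval ((α.app (Opposite.op (CycCat.mk n))).hom (cycAlg.cls k n a))
            (hopfC.cls k hS C M n c m) =
          hopfA.cls k hS A M n (fun i => φ (c i) (a i)) m) ∧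
      (∀ (n : ℕ) (g : (diagHom (kCocyc k) (hopfA k hS A M)).deg n),
        (e.hom.app (Opposite.op (CycCat.mk n))).hom g =
          diagHom.eval g (cocycCoalg.cls k n fun _ => (1 : k))) ∧
      ∀ p q : ℕ, ∃! cup : HCHopfC k hS C M p ⊗[k] HCHopfA k hS A M q →ₗ[k] HC k A (p + q),
        ∀ (ξ : YonedaSeq (kCocyc k) (hopfC k hS C M) p) (ν : HCHopfA k hS A M q),
          cup (ξ.ext ⊗ₜ[k] ν) =
            (Abelian.Ext.mk₀ α).comp
              ((ξ.extMap (diagHomFunctor (hopfA k hS A M)) (diagHomFunctor_shortExact _)).comp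
                ((Abelian.Ext.mk₀ e.hom).comp ν (zero_add q)) rfl)
              (zero_add (p + q)) := by
  refine ⟨alpha hS hφ, diagHomUnitIso k (hopfA k hS A M), fun n a c m => ?_, fun n g => rfl,
    fun p q => ?_⟩
  · refine (alphaDeg_toHopf hS hφ n (tens k (n + 1) a (1 : k)) (tens k (n + 1) c m)).trans ?_
    exact congrArg _ (tpowPair_tens k φ M (n + 1) a c m)
  -- `T` is the action of the exact functor `diagHom (-, C_• (A, M))` on Ext classes of degree `p`,
  -- and `B` is the defining formula of the pairing with `T` in place of the image of a chosen
  -- sequence.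
  · let T := (extTransformation.{u} k (diagHomFunctor (hopfA k hS A M))
      (diagHomFunctor_shortExact (hopfA k hS A M)) (diagHomFunctor_map_smul _) p).map (kCocyc k) (hopfC k hS C M)
    let B : HCHopfC k hS C M p →ₗ[k] HCHopfA k hS A M q →ₗ[k] HC k A (p + q) :=
      ((Abelian.Ext.bilinearCompOfLinear k _ _ _ p q (p + q) rfl).compl₁₂ T
        ((Abelian.Ext.mk₀ (diagHomUnitIso k (hopfA k hS A M)).hom).precompOfLinear k _
          (zero_add q))).compr₂
        ((Abelian.Ext.mk₀ (alpha hS hφ)).precompOfLinear k _ (zero_add (p + q)))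
    refine ⟨TensorProduct.lift B, fun ξ ν => ?_, fun cup hcup => ?_⟩
    · rw [TensorProduct.lift.tmul]
      rw [← extTransformation_ext k]
      rfl
    · refine TensorProduct.ext' fun x ν => ?_
      -- Uniqueness: every class of degree `p` is represented by a Yoneda sequence, so the
      -- prescribed values determine the map on all pure tensors.
      obtain ⟨ξ, rfl⟩ := YonedaSeq.ext_surjective x
      rw [hcup, TensorProduct.lift.tmul, ← extTransformation_ext k]
      rfl
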